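/- Let $f:\hat{\mathbb C}\to\hat{\mathbb C}$ be a rational map of degree at least two with a parabolic fixed point $p$ of multiplier $1$, of multiplicity $n+1\ge 2$ (so in a local coordinate $w$ with $p$ at $w=0$, $f(w)=w+aw^{n+1}+\cdots$ with $a\neq0$). Let $N$ be an open neighborhood of $p$ which $f$ maps injectively onto $N'=f(N)$. An attracting petal at $p$ is a connected open set $U$ with compact closure $\overline U\subset N\cap N'$ such that $f(\overline U)\subset U\cup\{p\}$ and $\bigcap_{k\ge0}f^{\circ k}(\overline U)=\{p\}$; a repelling petal is an attracting petal for $f^{-1}:N'\to N$. Let $U_1,\dots,U_n$ be disjoint attracting petals and $U'_1,\dots,U'_n$ disjoint repelling petals forming a Leau--Fatou flower: their union together with $p$ is a neighborhood of $p$, and each $U_i$ meets no repelling petals other than $U'_i$ and $U'_{i-1}$ (indices modulo $n$). The basin $\Omega_i$ consists of the points whose orbit eventually lands in $U_i$, and the immediate basin is the connected component of $\Omega_i$ containing $U_i$. A Fatou coordinate for $U_i$ is a function $\alpha:\Omega_i\to\mathbb C$, holomorphic on $\Omega_i$ and injective on $U_i$, with $\alpha(f(z))=1+\alpha(z)$ for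 all $z\in\Omega_i$. Then, for every $i$: (1) The immediate basin of $U_i$ (which contains $U_i$) contains at least one critical point of $f$. (2) A Fatou coordinate $\alpha$ for $U_i$ exists, and there is a set $U_i^*$ which, for every such $\alpha$, is the unique set with the following properties: it is a connected open subset of the immediate basin of $U_i$ with $f(\overline{U_i^*})\subset U_i^*\cup\{p\}$ and $\bigcap_{k\ge0}f^{\circ k}(\overline{U_i^*})=\{p\}$; it is mapped bijectively by $\alpha$ onto an open right half-plane $\{w:\operatorname{Re}w>c\}$ for some $c\in\mathbb R$; and its boundary contains at least one critical point of $f$. -/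

import Mathlib

noncomputable section

namespace RiemannSphere

/-- The Riemann sphere `ℂ ∪ {∞}`. -/
abbrev Sphere : Type := OnePoint ℂ

/-- The point `[a : b]` of the sphere, that is `a / b`, and `∞` when `b = 0`. -/
def quot (a b : ℂ) : Sphere :=
  open Classical in if b = 0 then OnePoint.infty else ((a / b : ℂ) : Sphere)

/-- The degree of a rational function written in lowest terms. -/
def degree (R : RatFunc ℂ) : ℕ := max R.num.natDegree R.denom.natDegree

/-- The self-map of the sphere defined by a rational function. The value at `∞` is read off from
the coefficients of index `degree R` of the numerator and of the denominator. -/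
def ratMap (R : RatFunc ℂ) : Sphere → Sphere
  | OnePoint.infty => quot (R.num.coeff (degree R)) (R.denom.coeff (degree R))
  | OnePoint.some z => quot (R.num.eval z) (R.denom.eval z)

/-- The local parametrization of the sphere around `x` sending `0` to `x`: it is `w ↦ a + w` around
a finite point `a`, and `w ↦ 1 / w` around `∞`. -/
def param : Sphere → ℂ → Sphere
  | OnePoint.infty => fun w => quot 1 w
  | OnePoint.some a => fun w => ((a + w : ℂ) : Sphere)

/-- The local coordinate around `x`, inverse to `param x`. Only its values near `x` matter. -/
def coord : Sphere → Sphere → ℂ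
  | OnePoint.infty, OnePoint.infty => 0
  | OnePoint.infty, OnePoint.some z => z⁻¹
  | OnePoint.some _, OnePoint.infty => 0
  | OnePoint.some a, OnePoint.some z => z - a

/-- The expression of `f` in the local coordinates around `x` and `f x`. -/
def localExpr (f : Sphere → Sphere) (x : Sphere) : ℂ → ℂ :=
  fun w => coord (f x) (f (param x w))

/-- `x` is a critical point of `f`: the derivative of `f` at `x`, in local coordinates, is `0`. -/
def IsCriticalPoint (f : Sphere → Sphere) (x : Sphere) : Prop :=
  HasDerivAt (localExpr f x) 0 0

/-- `p` is a fixed point of `f` of multiplicity `m`: in the local coordinate `w` at `p`, the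
function `f(w) - w` has a zero of order exactly `m` at the origin. -/
def IsFixedPointOfMultiplicity (f : Sphere → Sphere) (p : Sphere) (m : ℕ) : Prop :=
  f p = p ∧ analyticOrderAt (fun w => localExpr f p w - w) 0 = (m : ℕ∞)

/-- A complex valued function is holomorphic on the (open) set `Ω` of the sphere: in local
coordinates it is complex differentiable at every point of `Ω`. -/
def HolomorphicOn (α : Sphere → ℂ) (Ω : Set Sphere) : Prop :=
  ∀ x ∈ Ω, DifferentiableAt ℂ (fun w => α (param x w)) 0

/-- The dynamical conditions on a petal of `g` at `p`: a connected open set `U` with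
`g(closure U) ⊆ U ∪ {p}` and `⋂ₖ gᵏ(closure U) = {p}`.
(Closures are automatically compact, since the sphere is.) -/
structure IsPetalLike (g : Sphere → Sphere) (p : Sphere) (U : Set Sphere) : Prop where
  isOpen : IsOpen U
  isConnected : IsConnected U
  image_closure : g '' closure U ⊆ U ∪ {p}
  iInter_image : ⋂ k : ℕ, g^[k] '' closure U = {p}

/-- `U` is an attracting petal of `f` at `p`, with respect to an open neighborhood `N` of `p`
which `f` maps injectively onto `N' = f(N)`. -/
structure IsAttractingPetal (f : Sphere → Sphere) (p : Sphere) (N U : Set Sphere) : Prop where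
  closure_subset : closure U ⊆ N ∩ f '' N
  petalLike : IsPetalLike f p U

/-- `U` is a repelling petal of `f` at `p`: an attracting petal of the inverse
`f⁻¹ : N' → N` of `f : N → N' = f(N)`. -/
structure IsRepellingPetal (f : Sphere → Sphere) (p : Sphere) (N U : Set Sphere) : Prop where
  closure_subset : closure U ⊆ N ∩ f '' N
  petalLike : IsPetalLike (Function.invFunOn f N) p U

/-- A Leau–Fatou flower of `f` at a fixed point `p` of multiplicity `n + 1`: `n` disjoint attracting
petals `U i` and `n` disjoint repelling petals `U' i`, alternating with each other, which together
with `p` fill out a neighborhood of `p`. The indices are taken modulo `n`. -/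
structure IsFlower (f : Sphere → Sphere) (p : Sphere) (n : ℕ) (N : Set Sphere)
    (U U' : Fin n → Set Sphere) : Prop where
  isOpen : IsOpen N
  mem : p ∈ N
  injOn : Set.InjOn f N
  attracting : ∀ i, IsAttractingPetal f p N (U i)
  repelling : ∀ i, IsRepellingPetal f p N (U' i)
  disjoint_attracting : Pairwise fun i j => Disjoint (U i) (U j)
  disjoint_repelling : Pairwise fun i j => Disjoint (U' i) (U' j)
  alternate : ∀ i j, (U i ∩ U' j).Nonempty → j = i ∨ ((j : ℕ) + 1) % n = i
  nhds : (⋃ i, U i) ∪ (⋃ i, U' i) ∪ {p} ∈ nhds p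

/-- The basin of attraction of a petal: the points whose orbit eventually lands in it. -/
def basin (f : Sphere → Sphere) (U : Set Sphere) : Set Sphere :=
  {z | ∃ k : ℕ, f^[k] z ∈ U}

/-- The immediate basin of a (connected) petal `U`: the connected component of the basin that
contains `U`. -/
def immediateBasin (f : Sphere → Sphere) (U : Set Sphere) : Set Sphere :=
  ⋃ x ∈ U, connectedComponentIn (basin f U) x

/-- `α` is a Fatou coordinate of the attracting petal `U`, extended to the whole basin:
it is univalent on `U`, holomorphic on the basin, and satisfies the Abel equation there.
The values of `α` outside the basin are irrelevant. -/
structure IsFatouCoordinate (f : Sphere → Sphere) (U : Set Sphere) (α : Sphere → ℂ) : Prop where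
  injOn : Set.InjOn α U
  holomorphicOn : HolomorphicOn α (basin f U)
  abel : ∀ z ∈ basin f U, α (f z) = 1 + α z

/-- `V` is a preferred petal for the basin of the attracting petal `U`: it lies in the immediate
basin, satisfies the dynamical conditions of a petal, is mapped by `α` bijectively onto an open
right half-plane, and has a critical point of `f` on its boundary. Because of this critical point
the closure of `V` cannot lie in an open set on which `f` is injective. -/
structure IsPreferredPetal (f : Sphere → Sphere) (p : Sphere) (U : Set Sphere) (α : Sphere → ℂ)
    (V : Set Sphere) : Prop where
  subset_basin : V ⊆ immediateBasin f U
  petalLike : IsPetalLike f p V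
  bijOn : ∃ c : ℝ, Set.BijOn α V {w : ℂ | c < w.re}
  critical : ∃ x ∈ frontier V, IsCriticalPoint f x

end RiemannSphere

end

/-!
The theorem combines a local construction at the parabolic point `p` with a topological argument
about inverse branches of the Fatou coordinate.

Near `p` the coordinate `z = A / w ^ n` turns `f` into `z ↦ z + 1 + o(1)`
(`exists_parabolic_coordinate`). On a sector wider than a half-plane the iterates of this map,
normalized at a base point, converge to a solution `β` of the Abel equation whose difference with
the identity is a contraction (`exists_abel_of_sector`); hence `β` is injective and its image
contains a right half-plane. The `n` branches of the `n`-th root give `n` parabolic petals, which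
together absorb every orbit that converges to `p` without reaching it (`exists_parabolicPetals`).

The petals `U i` of a flower are arbitrary, but each is connected and so lies in the basin of one
parabolic petal. An orbit in a parabolic petal cannot change from one repelling petal to another,
nor remain in a repelling petal forever, so it enters some `U m`. There are as many petals as
parabolic petals, and therefore `U i` has exactly the basin `Ω` of one parabolic petal
(`IsFlower.exists_basin_eq`). Pulling back along orbits extends its Fatou coordinate `α` to `Ω`.
All Fatou coordinates on `Ω` differ by constants, because `β ∘ α⁻¹` extends to an injective entire
function, and such a function is affine (`exists_eq_affine_of_injective`).

An open set `V ⊆ Ω` that `α` maps bijectively onto a half-plane is called a sheet. Sheets with a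
common point are nested, and the union of those that contain a given one is the largest sheet `V`.
It does not lie over the whole plane: it would then be the complement of `p`, and `f` would be
injective there, against `not_injOn_ratMap`. Points of `V` tend to `p` as `α → ∞`, so the closure
of `V` adds only `p` and points over the boundary line, and `V` is petal-like
(`IsFatouBasin.isPetalLike_sheet`). If no critical point were on the boundary of `V`, then `f` would
be injective on a neighbourhood of the compact closure of `V`, and pulling `V` back by the inverse
of `f` would give a larger sheet (`IsFatouBasin.exists_sheet_extension`). The critical point found
in this way also lies in the immediate basin. Conversely, a critical point of `f` in `Ω` is a
critical point of `α` and so lies in no sheet, which excludes every other invariant sheet with a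
critical point on its boundary (`IsFatouBasin.exists_unique_critical_sheet`).
-/

noncomputable section

open Filter Topology Set

namespace RiemannSphere

/-! ### Injective holomorphic functions of one variable -/

theorem not_eventually_const_of_injOn {X : Type*} {g : ℂ → X} {O : Set ℂ} (hO : IsOpen O)
    (hi : InjOn g O) {z : ℂ} (hz : z ∈ O) : ¬ ∀ᶠ w in 𝓝 z, g w = g z := by
  intro h
  have h2 : ∀ᶠ w in 𝓝 z, w = z := by
    filter_upwards [h, hO.mem_nhds hz] with w hw hwO using hi hwO hz hw
  have h3 : ∀ᶠ w in 𝓝[≠] z, w = z := h2.filter_mono nhdsWithin_le_nhds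
  obtain ⟨w, hw, hw2⟩ := (h3.and self_mem_nhdsWithin).exists
  exact hw2 hw

theorem nhds_le_map_of_injOn {g : ℂ → ℂ} {O : Set ℂ} (hO : IsOpen O)
    (hg : DifferentiableOn ℂ g O) (hi : InjOn g O) {z : ℂ} (hz : z ∈ O) :
    𝓝 (g z) ≤ map g (𝓝 z) :=
  ((hg.analyticAt (hO.mem_nhds hz)).eventually_constant_or_nhds_le_map_nhds).resolve_left
    (not_eventually_const_of_injOn hO hi hz)

theorem isOpen_image_of_injOn {g : ℂ → ℂ} {O : Set ℂ} (hO : IsOpen O)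
    (hg : DifferentiableOn ℂ g O) (hi : InjOn g O) : IsOpen (g '' O) := by
  rw [isOpen_iff_mem_nhds]
  rintro _ ⟨z, hz, rfl⟩
  exact nhds_le_map_of_injOn hO hg hi hz (image_mem_map (hO.mem_nhds hz))

theorem continuousAt_invFunOn_of_injOn {g : ℂ → ℂ} {O : Set ℂ} (hO : IsOpen O)
    (hg : DifferentiableOn ℂ g O) (hi : InjOn g O) {z : ℂ} (hz : z ∈ O) :
    ContinuousAt (Function.invFunOn g O) (g z) := by
  intro s hs
  rw [hi.leftInvOn_invFunOn hz] at hs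
  have h1 : g '' (s ∩ O) ∈ 𝓝 (g z) :=
    nhds_le_map_of_injOn hO hg hi hz (image_mem_map (inter_mem hs (hO.mem_nhds hz)))
  rw [mem_map]
  filter_upwards [h1]
  rintro _ ⟨x, hx, rfl⟩
  simpa [hi.leftInvOn_invFunOn hx.2] using hx.1

theorem hasDerivAt_invFunOn_of_deriv_ne_zero {g : ℂ → ℂ} {O : Set ℂ} (hO : IsOpen O)
    (hg : DifferentiableOn ℂ g O) (hi : InjOn g O) {z : ℂ} (hz : z ∈ O) (hd : deriv g z ≠ 0) :
    HasDerivAt (Function.invFunOn g O) (deriv g z)⁻¹ (g z) := by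
  have h1 : HasDerivAt g (deriv g z) (Function.invFunOn g O (g z)) := by
    rw [hi.leftInvOn_invFunOn hz]
    exact (hg.differentiableAt (hO.mem_nhds hz)).hasDerivAt
  refine h1.of_local_left_inverse (continuousAt_invFunOn_of_injOn hO hg hi hz) hd ?_
  filter_upwards [(isOpen_image_of_injOn hO hg hi).mem_nhds (mem_image_of_mem g hz)] with y hy
  exact Function.invFunOn_eq hy

/-- The zeros of the derivative of an injective holomorphic function are isolated; the continuous
inverse is holomorphic off the corresponding values, hence everywhere by removability, and the
chain rule then excludes such zeros. -/
theorem deriv_ne_zero_of_injOn {g : ℂ → ℂ} {O : Set ℂ} (hO : IsOpen O)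
    (hg : DifferentiableOn ℂ g O) (hi : InjOn g O) {z : ℂ} (hz : z ∈ O) : deriv g z ≠ 0 := by
  have han : AnalyticAt ℂ g z := hg.analyticAt (hO.mem_nhds hz)
  have hpun : ∀ᶠ w in 𝓝[≠] z, deriv g w ≠ 0 := by
    rcases han.deriv.eventually_eq_zero_or_eventually_ne_zero with h | h
    · exfalso
      obtain ⟨r, hr, hrs⟩ := Metric.eventually_nhds_iff_ball.1 (h.and (hO.mem_nhds hz))
      apply not_eventually_const_of_injOn hO hi hz
      filter_upwards [Metric.ball_mem_nhds z hr] with w hw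
      refine (convex_ball z r).is_const_of_fderivWithin_eq_zero (𝕜 := ℂ)
        (hg.mono fun x hx => (hrs x hx).2) ?_ hw (Metric.mem_ball_self hr)
      intro x hx
      rw [fderivWithin_of_isOpen Metric.isOpen_ball hx]
      ext
      simpa using (hrs x hx).1
    · exact h
  set G := Function.invFunOn g O with hG
  have hcG := continuousAt_invFunOn_of_injOn hO hg hi hz
  -- a neighbourhood of `z` in `O` on whose punctured version the derivative does not vanish
  have hpun' : ∀ᶠ w in 𝓝 z, w ≠ z → deriv g w ≠ 0 := eventually_nhdsWithin_iff.1 hpun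
  obtain ⟨r, hr, hrs⟩ := Metric.eventually_nhds_iff_ball.1 (hpun'.and (hO.mem_nhds hz))
  have hBO : Metric.ball z r ⊆ O := fun x hx => (hrs x hx).2
  have hop : IsOpen (g '' Metric.ball z r) :=
    isOpen_image_of_injOn Metric.isOpen_ball (hg.mono hBO) (hi.mono hBO)
  have hmem : g '' Metric.ball z r ∈ 𝓝 (g z) :=
    hop.mem_nhds (mem_image_of_mem g (Metric.mem_ball_self hr))
  have hdG : DifferentiableOn ℂ G (g '' Metric.ball z r) := by
    rw [← Complex.differentiableOn_compl_singleton_and_continuousAt_iff hmem]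
    refine ⟨?_, hcG⟩
    rintro _ ⟨⟨x, hx, rfl⟩, hne⟩
    have hxz : x ≠ z := by rintro rfl; exact hne rfl
    exact (hasDerivAt_invFunOn_of_deriv_ne_zero hO hg hi (hBO hx)
      ((hrs x hx).1 hxz)).differentiableAt.differentiableWithinAt
  have hGd : DifferentiableAt ℂ G (g z) := hdG.differentiableAt hmem
  have hcomp : HasDerivAt (G ∘ g) (deriv G (g z) * deriv g z) z :=
    hGd.hasDerivAt.comp z (hg.differentiableAt (hO.mem_nhds hz)).hasDerivAt
  have hid : HasDerivAt (G ∘ g) 1 z := by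
    refine (hasDerivAt_id z).congr_of_eventuallyEq ?_
    filter_upwards [hO.mem_nhds hz] with w hw using hi.leftInvOn_invFunOn hw
  intro h0
  have := hcomp.unique hid
  simp [h0] at this

theorem hasDerivAt_invFunOn {g : ℂ → ℂ} {O : Set ℂ} (hO : IsOpen O)
    (hg : DifferentiableOn ℂ g O) (hi : InjOn g O) {z : ℂ} (hz : z ∈ O) :
    HasDerivAt (Function.invFunOn g O) (deriv g z)⁻¹ (g z) :=
  hasDerivAt_invFunOn_of_deriv_ne_zero hO hg hi hz (deriv_ne_zero_of_injOn hO hg hi hz)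

/-- An injective entire function `h` is affine. Outside the unit disc it omits a neighbourhood of
`h 0`, namely the image of the disc, so the entire function `w / (h w - h 0)` grows at most linearly.
By Liouville's theorem it is affine, and as it has no zero it is constant. -/
theorem exists_eq_affine_of_injective {h : ℂ → ℂ} (hd : Differentiable ℂ h)
    (hi : Function.Injective h) : ∃ a b : ℂ, a ≠ 0 ∧ ∀ w, h w = a * w + b := by
  have hiO : InjOn h univ := hi.injOn
  set q := dslope h 0 with hq
  have hqd : Differentiable ℂ q := by
    rw [← differentiableOn_univ]
    exact (Complex.differentiableOn_dslope univ_mem).2 hd.differentiableOn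
  have hmul : ∀ w, w * q w = h w - h 0 := by
    intro w; simpa using sub_smul_dslope h 0 w
  have hq0 : ∀ w, q w ≠ 0 := by
    intro w hw
    by_cases h0 : w = 0
    · subst h0
      rw [hq, dslope_same] at hw
      exact deriv_ne_zero_of_injOn isOpen_univ hd.differentiableOn hiO (mem_univ _) hw
    · have := hmul w
      rw [hw, mul_zero] at this
      exact h0 (hi (sub_eq_zero.1 this.symm))
  have hrd : Differentiable ℂ fun w => (q w)⁻¹ := hqd.inv hq0
  -- the image of the unit disc contains a disc of some radius `ε` around `h 0`
  have hopen : IsOpen (h '' Metric.ball 0 1) :=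
    isOpen_image_of_injOn Metric.isOpen_ball hd.differentiableOn (hi.injOn)
  obtain ⟨ε, hε, hεs⟩ := Metric.isOpen_iff.1 hopen (h 0)
    (mem_image_of_mem h (Metric.mem_ball_self one_pos))
  have hout : ∀ w, 1 ≤ ‖w‖ → ε ≤ ‖h w - h 0‖ := by
    intro w hw
    by_contra hlt
    push Not at hlt
    obtain ⟨x, hx, hxw⟩ := hεs (by simpa [dist_eq_norm] using hlt : h w ∈ Metric.ball (h 0) ε)
    have := hi hxw
    subst this
    simp at hx
    linarith
  have hgrow : ∀ w, 1 ≤ ‖w‖ → ‖(q w)⁻¹‖ ≤ ‖w‖ / ε := by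
    intro w hw
    have h1 : (0 : ℝ) < ‖w‖ := by linarith
    have h2 : ‖q w‖ = ‖h w - h 0‖ / ‖w‖ := by
      rw [← hmul w, norm_mul]; field_simp
    rw [norm_inv, h2, inv_div]
    exact div_le_div_of_nonneg_left h1.le hε (hout w hw)
  set r : ℂ → ℂ := fun w => (q w)⁻¹ with hr
  set s := dslope r 0 with hs
  have hsd : Differentiable ℂ s := by
    rw [← differentiableOn_univ]
    exact (Complex.differentiableOn_dslope univ_mem).2 hrd.differentiableOn
  have hmul2 : ∀ w, w * s w = r w - r 0 := by
    intro w; simpa using sub_smul_dslope r 0 w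
  obtain ⟨C, hC⟩ := (isCompact_closedBall (0 : ℂ) 1).exists_bound_of_continuousOn
    hsd.continuous.continuousOn
  have hsb : Bornology.IsBounded (range s) := by
    rw [isBounded_iff_forall_norm_le]
    refine ⟨max C (1 / ε + ‖r 0‖), ?_⟩
    rintro _ ⟨w, rfl⟩
    by_cases hw : ‖w‖ ≤ 1
    · exact (hC w (by simpa using hw)).trans (le_max_left _ _)
    · push Not at hw
      refine le_trans ?_ (le_max_right _ _)
      have h1 : (0 : ℝ) < ‖w‖ := by linarith
      have h2 : ‖w‖ * ‖s w‖ ≤ ‖w‖ / ε + ‖r 0‖ := by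
        rw [← norm_mul, hmul2]
        exact (norm_sub_le _ _).trans (by gcongr; exact hgrow w hw.le)
      have h3 : ‖r 0‖ ≤ ‖w‖ * ‖r 0‖ := le_mul_of_one_le_left (norm_nonneg _) hw.le
      have h4 : ‖w‖ * ‖s w‖ ≤ ‖w‖ * (1 / ε + ‖r 0‖) := by
        calc _ ≤ ‖w‖ / ε + ‖w‖ * ‖r 0‖ := by linarith
          _ = _ := by ring
      exact le_of_mul_le_mul_left h4 h1
  obtain ⟨c, hc⟩ := hsd.exists_const_forall_eq_of_bounded hsb
  have hrw : ∀ w, r w = r 0 + c * w := by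
    intro w
    have := hmul2 w
    rw [hc w] at this
    linear_combination -this
  -- an affine function without zeros is constant
  have hc0 : c = 0 := by
    by_contra hc0
    have h1 := hrw (-(r 0) / c)
    have h2 : r (-(r 0) / c) = 0 := by rw [h1]; field_simp; ring
    exact inv_ne_zero (hq0 _) h2
  refine ⟨q 0, h 0, hq0 0, fun w => ?_⟩
  have h1 : q w = q 0 := by
    have := hrw w
    simpa [hc0, hr] using this
  rw [← h1]
  linear_combination -(hmul w)

/-! ### The Fatou coordinate of a perturbed translation on a wide sector -/

/-- A sector of opening `3π/2` around the positive real axis, with its corner at `R`. It is wider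
than a half-plane, so that its image under an almost isometric map contains a half-plane. -/
def sector (R : ℝ) : Set ℂ := {z | R < z.re + |z.im|}

theorem isOpen_sector (R : ℝ) : IsOpen (sector R) :=
  isOpen_lt continuous_const (by fun_prop)

theorem sector_anti {R S : ℝ} (h : R ≤ S) : sector S ⊆ sector R := fun _ hz => h.trans_lt hz

theorem half_lt_norm_of_mem_sector {R : ℝ} {z : ℂ} (hz : z ∈ sector R) : R / 2 < ‖z‖ := by
  have h1 := (le_abs_self _).trans (Complex.abs_re_le_norm z)
  have h2 := Complex.abs_im_le_norm z
  have h3 : R < z.re + |z.im| := hz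
  linarith

theorem mem_sector_of_lt_re {R : ℝ} {z : ℂ} (hz : R < z.re) : z ∈ sector R := by
  have := abs_nonneg z.im
  show R < z.re + |z.im|
  linarith

theorem add_mem_sector {R : ℝ} {z u : ℂ} (hz : z ∈ sector R) (hu : ‖u‖ ≤ 1 / 4) :
    z + 1 + u ∈ sector (R + 1 / 2) := by
  have h1 := neg_le_of_abs_le ((Complex.abs_re_le_norm u).trans hu)
  have h2 := (Complex.abs_im_le_norm u).trans hu
  have h3 : R < z.re + |z.im| := hz
  have h4 : |z.im| ≤ |z.im + u.im| + |u.im| := by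
    have := abs_sub (z.im + u.im) u.im
    simpa using this
  show R + 1 / 2 < (z + 1 + u).re + |(z + 1 + u).im|
  simp only [Complex.add_re, Complex.one_re, Complex.add_im, Complex.one_im, add_zero]
  linarith

/-- The sector is not convex, but it is the union of two half-planes, and two of its points are
joined by a broken line at most four times as long as their distance. -/
theorem norm_sub_le_of_norm_deriv_le_sector {g : ℂ → ℂ} {R L : ℝ}
    (hd : ∀ z ∈ sector R, DifferentiableAt ℂ g z) (hL : ∀ z ∈ sector R, ‖deriv g z‖ ≤ L)
    {x y : ℂ} (hx : x ∈ sector R) (hy : y ∈ sector R) : ‖g x - g y‖ ≤ 4 * L * ‖x - y‖ := by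
  have hL0 : 0 ≤ L := (norm_nonneg _).trans (hL x hx)
  have half : ∀ s : ℝ, |s| = 1 → ∀ u v : ℂ, R < u.re + s * u.im → R < v.re + s * v.im →
      ‖g u - g v‖ ≤ L * ‖u - v‖ := by
    intro s hs u v hu hv
    have hsub : {z : ℂ | R < z.re + s * z.im} ⊆ sector R := by
      intro z hz
      have : s * z.im ≤ |z.im| := (le_abs_self _).trans (by rw [abs_mul, hs, one_mul])
      have hz' : R < z.re + s * z.im := hz
      show R < z.re + |z.im|
      linarith
    have hconv : Convex ℝ {z : ℂ | R < z.re + s * z.im} := by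
      have : IsLinearMap ℝ fun z : ℂ => z.re + s * z.im :=
        ⟨fun a b => by simp; ring, fun a b => by simp; ring⟩
      exact convex_halfSpace_gt this R
    exact hconv.norm_image_sub_le_of_norm_deriv_le (fun z hz => hd z (hsub hz))
      (fun z hz => hL z (hsub hz)) hv hu
  have mixed : ∀ u v : ℂ, R < u.re + u.im → R < v.re - v.im → 0 ≤ u.im → v.im ≤ 0 →
      ‖g u - g v‖ ≤ 4 * L * ‖u - v‖ := by
    intro u v hu hv hu0 hv0
    set t : ℝ := max (u.re + u.im) (v.re - v.im) with ht
    have htR : R < t := lt_of_lt_of_le hu (le_max_left _ _)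
    have h1 : ‖g u - g t‖ ≤ L * ‖u - t‖ := half 1 (by simp) u t (by simpa using hu) (by simpa)
    have h2 : ‖g t - g v‖ ≤ L * ‖(t : ℂ) - v‖ :=
      half (-1) (by simp) t v (by simpa) (by linarith)
    have him : u.im - v.im ≤ ‖u - v‖ := by
      simpa using (le_abs_self _).trans (Complex.abs_im_le_norm (u - v))
    have hre := abs_le.1 (Complex.abs_re_le_norm (u - v))
    have h3 : ‖u - t‖ ≤ |u.re - t| + |u.im| := by
      simpa using Complex.norm_le_abs_re_add_abs_im (u - t)
    have h4 : ‖(t : ℂ) - v‖ ≤ |t - v.re| + |v.im| := by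
      simpa using Complex.norm_le_abs_re_add_abs_im ((t : ℂ) - v)
    rw [abs_of_nonneg hu0] at h3
    rw [abs_of_nonpos hv0] at h4
    have h5 : ‖u - t‖ + ‖(t : ℂ) - v‖ ≤ 4 * ‖u - v‖ := by
      simp only [Complex.sub_re] at hre
      rcases le_total (u.re + u.im) (v.re - v.im) with hle | hle
      · rw [max_eq_right hle] at ht
        have e1 : |u.re - t| ≤ ‖u - v‖ - v.im := by rw [abs_le]; constructor <;> linarith
        have e2 : |t - v.re| ≤ -v.im := by rw [abs_le]; constructor <;> linarith
        linarith
      · rw [max_eq_left hle] at ht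
        have e1 : |u.re - t| ≤ u.im := by rw [abs_le]; constructor <;> linarith
        have e2 : |t - v.re| ≤ ‖u - v‖ + u.im := by rw [abs_le]; constructor <;> linarith
        linarith
    calc ‖g u - g v‖ ≤ ‖g u - g t‖ + ‖g t - g v‖ := norm_sub_le_norm_sub_add_norm_sub _ _ _
      _ ≤ L * (‖u - t‖ + ‖(t : ℂ) - v‖) := by linarith
      _ ≤ L * (4 * ‖u - v‖) := by gcongr
      _ = _ := by ring
  have hle : L * ‖x - y‖ ≤ 4 * L * ‖x - y‖ := by nlinarith [mul_nonneg hL0 (norm_nonneg (x - y))]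
  have hx' : R < x.re + |x.im| := hx
  have hy' : R < y.re + |y.im| := hy
  rcases le_total 0 x.im with hxi | hxi <;> rcases le_total 0 y.im with hyi | hyi
  · rw [abs_of_nonneg hxi] at hx'; rw [abs_of_nonneg hyi] at hy'
    exact (half 1 (by simp) x y (by linarith) (by linarith)).trans hle
  · rw [abs_of_nonneg hxi] at hx'; rw [abs_of_nonpos hyi] at hy'
    exact mixed x y hx' (by linarith) hxi hyi
  · rw [abs_of_nonpos hxi] at hx'; rw [abs_of_nonneg hyi] at hy'
    rw [norm_sub_rev, norm_sub_rev x]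
    exact mixed y x hy' (by linarith) hyi hxi
  · rw [abs_of_nonpos hxi] at hx'; rw [abs_of_nonpos hyi] at hy'
    exact (half (-1) (by simp) x y (by linarith) (by linarith)).trans hle

theorem iterate_mem_sector {G : ℂ → ℂ} {R : ℝ} (hG : ∀ z ∈ sector R, ‖G z‖ ≤ 1 / 4)
    {S : ℝ} (hS : R ≤ S) {z : ℂ} (hz : z ∈ sector S) (k : ℕ) :
    (fun w => w + 1 + G w)^[k] z ∈ sector (S + k / 2) := by
  induction k with
  | zero => simpa using hz
  | succ k ih =>
    rw [Function.iterate_succ_apply']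
    have h1 := add_mem_sector ih (hG _ (sector_anti (by linarith [Nat.cast_nonneg (α := ℝ) k]) ih))
    convert h1 using 2
    push_cast; ring

theorem tendsto_cocompact_of_mem_sector {u : ℕ → ℂ} {S : ℝ}
    (h : ∀ k : ℕ, u k ∈ sector (S + k / 2)) : Tendsto u atTop (cocompact ℂ) := by
  rw [← Metric.cobounded_eq_cocompact, ← tendsto_norm_atTop_iff_cobounded]
  refine tendsto_atTop_mono (fun k => (half_lt_norm_of_mem_sector (h k)).le) ?_
  refine Tendsto.atTop_div_const two_pos (tendsto_atTop_add_const_left _ _ ?_)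
  exact tendsto_natCast_atTop_atTop.atTop_div_const two_pos

/-- The Fatou coordinate of the map `F z = z + 1 + G z` is the limit of `F^k z - F^k z₀`. The decay
of `deriv G` makes the differences of these functions summable, and keeps the limit close to an
isometry on a sector that is far enough to the right. -/
theorem exists_abel_of_sector {G : ℂ → ℂ} {R M δ : ℝ} (hR : 0 < R) (hδ : 0 < δ)
    (hd : ∀ z ∈ sector R, DifferentiableAt ℂ G z) (hG : ∀ z ∈ sector R, ‖G z‖ ≤ 1 / 4)
    (hG' : ∀ z ∈ sector R, ‖deriv G z‖ ≤ M * ‖z‖ ^ (-(1 + δ)))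
    (h0 : Tendsto G (cocompact ℂ) (𝓝 0)) :
    ∃ S, R ≤ S ∧ ∃ β : ℂ → ℂ, DifferentiableOn ℂ β (sector S) ∧
      (∀ z ∈ sector S, β (z + 1 + G z) = β z + 1) ∧
      ∀ x ∈ sector S, ∀ y ∈ sector S, ‖β x - β y - (x - y)‖ ≤ 1 / 4 * ‖x - y‖ := by
  have hM : 0 ≤ M := by
    have hz : ((R + 1 : ℝ) : ℂ) ∈ sector R := mem_sector_of_lt_re (by simp)
    have h1 := (norm_nonneg _).trans (hG' _ hz)
    have h2 : 0 < ‖((R + 1 : ℝ) : ℂ)‖ := (by positivity : 0 < R / 2).trans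
      (half_lt_norm_of_mem_sector hz)
    exact nonneg_of_mul_nonneg_left h1 (Real.rpow_pos_of_pos h2 _)
  set F : ℂ → ℂ := fun w => w + 1 + G w with hF
  set l : ℕ → ℝ := fun k => 4 * (M * ((R + k / 2) / 2) ^ (-(1 + δ))) with hl
  have hl0 : ∀ k, 0 ≤ l k := fun k => by positivity
  have hlip : ∀ k : ℕ, ∀ x ∈ sector (R + k / 2), ∀ y ∈ sector (R + k / 2),
      ‖G x - G y‖ ≤ l k * ‖x - y‖ := by
    intro k x hx y hy
    have hsub : sector (R + k / 2) ⊆ sector R :=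
      sector_anti (by linarith [Nat.cast_nonneg (α := ℝ) k])
    refine norm_sub_le_of_norm_deriv_le_sector (fun z hz => hd z (hsub hz)) (fun z hz => ?_) hx hy
    refine (hG' z (hsub hz)).trans ?_
    refine mul_le_mul_of_nonneg_left ?_ hM
    exact Real.rpow_le_rpow_of_nonpos (by positivity) (half_lt_norm_of_mem_sector hz).le
      (by linarith)
  have hsum : Summable l := by
    have h1 : Summable fun k : ℕ => 1 / |(k : ℝ) + 2 * R| ^ (1 + δ) :=
      (Real.summable_one_div_nat_add_rpow (2 * R) (1 + δ)).2 (by linarith)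
    have h2 := h1.mul_left (4 * M * (1 / 4 : ℝ) ^ (-(1 + δ)))
    refine h2.congr fun k => ?_
    have hp : (0 : ℝ) < k + 2 * R := by positivity
    have e : (R + k / 2) / 2 = (1 / 4 : ℝ) * (k + 2 * R) := by ring
    rw [hl]
    simp only
    rw [e, Real.mul_rpow (by norm_num) hp.le, abs_of_pos hp, Real.rpow_neg hp.le]
    ring
  -- far enough to the right the total Lipschitz constant is small
  obtain ⟨K, hK⟩ : ∃ K : ℕ, ∑' k, l (k + K) < 1 / 16 :=
    ((tendsto_sum_nat_add l).eventually (gt_mem_nhds (by norm_num))).exists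
  have hsumK : Summable fun k => l (k + K) := (summable_nat_add_iff K).2 hsum
  have hpart : ∀ k, ∑ m ∈ Finset.range k, l (m + K) ≤ 1 / 16 := fun k =>
    (hsumK.sum_le_tsum _ (fun i _ => hl0 _)).trans hK.le
  set S : ℝ := R + K / 2 with hS
  have hRS : R ≤ S := by linarith [Nat.cast_nonneg (α := ℝ) K]
  have horb : ∀ z ∈ sector S, ∀ k, F^[k] z ∈ sector (R + ((k + K : ℕ) : ℝ) / 2) := by
    intro z hz k
    have h1 := iterate_mem_sector hG hRS hz k
    convert h1 using 2
    rw [hS]; push_cast; ring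
  have horb' : ∀ z ∈ sector S, ∀ k, F^[k] z ∈ sector R := fun z hz k =>
    sector_anti (by linarith [Nat.cast_nonneg (α := ℝ) (k + K)]) (horb z hz k)
  have hstep : ∀ x y : ℂ, ∀ k, F^[k + 1] x - F^[k + 1] y =
      (F^[k] x - F^[k] y) + (G (F^[k] x) - G (F^[k] y)) := by
    intro x y k
    rw [Function.iterate_succ_apply', Function.iterate_succ_apply', hF]
    ring
  have hest : ∀ x ∈ sector S, ∀ y ∈ sector S, ∀ k,
      ‖F^[k] x - F^[k] y - (x - y)‖ ≤ 2 * (∑ m ∈ Finset.range k, l (m + K)) * ‖x - y‖ ∧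
      ‖F^[k] x - F^[k] y‖ ≤ 2 * ‖x - y‖ := by
    intro x hx y hy k
    have hsecond : ∀ k, ‖F^[k] x - F^[k] y - (x - y)‖ ≤
        2 * (∑ m ∈ Finset.range k, l (m + K)) * ‖x - y‖ → ‖F^[k] x - F^[k] y‖ ≤ 2 * ‖x - y‖ := by
      intro k hk
      have h1 : ‖F^[k] x - F^[k] y‖ ≤ ‖F^[k] x - F^[k] y - (x - y)‖ + ‖x - y‖ := by
        simpa using norm_add_le (F^[k] x - F^[k] y - (x - y)) (x - y)
      have h2 := mul_le_mul_of_nonneg_right (hpart k) (norm_nonneg (x - y))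
      linarith [norm_nonneg (x - y)]
    induction k with
    | zero => refine ⟨by simp, ?_⟩; simp; linarith [norm_nonneg (x - y)]
    | succ k ih =>
      have h1 : ‖F^[k + 1] x - F^[k + 1] y - (x - y)‖ ≤
          2 * (∑ m ∈ Finset.range (k + 1), l (m + K)) * ‖x - y‖ := by
        have h2 := hlip (k + K) _ (horb x hx k) _ (horb y hy k)
        have h3 := mul_le_mul_of_nonneg_left ih.2 (hl0 (k + K))
        rw [hstep, Finset.sum_range_succ,
          show (F^[k] x - F^[k] y) + (G (F^[k] x) - G (F^[k] y)) - (x - y) =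
          (F^[k] x - F^[k] y - (x - y)) + (G (F^[k] x) - G (F^[k] y)) by ring]
        refine (norm_add_le _ _).trans ?_
        linarith [ih.1]
      exact ⟨h1, hsecond _ h1⟩
  set z₀ : ℂ := ((S + 1 : ℝ) : ℂ) with hz₀d
  have hz₀ : z₀ ∈ sector S := mem_sector_of_lt_re (by simp [hz₀d])
  have hterm : ∀ z ∈ sector S, ∀ k,
      ‖G (F^[k] z) - G (F^[k] z₀)‖ ≤ l (k + K) * (2 * ‖z - z₀‖) := by
    intro z hz k
    refine (hlip (k + K) _ (horb z hz k) _ (horb z₀ hz₀ k)).trans ?_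
    exact mul_le_mul_of_nonneg_left (hest z hz z₀ hz₀ k).2 (hl0 _)
  set β : ℂ → ℂ := fun z => (z - z₀) + ∑' k, (G (F^[k] z) - G (F^[k] z₀)) with hβ
  have hlim : ∀ z ∈ sector S, Tendsto (fun k => F^[k] z - F^[k] z₀) atTop (𝓝 (β z)) := by
    intro z hz
    have hs : Summable fun k => G (F^[k] z) - G (F^[k] z₀) :=
      Summable.of_norm_bounded (hsumK.mul_right _) (hterm z hz)
    have h1 := hs.hasSum.tendsto_sum_nat.const_add (z - z₀)
    refine h1.congr fun k => ?_
    have h2 : ∀ m, G (F^[m] z) - G (F^[m] z₀) =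
        (F^[m + 1] z - F^[m + 1] z₀) - (F^[m] z - F^[m] z₀) := fun m => by rw [hstep]; ring
    rw [Finset.sum_congr rfl fun m _ => h2 m, Finset.sum_range_sub fun m => F^[m] z - F^[m] z₀]
    simp
  have hFd : ∀ k, DifferentiableOn ℂ F^[k] (sector S) := by
    intro k
    induction k with
    | zero => exact differentiableOn_id
    | succ k ih =>
      intro z hz
      rw [Function.iterate_succ']
      refine DifferentiableAt.comp_differentiableWithinAt z ?_ (ih z hz)
      have := hd _ (horb' z hz k)
      fun_prop
  refine ⟨S, hRS, β, ?_, ?_, ?_⟩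
  · intro z hz
    have hU : IsOpen (sector S ∩ Metric.ball z₀ (‖z - z₀‖ + 1)) :=
      (isOpen_sector S).inter Metric.isOpen_ball
    have hzU : z ∈ sector S ∩ Metric.ball z₀ (‖z - z₀‖ + 1) :=
      ⟨hz, by rw [Metric.mem_ball, dist_eq_norm]; linarith⟩
    have h1 : DifferentiableOn ℂ (fun z => ∑' k, (G (F^[k] z) - G (F^[k] z₀)))
        (sector S ∩ Metric.ball z₀ (‖z - z₀‖ + 1)) := by
      refine Complex.differentiableOn_tsum_of_summable_norm
        (u := fun k => l (k + K) * (2 * (‖z - z₀‖ + 1))) (hsumK.mul_right _) ?_ hU ?_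
      · intro k w hw
        refine DifferentiableWithinAt.sub_const ?_ _
        exact (hd _ (horb' w hw.1 k)).comp_differentiableWithinAt w
          ((hFd k w hw.1).mono inter_subset_left)
      · intro k w hw
        refine (hterm w hw.1 k).trans ?_
        have h2 : ‖w - z₀‖ ≤ ‖z - z₀‖ + 1 := by
          have := hw.2
          rw [Metric.mem_ball, dist_eq_norm] at this
          exact this.le
        exact mul_le_mul_of_nonneg_left (by linarith) (hl0 _)
    have h2 : DifferentiableAt ℂ β z :=
      (differentiableAt_id.sub_const z₀).add (h1.differentiableAt (hU.mem_nhds hzU))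
    exact h2.differentiableWithinAt
  · intro z hz
    have hFz : F z ∈ sector S :=
      sector_anti (by linarith) (add_mem_sector hz (hG z (sector_anti hRS hz)))
    have h1 := hlim _ hFz
    -- consecutive points of the reference orbit differ by almost `1`
    have h2 : Tendsto (fun k => F^[k + 1] z₀ - F^[k] z₀) atTop (𝓝 1) := by
      have h3 := h0.comp (tendsto_cocompact_of_mem_sector
        (fun k : ℕ => iterate_mem_sector hG hRS hz₀ k))
      have h4 := h3.const_add 1
      rw [add_zero] at h4
      refine h4.congr fun k => ?_
      rw [Function.iterate_succ_apply', hF]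
      simp only [Function.comp]
      ring
    have h5 := ((hlim z hz).comp (tendsto_add_atTop_nat 1)).add h2
    refine tendsto_nhds_unique h1 (h5.congr fun k => ?_)
    simp only [Function.comp, Function.iterate_succ_apply]
    ring
  · intro x hx y hy
    have h1 := ((hlim x hx).sub (hlim y hy)).sub_const (x - y)
    refine le_of_tendsto h1.norm (Eventually.of_forall fun k => ?_)
    have h2 := (hest x hx y hy k).1
    have h3 := mul_le_mul_of_nonneg_right (hpart k) (norm_nonneg (x - y))
    rw [show F^[k] x - F^[k] z₀ - (F^[k] y - F^[k] z₀) - (x - y) =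
      F^[k] x - F^[k] y - (x - y) by ring]
    linarith [norm_nonneg (x - y)]

theorem exists_halfPlane_subset_image_sector {β : ℂ → ℂ} {S : ℝ}
    (hβ : ∀ x ∈ sector S, ∀ y ∈ sector S, ‖β x - β y - (x - y)‖ ≤ 1 / 4 * ‖x - y‖) :
    ∃ c : ℝ, {w : ℂ | c < w.re} ⊆ β '' sector S := by
  set z₀ : ℂ := ((S + 1 : ℝ) : ℂ) with hz₀d
  have hz₀ : z₀ ∈ sector S := mem_sector_of_lt_re (by simp [hz₀d])
  set b := β z₀ - z₀ with hb
  refine ⟨‖b‖ + 5 * ‖z₀‖ + 5 * |S| + 1, fun w hw => ?_⟩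
  set z := w - b with hz
  have hre : 5 * ‖z₀‖ + 5 * |S| + 1 < z.re := by
    have h1 := (le_abs_self _).trans (Complex.abs_re_le_norm b)
    have h2 : ‖b‖ + 5 * ‖z₀‖ + 5 * |S| + 1 < w.re := hw
    rw [hz, Complex.sub_re]
    linarith
  have hn0 := norm_nonneg z₀
  have hS0 := abs_nonneg S
  have hnorm := (le_abs_self _).trans (Complex.abs_re_le_norm z)
  have happ : ApproximatesLinearOn β (ContinuousLinearMap.id ℂ ℂ) (sector S) (1 / 4 : NNReal) := by
    intro x hx y hy
    simpa using hβ x hx y hy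
  have hball : Metric.closedBall z (2 / 5 * ‖z‖) ⊆ sector S := by
    intro x hx
    rw [Metric.mem_closedBall, dist_eq_norm] at hx
    have h1 := abs_le.1 ((Complex.abs_re_le_norm (x - z)).trans hx)
    have h2 := (Complex.abs_im_le_norm (x - z)).trans hx
    simp only [Complex.sub_re, Complex.sub_im] at h1 h2
    have h3 : |z.im| ≤ |x.im| + |x.im - z.im| := by
      have := abs_sub x.im (x.im - z.im)
      simpa using this
    have h4 := Complex.norm_le_abs_re_add_abs_im z
    rw [abs_of_pos (by linarith : 0 < z.re)] at h4
    show S < x.re + |x.im|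
    linarith [le_abs_self S]
  have hsurj := happ.surjOn_closedBall_of_nonlinearRightInverse
    (ContinuousLinearEquiv.refl ℂ ℂ).toNonlinearRightInverse
    (ε := 2 / 5 * ‖z‖) (by positivity) (b := z) hball
  have hN : (((ContinuousLinearEquiv.refl ℂ ℂ).toNonlinearRightInverse.nnnorm : NNReal) : ℝ)⁻¹
      = 1 := by
    simp [ContinuousLinearEquiv.toNonlinearRightInverse]
  have hmem : w ∈ Metric.closedBall (β z) (((((ContinuousLinearEquiv.refl ℂ
      ℂ).toNonlinearRightInverse.nnnorm : NNReal) : ℝ)⁻¹ - (1 / 4 : NNReal)) * (2 / 5 * ‖z‖)) := by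
    rw [hN, Metric.mem_closedBall, dist_comm, dist_eq_norm]
    have h1 := hβ z (hball (Metric.mem_closedBall_self (by positivity))) z₀ hz₀
    rw [show β z - β z₀ - (z - z₀) = β z - w by rw [hz, hb]; ring] at h1
    have h2 := norm_sub_le z z₀
    push_cast
    linarith
  obtain ⟨x, hx, hxw⟩ := hsurj hmem
  exact ⟨x, hball hx, hxw⟩

/-! ### Charts of the Riemann sphere -/

@[simp] theorem param_coe (a w : ℂ) : param (a : Sphere) w = ((a + w : ℂ) : Sphere) := rfl

@[simp] theorem param_infty (w : ℂ) : param OnePoint.infty w = quot 1 w := rfl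

@[simp] theorem quot_zero (a : ℂ) : quot a 0 = OnePoint.infty := if_pos rfl

theorem quot_of_ne_zero (a : ℂ) {b : ℂ} (hb : b ≠ 0) : quot a b = ((a / b : ℂ) : Sphere) :=
  if_neg hb

@[simp] theorem param_zero (x : Sphere) : param x 0 = x := by
  cases x using OnePoint.rec <;> simp

@[simp] theorem coord_coe_coe (a z : ℂ) : coord (a : Sphere) (z : Sphere) = z - a := rfl

@[simp] theorem coord_infty_coe (z : ℂ) : coord OnePoint.infty (z : Sphere) = z⁻¹ := rfl

@[simp] theorem coord_infty_infty : coord OnePoint.infty OnePoint.infty = 0 := rfl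

@[simp] theorem coord_param (x : Sphere) (w : ℂ) : coord x (param x w) = w := by
  cases x using OnePoint.rec with
  | infty =>
    by_cases hw : w = 0
    · simp [hw]
    · simp [quot_of_ne_zero _ hw]
  | coe a => simp

@[simp] theorem coord_self (x : Sphere) : coord x x = 0 := by
  simpa using coord_param x 0

/-- The inversion `z ↦ 1 / z` of the sphere. -/
def inversion : Sphere → Sphere
  | OnePoint.infty => ((0 : ℂ) : Sphere)
  | OnePoint.some z => quot 1 z

@[simp] theorem inversion_infty : inversion OnePoint.infty = ((0 : ℂ) : Sphere) := rfl

@[simp] theorem inversion_coe (z : ℂ) : inversion (z : Sphere) = quot 1 z := rfl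

theorem inversion_involutive : Function.Involutive inversion := by
  intro x
  cases x using OnePoint.rec with
  | infty => simp
  | coe z =>
    by_cases hz : z = 0
    · simp [hz]
    · simp [quot_of_ne_zero _ hz, quot_of_ne_zero _ (inv_ne_zero hz)]

theorem tendsto_coe_cocompact :
    Tendsto ((↑) : ℂ → Sphere) (cocompact ℂ) (𝓝 OnePoint.infty) := by
  simpa [coclosedCompact_eq_cocompact] using OnePoint.tendsto_coe_infty (X := ℂ)

theorem continuous_inversion : Continuous inversion := by
  rw [continuous_iff_continuousAt]
  intro x
  cases x using OnePoint.rec with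
  | infty =>
    rw [OnePoint.continuousAt_infty', coclosedCompact_eq_cocompact, inversion_infty]
    have h1 : Tendsto (fun z : ℂ => ((z⁻¹ : ℂ) : Sphere)) (cocompact ℂ) (𝓝 ((0 : ℂ) : Sphere)) := by
      rw [← Metric.cobounded_eq_cocompact]
      exact (OnePoint.continuous_coe.tendsto _).comp tendsto_inv₀_cobounded
    refine h1.congr' ?_
    have h2 : ∀ᶠ z : ℂ in cocompact ℂ, z ≠ 0 :=
      (isCompact_singleton (x := (0 : ℂ))).compl_mem_cocompact
    filter_upwards [h2] with z hz
    simp [quot_of_ne_zero _ hz]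
  | coe z =>
    rw [OnePoint.continuousAt_coe]
    by_cases hz : z = 0
    · subst hz
      rw [continuousAt_iff_punctured_nhds]
      have h1 : Tendsto (fun z : ℂ => ((z⁻¹ : ℂ) : Sphere)) (𝓝[≠] 0) (𝓝 OnePoint.infty) := by
        refine tendsto_coe_cocompact.comp ?_
        rw [← Metric.cobounded_eq_cocompact]
        exact tendsto_inv₀_nhdsNE_zero
      simp only [Function.comp, inversion_coe, quot_zero]
      refine h1.congr' ?_
      filter_upwards [self_mem_nhdsWithin] with z hz
      simp [quot_of_ne_zero _ hz]
    · have h1 : ContinuousAt (fun z : ℂ => ((z⁻¹ : ℂ) : Sphere)) z :=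
        OnePoint.continuous_coe.continuousAt.comp (continuousAt_inv₀ hz)
      refine h1.congr ?_
      filter_upwards [isOpen_ne.mem_nhds hz] with w hw
      simp [quot_of_ne_zero _ hw]

theorem isOpenEmbedding_param (x : Sphere) : IsOpenEmbedding (param x) := by
  cases x using OnePoint.rec with
  | infty =>
    have h1 : IsOpenEmbedding inversion :=
      (Homeomorph.mk (inversion_involutive.toPerm) continuous_inversion
        continuous_inversion).isOpenEmbedding
    exact h1.comp OnePoint.isOpenEmbedding_coe
  | coe a => exact OnePoint.isOpenEmbedding_coe.comp (Homeomorph.addLeft a).isOpenEmbedding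

theorem map_param_nhds_zero (x : Sphere) : map (param x) (𝓝 0) = 𝓝 x := by
  rw [(isOpenEmbedding_param x).map_nhds_eq, param_zero]

theorem range_param_mem_nhds (x : Sphere) : range (param x) ∈ 𝓝 x :=
  (isOpenEmbedding_param x).isOpen_range.mem_nhds ⟨0, param_zero x⟩

theorem param_coord {x y : Sphere} (h : y ∈ range (param x)) : param x (coord x y) = y := by
  obtain ⟨w, rfl⟩ := h
  rw [coord_param]

theorem tendsto_param (x : Sphere) : Tendsto (param x) (𝓝 0) (𝓝 x) :=
  (map_param_nhds_zero x).le

theorem tendsto_coord (x : Sphere) : Tendsto (coord x) (𝓝 x) (𝓝 0) := by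
  rw [← map_param_nhds_zero x, tendsto_map'_iff]
  exact tendsto_id.congr fun w => (coord_param x w).symm

/-- The change from the chart around `x` to the chart around a nearby point. -/
theorem exists_transition (x : Sphere) (w₀ : ℂ) : ∃ τ : ℂ → ℂ, DifferentiableAt ℂ τ w₀ ∧
    τ w₀ = 0 ∧ ∀ᶠ w in 𝓝 w₀, param x w = param (param x w₀) (τ w) := by
  cases x using OnePoint.rec with
  | infty =>
    by_cases hw : w₀ = 0
    · exact ⟨id, differentiableAt_id, hw, by simp [hw]⟩
    · refine ⟨fun w => w⁻¹ - w₀⁻¹, (differentiableAt_inv hw).sub_const _, sub_self _, ?_⟩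
      filter_upwards [isOpen_ne.mem_nhds hw] with w hw'
      simp [quot_of_ne_zero _ hw, quot_of_ne_zero _ hw']
  | coe a =>
    exact ⟨fun w => w - w₀, by fun_prop, sub_self _, by simp⟩

/-! ### Holomorphic functions and maps on the sphere -/

/-- Holomorphy is tested in the chart centred at each point; a single chart serves for all points
in its range. -/
theorem HolomorphicOn.differentiableOn {α : Sphere → ℂ} {Ω : Set Sphere} (h : HolomorphicOn α Ω)
    (x : Sphere) : DifferentiableOn ℂ (fun w => α (param x w)) (param x ⁻¹' Ω) := by
  intro w₀ hw₀
  obtain ⟨τ, hτ, hτ0, he⟩ := exists_transition x w₀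
  have h1 : DifferentiableAt ℂ (fun w => α (param (param x w₀) w)) (τ w₀) := by
    rw [hτ0]; exact h _ hw₀
  refine ((h1.comp w₀ hτ).congr_of_eventuallyEq ?_).differentiableWithinAt
  filter_upwards [he] with w hw
  simp [hw]

theorem HolomorphicOn.mono {α : Sphere → ℂ} {Ω Ω' : Set Sphere} (h : HolomorphicOn α Ω)
    (hs : Ω' ⊆ Ω) : HolomorphicOn α Ω' := fun x hx => h x (hs hx)

theorem HolomorphicOn.continuousAt {α : Sphere → ℂ} {Ω : Set Sphere} (h : HolomorphicOn α Ω)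
    {x : Sphere} (hx : x ∈ Ω) : ContinuousAt α x := by
  have h1 := (h x hx).continuousAt
  rw [ContinuousAt, ← map_param_nhds_zero x, tendsto_map'_iff]
  simpa [ContinuousAt, Function.comp_def] using h1

/-- The open mapping theorem on the sphere, for injective functions. -/
theorem HolomorphicOn.nhds_le_map {α : Sphere → ℂ} {V : Set Sphere} (hV : IsOpen V)
    (h : HolomorphicOn α V) (hi : InjOn α V) {x : Sphere} (hx : x ∈ V) :
    𝓝 (α x) ≤ map α (𝓝 x) := by
  have h1 := nhds_le_map_of_injOn (g := fun w => α (param x w))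
    (hV.preimage (isOpenEmbedding_param x).continuous) (h.differentiableOn x)
    (fun u hu v hv huv => (isOpenEmbedding_param x).injective (hi hu hv huv))
    (z := 0) (by simpa using hx)
  rwa [param_zero, ← Function.comp_def, ← map_map, map_param_nhds_zero] at h1

theorem HolomorphicOn.continuousOn_invFunOn {α : Sphere → ℂ} {V : Set Sphere} (hV : IsOpen V)
    (h : HolomorphicOn α V) (hi : InjOn α V) :
    ContinuousOn (Function.invFunOn α V) (α '' V) := by
  rintro _ ⟨z, hz, rfl⟩
  refine ContinuousAt.continuousWithinAt fun s hs => ?_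
  rw [hi.leftInvOn_invFunOn hz] at hs
  have h1 : α '' (s ∩ V) ∈ 𝓝 (α z) :=
    h.nhds_le_map hV hi hz (image_mem_map (inter_mem hs (hV.mem_nhds hz)))
  rw [mem_map]
  filter_upwards [h1]
  rintro _ ⟨x, hx, rfl⟩
  simpa [hi.leftInvOn_invFunOn hx.2] using hx.1

/-- A holomorphic self-map of the sphere: it is continuous and, in local coordinates, analytic. -/
structure IsHolomorphicMap (f : Sphere → Sphere) : Prop where
  continuous : Continuous f
  analyticAt : ∀ x, AnalyticAt ℂ (localExpr f x) 0

@[simp] theorem localExpr_zero (f : Sphere → Sphere) (x : Sphere) : localExpr f x 0 = 0 := by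
  simp [localExpr]

namespace IsHolomorphicMap

variable {f : Sphere → Sphere}

theorem eventually_eq (hf : IsHolomorphicMap f) (x : Sphere) :
    ∀ᶠ w in 𝓝 0, f (param x w) = param (f x) (localExpr f x w) := by
  have h1 : Tendsto (fun w => f (param x w)) (𝓝 0) (𝓝 (f x)) :=
    (hf.continuous.tendsto x).comp (tendsto_param x)
  filter_upwards [h1 (range_param_mem_nhds (f x))] with w hw
  exact (param_coord hw).symm

theorem hasDerivAt_comp (hf : IsHolomorphicMap f) {α : Sphere → ℂ} {x : Sphere}
    {a b : ℂ} (h : HasDerivAt (fun w => α (param (f x) w)) a 0)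
    (hb : HasDerivAt (localExpr f x) b 0) :
    HasDerivAt (fun w => α (f (param x w))) (a * b) 0 := by
  have h1 : HasDerivAt (fun w => α (param (f x) w)) a (localExpr f x 0) := by simpa using h
  refine (h1.comp 0 hb).congr_of_eventuallyEq ?_
  filter_upwards [hf.eventually_eq x] with w hw
  simp [hw]

theorem holomorphicOn_comp (hf : IsHolomorphicMap f) {α : Sphere → ℂ} {Ω : Set Sphere}
    (h : HolomorphicOn α Ω) : HolomorphicOn (fun z => α (f z)) (f ⁻¹' Ω) := fun x hx =>
  (hf.hasDerivAt_comp (h _ hx).hasDerivAt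
    (hf.analyticAt x).differentiableAt.hasDerivAt).differentiableAt

theorem holomorphicOn_comp_iterate (hf : IsHolomorphicMap f) {α : Sphere → ℂ} {Ω : Set Sphere}
    (h : HolomorphicOn α Ω) (k : ℕ) : HolomorphicOn (fun z => α (f^[k] z)) (f^[k] ⁻¹' Ω) := by
  induction k with
  | zero => exact h
  | succ k ih => exact hf.holomorphicOn_comp ih

theorem nhds_le_map (hf : IsHolomorphicMap f) {O : Set Sphere} (hO : IsOpen O) (hi : InjOn f O)
    {x : Sphere} (hx : x ∈ O) : 𝓝 (f x) ≤ map f (𝓝 x) := by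
  have hev := (hf.eventually_eq x).and ((tendsto_param x) (hO.mem_nhds hx))
  have h1 : ¬ ∀ᶠ w in 𝓝 (0 : ℂ), localExpr f x w = localExpr f x 0 := by
    intro h
    obtain ⟨r, hr, hrs⟩ := Metric.eventually_nhds_iff_ball.1 (h.and hev)
    have hi' : InjOn (fun w => f (param x w)) (Metric.ball 0 r) := fun u hu v hv huv =>
      (isOpenEmbedding_param x).injective (hi (hrs u hu).2.2 (hrs v hv).2.2 huv)
    refine not_eventually_const_of_injOn Metric.isOpen_ball hi' (Metric.mem_ball_self hr) ?_
    filter_upwards [Metric.ball_mem_nhds 0 hr] with w hw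
    rw [(hrs w hw).2.1, (hrs w hw).1]
    simp
  have h2 := (hf.analyticAt x).eventually_constant_or_nhds_le_map_nhds.resolve_left h1
  have h3 := map_mono (m := param (f x)) h2
  rw [localExpr_zero, map_param_nhds_zero, map_map] at h3
  refine h3.trans ?_
  rw [← map_param_nhds_zero x, map_map]
  refine le_of_eq (Filter.map_congr ?_)
  filter_upwards [hf.eventually_eq x] with w hw
  simp [hw]

theorem isOpen_image (hf : IsHolomorphicMap f) {O : Set Sphere} (hO : IsOpen O)
    (hi : InjOn f O) : IsOpen (f '' O) := by
  rw [isOpen_iff_mem_nhds]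
  rintro _ ⟨x, hx, rfl⟩
  exact hf.nhds_le_map hO hi hx (image_mem_map (hO.mem_nhds hx))

theorem continuousOn_invFunOn (hf : IsHolomorphicMap f) {O : Set Sphere} (hO : IsOpen O)
    (hi : InjOn f O) : ContinuousOn (Function.invFunOn f O) (f '' O) := by
  rintro _ ⟨z, hz, rfl⟩
  refine ContinuousAt.continuousWithinAt fun s hs => ?_
  rw [hi.leftInvOn_invFunOn hz] at hs
  have h1 : f '' (s ∩ O) ∈ 𝓝 (f z) :=
    hf.nhds_le_map hO hi hz (image_mem_map (inter_mem hs (hO.mem_nhds hz)))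
  rw [mem_map]
  filter_upwards [h1]
  rintro _ ⟨x, hx, rfl⟩
  simpa [hi.leftInvOn_invFunOn hx.2] using hx.1

theorem exists_injOn_of_not_isCriticalPoint (hf : IsHolomorphicMap f) {x : Sphere}
    (hx : ¬ IsCriticalPoint f x) : ∃ O ∈ 𝓝 x, InjOn f O := by
  have hs : HasStrictDerivAt (localExpr f x) (deriv (localExpr f x) 0) 0 :=
    (hf.analyticAt x).hasStrictDerivAt
  have hne : deriv (localExpr f x) 0 ≠ 0 := by
    intro h
    apply hx
    have h1 := (hf.analyticAt x).differentiableAt.hasDerivAt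
    rwa [h] at h1
  have hF := hs.hasStrictFDerivAt_equiv hne
  set e := hF.toOpenPartialHomeomorph (localExpr f x) with he
  have he0 : e.source ∈ 𝓝 (0 : ℂ) :=
    e.open_source.mem_nhds hF.mem_toOpenPartialHomeomorph_source
  refine ⟨param x '' (e.source ∩ {w | f (param x w) = param (f x) (localExpr f x w)}), ?_, ?_⟩
  · rw [← map_param_nhds_zero x]
    exact image_mem_map (inter_mem he0 (hf.eventually_eq x))
  · rintro _ ⟨u, hu, rfl⟩ _ ⟨v, hv, rfl⟩ huv
    rw [hu.2, hv.2] at huv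
    have h1 := (isOpenEmbedding_param (f x)).injective huv
    rw [e.injOn hu.1 hv.1 h1]

/-- A solution of the Abel equation has a critical point wherever the map has one. -/
theorem not_injOn_of_isCriticalPoint (hf : IsHolomorphicMap f) {α : Sphere → ℂ} {Ω V : Set Sphere}
    (hα : HolomorphicOn α Ω) (hΩ : IsOpen Ω) (hfΩ : MapsTo f Ω Ω)
    (habel : ∀ z ∈ Ω, α (f z) = 1 + α z) (hV : IsOpen V) (hVΩ : V ⊆ Ω) {x : Sphere} (hx : x ∈ V)
    (hc : IsCriticalPoint f x) : ¬ InjOn α V := by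
  intro hi
  have h1 := hf.hasDerivAt_comp (hα _ (hfΩ (hVΩ hx))).hasDerivAt hc
  rw [mul_zero] at h1
  have h2 : HasDerivAt (fun w => α (param x w)) 0 0 := by
    refine (h1.sub_const 1).congr_of_eventuallyEq ?_
    filter_upwards [(tendsto_param x) (hΩ.mem_nhds (hVΩ hx))] with w hw
    rw [habel _ hw]; ring
  refine deriv_ne_zero_of_injOn (g := fun w => α (param x w))
    (hV.preimage (isOpenEmbedding_param x).continuous) ((hα.mono hVΩ).differentiableOn x)
    (fun u hu v hv huv => (isOpenEmbedding_param x).injective (hi hu hv huv))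
    (z := 0) (by simpa using hx) h2.deriv

end IsHolomorphicMap

/-! ### Rational maps -/

theorem quot_mul {c : ℂ} (hc : c ≠ 0) (a b : ℂ) : quot (c * a) (c * b) = quot a b := by
  by_cases hb : b = 0
  · simp [hb]
  · rw [quot_of_ne_zero _ hb, quot_of_ne_zero _ (mul_ne_zero hc hb), mul_div_mul_left _ _ hc]

theorem quot_eq_inversion {a b : ℂ} (ha : a ≠ 0) : quot a b = inversion (quot b a) := by
  rw [quot_of_ne_zero _ ha, inversion_coe]
  by_cases hb : b = 0
  · simp [hb]
  · rw [quot_of_ne_zero _ hb, quot_of_ne_zero _ (div_ne_zero hb ha), one_div_div]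

theorem continuousAt_quot {A B : ℂ → ℂ} {w : ℂ} (hA : ContinuousAt A w) (hB : ContinuousAt B w)
    (h : A w ≠ 0 ∨ B w ≠ 0) : ContinuousAt (fun w => quot (A w) (B w)) w := by
  have key : ∀ {A B : ℂ → ℂ}, ContinuousAt A w → ContinuousAt B w → B w ≠ 0 →
      ContinuousAt (fun w => quot (A w) (B w)) w := by
    intro A B hA hB h
    have h1 : ContinuousAt (fun w => ((A w / B w : ℂ) : Sphere)) w :=
      OnePoint.continuous_coe.continuousAt.comp (hA.div hB h)
    refine h1.congr ?_
    filter_upwards [hB.eventually_ne h] with w hw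
    rw [quot_of_ne_zero _ hw]
  rcases h with h | h
  · have h1 := continuous_inversion.continuousAt.comp (key hB hA h)
    refine h1.congr ?_
    filter_upwards [hA.eventually_ne h] with w hw
    rw [quot_eq_inversion hw]
    rfl
  · exact key hA hB h

/-- In every chart a rational map is a quotient of two polynomials without common zeros. -/
theorem exists_ratMap_param_eq_quot (R : RatFunc ℂ) (x : Sphere) : ∃ A B : Polynomial ℂ,
    (∀ w, A.eval w ≠ 0 ∨ B.eval w ≠ 0) ∧
      ∀ w, ratMap R (param x w) = quot (A.eval w) (B.eval w) := by
  have hcop : ∀ z, R.num.eval z ≠ 0 ∨ R.denom.eval z ≠ 0 := by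
    intro z
    obtain ⟨u, v, huv⟩ := R.isCoprime_num_denom
    by_contra! h
    have := congrArg (Polynomial.eval z) huv
    simp [h.1, h.2] at this
  cases x using OnePoint.rec with
  | infty =>
    set d := degree R with hd
    have h0 : ∀ P : Polynomial ℂ, (P.reflect d).eval 0 = P.coeff d := by
      intro P
      rw [← Polynomial.coeff_zero_eq_eval_zero, Polynomial.coeff_reflect]
      rw [Polynomial.revAt_le (Nat.zero_le d), Nat.sub_zero]
    have hne : ∀ P : Polynomial ℂ, P.natDegree ≤ d → ∀ w : ℂ, w ≠ 0 →
        (P.reflect d).eval w = w ^ d * P.eval w⁻¹ := by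
      intro P hP w hw
      let _ : Invertible w⁻¹ := invertibleOfNonzero (inv_ne_zero hw)
      have h1 := Polynomial.eval₂_reflect_mul_pow (RingHom.id ℂ) w⁻¹ d P hP
      simp only [invOf_eq_inv, inv_inv, Polynomial.eval₂_id] at h1
      rw [← h1, inv_pow]
      field_simp
    have hn : R.num.natDegree ≤ d := le_max_left _ _
    have hdn : R.denom.natDegree ≤ d := le_max_right _ _
    refine ⟨R.num.reflect d, R.denom.reflect d, fun w => ?_, fun w => ?_⟩
    · by_cases hw : w = 0
      · subst hw
        rw [h0, h0]
        rcases le_or_gt R.num.natDegree R.denom.natDegree with h | h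
        · right
          rw [hd, degree, max_eq_right h]
          exact Polynomial.leadingCoeff_ne_zero.2 R.denom_ne_zero
        · left
          rw [hd, degree, max_eq_left h.le]
          refine Polynomial.leadingCoeff_ne_zero.2 fun h' => ?_
          simp [h'] at h
      · rw [hne _ hn w hw, hne _ hdn w hw]
        have := pow_ne_zero d hw
        simpa [this, hw] using hcop w⁻¹
    · by_cases hw : w = 0
      · subst hw
        rw [h0, h0, param_zero]
        rfl
      · rw [hne _ hn w hw, hne _ hdn w hw, quot_mul (pow_ne_zero d hw), param_infty,
          quot_of_ne_zero _ hw, one_div]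
        rfl
  | coe a =>
    refine ⟨R.num.comp (Polynomial.C a + Polynomial.X), R.denom.comp (Polynomial.C a +
      Polynomial.X), fun w => ?_, fun w => ?_⟩
    · simpa using hcop (a + w)
    · simp [ratMap]

theorem isHolomorphicMap_ratMap (R : RatFunc ℂ) : IsHolomorphicMap (ratMap R) := by
  constructor
  · rw [continuous_iff_continuousAt]
    intro x
    obtain ⟨A, B, hAB, he⟩ := exists_ratMap_param_eq_quot R x
    have h1 : ContinuousAt (fun w => quot (A.eval w) (B.eval w)) 0 :=
      continuousAt_quot A.continuous.continuousAt B.continuous.continuousAt (hAB 0)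
    rw [ContinuousAt, ← map_param_nhds_zero x, tendsto_map'_iff]
    have h2 : ratMap R x = quot (A.eval 0) (B.eval 0) := by rw [← he 0, param_zero]
    rw [h2]
    exact Tendsto.congr (fun w => (he w).symm) h1
  · intro x
    obtain ⟨A, B, hAB, he⟩ := exists_ratMap_param_eq_quot R x
    have h2 : ratMap R x = quot (A.eval 0) (B.eval 0) := by rw [← he 0, param_zero]
    have hA : AnalyticAt ℂ (fun w => A.eval w) 0 := A.differentiable.analyticAt 0
    have hB : AnalyticAt ℂ (fun w => B.eval w) 0 := B.differentiable.analyticAt 0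
    by_cases hB0 : B.eval 0 = 0
    · have hA0 : A.eval 0 ≠ 0 := (hAB 0).resolve_right (not_not.2 hB0)
      refine (hB.div hA hA0).congr ?_
      filter_upwards [hA.continuousAt.eventually_ne hA0] with w hw
      rw [localExpr, he, h2, hB0, quot_zero, Pi.div_apply]
      by_cases hBw : B.eval w = 0
      · simp [hBw]
      · simp [quot_of_ne_zero _ hBw]
    · refine ((hA.div hB hB0).sub (analyticAt_const (v := A.eval 0 / B.eval 0))).congr ?_
      filter_upwards [hB.continuousAt.eventually_ne hB0] with w hw
      rw [localExpr, he, h2, quot_of_ne_zero _ hB0, quot_of_ne_zero _ hw]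
      simp

/-- A generic value of a rational map of degree at least two is taken at two distinct points: only
finitely many values are taken at a zero of the Wronskian of numerator and denominator. -/
theorem not_injOn_ratMap {R : RatFunc ℂ} (hR : 2 ≤ degree R) {p : Sphere}
    (hp : ratMap R p = p) : ¬ InjOn (ratMap R) {p}ᶜ := by
  set P := R.num with hP
  set Q := R.denom with hQ
  have hQ0 : Q ≠ 0 := R.denom_ne_zero
  set d := degree R with hd
  have hcop : IsCoprime P Q := R.isCoprime_num_denom
  set W := Polynomial.derivative P * Q - P * Polynomial.derivative Q with hW
  have hW0 : W ≠ 0 := by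
    intro h
    have h1 : Polynomial.derivative P * Q = P * Polynomial.derivative Q := sub_eq_zero.1 h
    have h2 : Q ∣ Polynomial.derivative Q :=
      hcop.symm.dvd_of_dvd_mul_left (Dvd.intro_left _ h1)
    have h3 : Polynomial.derivative Q = 0 :=
      Polynomial.eq_zero_of_dvd_of_degree_lt h2 (Polynomial.degree_derivative_lt hQ0)
    have h4 : Polynomial.derivative P = 0 := by
      rw [h3, mul_zero] at h1
      exact (mul_eq_zero.1 h1).resolve_right hQ0
    have h5 := Polynomial.derivative_eq_zero.1 h3
    have h6 := Polynomial.derivative_eq_zero.1 h4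
    have h7 : d = 0 := by
      rw [hd, degree, ← hP, ← hQ, h5, h6, max_self]
    omega
  have hfin : (((fun z => P.eval z / Q.eval z) '' {z | W.IsRoot z}) ∪
      ({P.coeff d / Q.coeff d} ∪ {v : ℂ | (v : Sphere) = p})).Finite := by
    refine ((Polynomial.finite_setOfPred_isRoot hW0).image _).union ((finite_singleton _).union ?_)
    refine Set.Subsingleton.finite fun u hu v hv => OnePoint.coe_injective ?_
    exact Eq.trans hu (Eq.symm hv)
  obtain ⟨v, hv⟩ := hfin.infinite_compl.nonempty
  simp only [mem_compl_iff, mem_union, not_or, mem_singleton_iff, Set.mem_ofPred_eq] at hv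
  obtain ⟨hv1, hv2, hv3⟩ := hv
  set T := P - Polynomial.C v * Q with hT
  have hTd : T.natDegree = d := by
    refine le_antisymm ?_ (Polynomial.le_natDegree_of_ne_zero ?_)
    · refine (Polynomial.natDegree_sub_le _ _).trans (max_le (le_max_left _ _) ?_)
      exact (Polynomial.natDegree_C_mul_le _ _).trans (le_max_right _ _)
    · rw [hT, Polynomial.coeff_sub, Polynomial.coeff_C_mul]
      intro h
      by_cases hq : Q.coeff d = 0
      · rcases le_total P.natDegree Q.natDegree with hl | hl
        · have : d = Q.natDegree := max_eq_right hl
          rw [this] at hq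
          exact Polynomial.leadingCoeff_ne_zero.2 hQ0 hq
        · have h' : d = P.natDegree := max_eq_left hl
          rw [hq, mul_zero, sub_zero, h'] at h
          have h'' : P = 0 := Polynomial.leadingCoeff_eq_zero.1 h
          rw [h'', Polynomial.natDegree_zero] at h'
          omega
      · apply hv2
        rw [eq_div_iff hq]
        exact (sub_eq_zero.1 h).symm
  have hT0 : T ≠ 0 := by
    rintro h
    rw [h, Polynomial.natDegree_zero] at hTd
    omega
  have hroot : ∀ z, T.IsRoot z → Q.eval z ≠ 0 ∧ P.eval z = v * Q.eval z := by
    intro z hz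
    have h1 : P.eval z = v * Q.eval z := by
      have : P.eval z - v * Q.eval z = 0 := by simpa [hT, Polynomial.IsRoot] using hz
      exact sub_eq_zero.1 this
    refine ⟨fun h => ?_, h1⟩
    obtain ⟨a, b, hab⟩ := hcop
    have := congrArg (Polynomial.eval z) hab
    simp [h1, h] at this
  have hnodup : T.roots.Nodup := by
    rw [Multiset.nodup_iff_count_le_one]
    intro z
    rw [Polynomial.count_roots]
    by_contra! h
    obtain ⟨hz, hz'⟩ := (Polynomial.one_lt_rootMultiplicity_iff_isRoot hT0).1 h
    obtain ⟨hq, hpq⟩ := hroot z hz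
    have h1 : (Polynomial.derivative P).eval z = v * (Polynomial.derivative Q).eval z := by
      have : (Polynomial.derivative P).eval z - v * (Polynomial.derivative Q).eval z = 0 := by
        simpa [hT, Polynomial.IsRoot] using hz'
      exact sub_eq_zero.1 this
    refine hv1 ⟨z, ?_, ?_⟩
    · show W.eval z = 0
      simp only [hW, Polynomial.eval_sub, Polynomial.eval_mul, h1, hpq]
      ring
    · simp only
      rw [hpq, mul_div_cancel_right₀ _ hq]
  have hcard : 1 < T.roots.toFinset.card := by
    rw [Multiset.toFinset_card_of_nodup hnodup, (IsAlgClosed.splits T).natDegree_eq_card_roots.symm,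
      hTd]
    omega
  obtain ⟨z₁, hz₁, z₂, hz₂, hne⟩ := Finset.one_lt_card.1 hcard
  have hval : ∀ z ∈ T.roots.toFinset, ratMap R (z : Sphere) = (v : Sphere) := by
    intro z hz
    obtain ⟨hq, hpq⟩ := hroot z (Polynomial.isRoot_of_mem_roots (Multiset.mem_toFinset.1 hz))
    show quot (P.eval z) (Q.eval z) = _
    rw [quot_of_ne_zero _ hq, hpq, mul_div_cancel_right₀ _ hq]
  have hnp : ∀ z ∈ T.roots.toFinset, (z : Sphere) ∈ ({p}ᶜ : Set Sphere) := by
    intro z hz h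
    rw [mem_singleton_iff] at h
    apply hv3
    rw [← hval z hz, h, hp]
  intro hinj
  exact hne (OnePoint.coe_injective (hinj (hnp _ hz₁) (hnp _ hz₂)
    ((hval _ hz₁).trans (hval _ hz₂).symm)))

/-! ### Inverse branches of a Fatou coordinate over right half-planes -/

/-- The open half-plane to the right of the vertical line through `c`. -/
abbrev rightHalfPlane (c : ℝ) : Set ℂ := {w : ℂ | c < w.re}

theorem isOpen_rightHalfPlane (c : ℝ) : IsOpen (rightHalfPlane c) :=
  isOpen_lt continuous_const Complex.continuous_re

theorem convex_rightHalfPlane (c : ℝ) : Convex ℝ (rightHalfPlane c) :=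
  convex_halfSpace_re_gt c

theorem rightHalfPlane_nonempty (c : ℝ) : (rightHalfPlane c).Nonempty :=
  ⟨((c + 1 : ℝ) : ℂ), by simp⟩

/-- Two continuous sections of `α` over a preconnected set agree if they agree at a point and one
of them takes its values in an open set on which `α` is injective. -/
theorem eqOn_of_sections {α : Sphere → ℂ} {S : Set ℂ} {ψ ψ' : ℂ → Sphere} {V : Set Sphere}
    (hSo : IsOpen S) (hS : IsPreconnected S) (hψ : ContinuousOn ψ S) (hψ' : ContinuousOn ψ' S)
    (hV : IsOpen V) (hi : InjOn α V) (hm : MapsTo ψ' S V) (h1 : ∀ w ∈ S, α (ψ w) = w)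
    (h2 : ∀ w ∈ S, α (ψ' w) = w) {w₀ : ℂ} (hw₀ : w₀ ∈ S) (he : ψ w₀ = ψ' w₀) : EqOn ψ ψ' S := by
  have hu : IsOpen (S ∩ ψ ⁻¹' V) := hψ.isOpen_inter_preimage hSo hV
  have hv : IsOpen (S ∩ (fun w => (ψ w, ψ' w)) ⁻¹' (diagonal Sphere)ᶜ) :=
    (hψ.prodMk hψ').isOpen_inter_preimage hSo isClosed_diagonal.isOpen_compl
  have hkey : ∀ w ∈ S ∩ ψ ⁻¹' V, ψ w = ψ' w := fun w hw =>
    hi hw.2 (hm hw.1) ((h1 w hw.1).trans (h2 w hw.1).symm)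
  have hsub : S ⊆ S ∩ ψ ⁻¹' V := by
    refine hS.subset_left_of_subset_union hu hv ?_ ?_ ⟨w₀, hw₀, hw₀, ?_⟩
    · rw [Set.disjoint_left]
      exact fun w hw hw' => hw'.2 (hkey w hw)
    · intro w hw
      by_cases h : ψ w = ψ' w
      · left
        refine ⟨hw, ?_⟩
        rw [mem_preimage, h]
        exact hm hw
      · exact Or.inr ⟨hw, h⟩
    · rw [mem_preimage, he]
      exact hm hw₀
  exact fun w hw => hkey w (hsub hw)

theorem inter_frontier_nonempty {X : Type*} [TopologicalSpace X] {t s : Set X}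
    (ht : IsPreconnected t) (hs : IsOpen s) (h1 : (t ∩ s).Nonempty) (h2 : (t ∩ sᶜ).Nonempty) :
    (t ∩ frontier s).Nonempty := by
  by_contra hne
  rw [not_nonempty_iff_eq_empty, hs.frontier_eq] at hne
  have hsub : t ⊆ s := by
    refine ht.subset_left_of_subset_union hs isClosed_closure.isOpen_compl
      (disjoint_compl_right.mono_left subset_closure) (fun x hx => ?_) h1
    by_contra hx'
    rw [mem_union, not_or, notMem_compl_iff] at hx'
    have : x ∈ t ∩ (closure s \ s) := ⟨hx, hx'.2, hx'.1⟩
    simp [hne] at this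
  obtain ⟨x, hx, hxs⟩ := h2
  exact hxs (hsub hx)

/-- `V` is the image of a branch of `α⁻¹` over the half-plane to the right of `c`. -/
structure IsSheet (α : Sphere → ℂ) (Ω V : Set Sphere) (c : ℝ) : Prop where
  isOpen : IsOpen V
  subset : V ⊆ Ω
  bijOn : BijOn α V (rightHalfPlane c)

theorem IsSheet.nonempty {α : Sphere → ℂ} {Ω V : Set Sphere} {c : ℝ} (hV : IsSheet α Ω V c) :
    V.Nonempty := by
  obtain ⟨w, hw⟩ := rightHalfPlane_nonempty c
  obtain ⟨z, hz, -⟩ := hV.bijOn.surjOn hw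
  exact ⟨z, hz⟩

/-- The basin `Ω` of a parabolic fixed point `p` of the map `f`, with a solution `α` of the Abel
equation on `Ω` that has an inverse branch, with image `V₀`, over some right half-plane. The set
`V₀` absorbs all orbits in `Ω`, and its points tend to `p` as `α` tends to infinity. -/
structure IsFatouBasin (f : Sphere → Sphere) (p : Sphere) (Ω : Set Sphere) (α : Sphere → ℂ)
    (V₀ : Set Sphere) (c₀ : ℝ) : Prop where
  holomorphic : IsHolomorphicMap f
  map_self : f p = p
  not_isCriticalPoint : ¬ IsCriticalPoint f p
  isOpen : IsOpen Ω
  notMem : p ∉ Ω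
  map_mem_iff : ∀ z, f z ∈ Ω ↔ z ∈ Ω
  holomorphicOn : HolomorphicOn α Ω
  abel : ∀ z ∈ Ω, α (f z) = 1 + α z
  sheet : IsSheet α Ω V₀ c₀
  mapsTo : MapsTo f V₀ V₀
  near : ∀ D ∈ 𝓝 p, ∃ T : ℝ, ∀ z ∈ V₀, T < ‖α z‖ → z ∈ D
  absorb : ∀ z ∈ Ω, ∃ k : ℕ, f^[k] z ∈ V₀

namespace IsFatouBasin

variable {f : Sphere → Sphere} {p : Sphere} {Ω V₀ : Set Sphere} {α : Sphere → ℂ} {c₀ : ℝ}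

theorem continuousOn_invFunOn (h : IsFatouBasin f p Ω α V₀ c₀) {V : Set Sphere} {c : ℝ}
    (hV : IsSheet α Ω V c) : ContinuousOn (Function.invFunOn α V) (rightHalfPlane c) := by
  rw [← hV.bijOn.image_eq]
  exact (h.holomorphicOn.mono hV.subset).continuousOn_invFunOn hV.isOpen hV.bijOn.injOn

theorem isPreconnected_sheet (h : IsFatouBasin f p Ω α V₀ c₀) {V : Set Sphere} {c : ℝ}
    (hV : IsSheet α Ω V c) : IsPreconnected V := by
  have h1 := (convex_rightHalfPlane c).isPreconnected.image _ (h.continuousOn_invFunOn hV)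
  rwa [← hV.bijOn.image_eq, hV.bijOn.injOn.invFunOn_image Subset.rfl] at h1

/-- Sheets with a common point are nested. -/
theorem sheet_subset (h : IsFatouBasin f p Ω α V₀ c₀) {V V' : Set Sphere} {c c' : ℝ}
    (hV : IsSheet α Ω V c) (hV' : IsSheet α Ω V' c') (hc : c' ≤ c) (hne : (V ∩ V').Nonempty) :
    V ⊆ V' := by
  obtain ⟨z, hz, hz'⟩ := hne
  have hsub : rightHalfPlane c ⊆ rightHalfPlane c' := fun w hw => hc.trans_lt hw
  have he := eqOn_of_sections (isOpen_rightHalfPlane c) (convex_rightHalfPlane c).isPreconnected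
    (h.continuousOn_invFunOn hV) ((h.continuousOn_invFunOn hV').mono hsub) hV'.isOpen
    hV'.bijOn.injOn (fun w hw => hV'.bijOn.surjOn.mapsTo_invFunOn (hsub hw))
    (fun w hw => hV.bijOn.surjOn.rightInvOn_invFunOn hw)
    (fun w hw => hV'.bijOn.surjOn.rightInvOn_invFunOn (hsub hw)) (hV.bijOn.mapsTo hz)
    (by rw [hV.bijOn.injOn.leftInvOn_invFunOn hz, hV'.bijOn.injOn.leftInvOn_invFunOn hz'])
  intro y hy
  have h1 := he (hV.bijOn.mapsTo hy)
  rw [hV.bijOn.injOn.leftInvOn_invFunOn hy] at h1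
  rw [h1]
  exact hV'.bijOn.surjOn.mapsTo_invFunOn (hsub (hV.bijOn.mapsTo hy))

theorem mem_of_lt_re (h : IsFatouBasin f p Ω α V₀ c₀) {V : Set Sphere} {c : ℝ}
    (hV : IsSheet α Ω V c) (h0 : V₀ ⊆ V) {z : Sphere} (hz : z ∈ V) (hc : c₀ < (α z).re) :
    z ∈ V₀ := by
  obtain ⟨y, hy, hyz⟩ := h.sheet.bijOn.surjOn hc
  rwa [← hV.bijOn.injOn (h0 hy) hz hyz]

theorem mapsTo_sheet (h : IsFatouBasin f p Ω α V₀ c₀) {V : Set Sphere} {c : ℝ}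
    (hV : IsSheet α Ω V c) (h0 : V₀ ⊆ V) : MapsTo f V V := by
  obtain ⟨y, hy⟩ := h.sheet.nonempty
  have hsub : rightHalfPlane (c + 1) ⊆ rightHalfPlane c := fun w hw => by
    have : c + 1 < w.re := hw
    show c < w.re
    linarith
  have hm : MapsTo (fun w : ℂ => w - 1) (rightHalfPlane (c + 1)) (rightHalfPlane c) := by
    intro w hw
    have : c + 1 < w.re := hw
    show c < (w - 1).re
    simp only [Complex.sub_re, Complex.one_re]
    linarith
  have hadd : ∀ w ∈ rightHalfPlane c, 1 + w ∈ rightHalfPlane (c + 1) := by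
    intro w hw
    have : c < w.re := hw
    show c + 1 < (1 + w).re
    simp only [Complex.add_re, Complex.one_re]
    linarith
  have he := eqOn_of_sections (isOpen_rightHalfPlane (c + 1))
    (convex_rightHalfPlane (c + 1)).isPreconnected
    (ψ := fun w => f (Function.invFunOn α V (w - 1)))
    (h.holomorphic.continuous.comp_continuousOn
      ((h.continuousOn_invFunOn hV).comp (by fun_prop) hm))
    ((h.continuousOn_invFunOn hV).mono hsub) hV.isOpen hV.bijOn.injOn
    (fun w hw => hV.bijOn.surjOn.mapsTo_invFunOn (hsub hw))
    (fun w hw => by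
      rw [h.abel _ (hV.subset (hV.bijOn.surjOn.mapsTo_invFunOn (hm hw))),
        hV.bijOn.surjOn.rightInvOn_invFunOn (hm hw)]
      ring)
    (fun w hw => hV.bijOn.surjOn.rightInvOn_invFunOn (hsub hw))
    (hadd _ (hV.bijOn.mapsTo (h0 hy)))
    (by
      rw [add_sub_cancel_left, hV.bijOn.injOn.leftInvOn_invFunOn (h0 hy),
        ← h.abel _ (h.sheet.subset hy), hV.bijOn.injOn.leftInvOn_invFunOn (h0 (h.mapsTo hy))])
  intro z hz
  have hw := hadd _ (hV.bijOn.mapsTo hz)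
  have h1 := he hw
  simp only [add_sub_cancel_left, hV.bijOn.injOn.leftInvOn_invFunOn hz] at h1
  rw [h1]
  exact hV.bijOn.surjOn.mapsTo_invFunOn (hsub hw)

/-- The points of a sheet tend to `p` as `α` tends to infinity. This is propagated to the left in
steps of length one: a small disc `D` around `p` has no point of `f⁻¹(p)` on its boundary, so for
large `w` the image of the segment `[w, w + 1]` cannot leave `D`. -/
theorem near_of_sheet (h : IsFatouBasin f p Ω α V₀ c₀) {V : Set Sphere} {c : ℝ}
    (hV : IsSheet α Ω V c) (h0 : V₀ ⊆ V) :
    ∀ D ∈ 𝓝 p, ∃ T : ℝ, ∀ z ∈ V, T < ‖α z‖ → z ∈ D := by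
  have hstep : ∀ k : ℕ, ∀ D ∈ 𝓝 p, ∃ T : ℝ, ∀ z ∈ V, c₀ - k < (α z).re → T < ‖α z‖ → z ∈ D := by
    intro k
    induction k with
    | zero =>
      intro D hD
      obtain ⟨T, hT⟩ := h.near D hD
      exact ⟨T, fun z hz hc hn => hT z (h.mem_of_lt_re hV h0 hz (by simpa using hc)) hn⟩
    | succ k ih =>
      intro D hD
      obtain ⟨O, hO, hi⟩ := h.holomorphic.exists_injOn_of_not_isCriticalPoint h.not_isCriticalPoint
      obtain ⟨D₁, hD₁, hcl, hsub⟩ := exists_mem_nhds_isClosed_subset (inter_mem hD hO)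
      set D' := interior D₁ with hD'
      have hpD' : p ∈ D' := mem_interior_iff_mem_nhds.2 hD₁
      have hclD' : closure D' ⊆ D ∩ O :=
        (closure_minimal interior_subset hcl).trans hsub
      have hfr : p ∉ f '' frontier D' := by
        rintro ⟨x, hx, hxp⟩
        have hxO : x ∈ O := (hclD' (frontier_subset_closure hx)).2
        have hpO : p ∈ O := (hclD' (subset_closure hpD')).2
        have : x = p := hi hxO hpO (hxp.trans h.map_self.symm)
        rw [this, isOpen_interior.frontier_eq] at hx
        exact hx.2 hpD'
      have hcomp : IsClosed (f '' frontier D') :=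
        (isClosed_frontier.isCompact.image h.holomorphic.continuous).isClosed
      obtain ⟨T, hT⟩ := ih ((f '' frontier D')ᶜ ∩ D')
        (inter_mem (hcomp.isOpen_compl.mem_nhds hfr) (isOpen_interior.mem_nhds hpD'))
      refine ⟨T + 2, fun z hz hc hn => ?_⟩
      have hline : ∀ t ∈ Icc (0 : ℝ) 1, α z + t ∈ rightHalfPlane c := by
        intro t ht
        have : c < (α z).re := hV.bijOn.mapsTo hz
        show c < (α z + t).re
        simp only [Complex.add_re, Complex.ofReal_re]
        linarith [ht.1]
      set γ : ℝ → Sphere := fun t => Function.invFunOn α V (α z + t) with hγ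
      have hγV : ∀ t ∈ Icc (0 : ℝ) 1, γ t ∈ V ∧ α (γ t) = α z + t := fun t ht =>
        ⟨hV.bijOn.surjOn.mapsTo_invFunOn (hline t ht),
          hV.bijOn.surjOn.rightInvOn_invFunOn (hline t ht)⟩
      have hγc : ContinuousOn γ (Icc 0 1) :=
        (h.continuousOn_invFunOn hV).comp (by fun_prop) hline
      have hγ0 : γ 0 = z := by simp [hγ, hV.bijOn.injOn.leftInvOn_invFunOn hz]
      have hnorm : ∀ t ∈ Icc (0 : ℝ) 2, T < ‖α z + t‖ := by
        intro t ht
        have h1 : ‖α z‖ ≤ ‖α z + t‖ + ‖(t : ℂ)‖ := by simpa using norm_sub_le (α z + t) t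
        rw [Complex.norm_real, Real.norm_of_nonneg ht.1] at h1
        linarith [ht.2]
      have hpre := isPreconnected_Icc.image γ hγc
      by_contra hzD
      have hne1 : (γ '' Icc 0 1 ∩ D').Nonempty := by
        refine ⟨γ 1, mem_image_of_mem _ (by simp), ?_⟩
        obtain ⟨h1, h2⟩ := hγV 1 (by simp)
        refine (hT _ h1 ?_ ?_).2
        · rw [h2]
          push_cast at hc
          simp only [Complex.add_re, Complex.ofReal_re]
          linarith
        · rw [h2]; exact hnorm 1 (by constructor <;> norm_num)
      have hne2 : (γ '' Icc 0 1 ∩ D'ᶜ).Nonempty :=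
        ⟨z, ⟨0, by simp, hγ0⟩, fun hz' => hzD (hclD' (subset_closure hz')).1⟩
      obtain ⟨_, ⟨t, ht, rfl⟩, htf⟩ := inter_frontier_nonempty hpre isOpen_interior hne1 hne2
      obtain ⟨h1, h2⟩ := hγV t ht
      have h3 : α (f (γ t)) = α z + (t + 1 : ℝ) := by
        rw [h.abel _ (hV.subset h1), h2]; push_cast; ring
      refine (hT _ (h.mapsTo_sheet hV h0 h1) ?_ ?_).1 (mem_image_of_mem f htf)
      · rw [h3]
        push_cast at hc
        simp only [Complex.add_re, Complex.ofReal_re]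
        linarith [ht.1]
      · rw [h3]; exact hnorm _ (by constructor <;> linarith [ht.1, ht.2])
  intro D hD
  obtain ⟨k, hk⟩ := exists_nat_gt (c₀ - c)
  obtain ⟨T, hT⟩ := hstep k D hD
  refine ⟨T, fun z hz hn => hT z hz ?_ hn⟩
  have : c < (α z).re := hV.bijOn.mapsTo hz
  linarith

theorem mem_closure_sheet (h : IsFatouBasin f p Ω α V₀ c₀) {V : Set Sphere} {c : ℝ}
    (hV : IsSheet α Ω V c) (h0 : V₀ ⊆ V) : p ∈ closure V := by
  rw [mem_closure_iff_nhds]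
  intro D hD
  obtain ⟨T, hT⟩ := h.near_of_sheet hV h0 D hD
  have hw : ((max c T + |c| + |T| + 1 : ℝ) : ℂ) ∈ rightHalfPlane c := by
    show c < (((max c T + |c| + |T| + 1 : ℝ) : ℂ)).re
    rw [Complex.ofReal_re]
    linarith [le_max_left c T, abs_nonneg c, abs_nonneg T]
  obtain ⟨z, hz, hzw⟩ := hV.bijOn.surjOn hw
  refine ⟨z, hT z hz ?_, hz⟩
  rw [hzw, Complex.norm_real]
  refine lt_of_lt_of_le ?_ (le_abs_self _)
  linarith [le_max_right c T, abs_nonneg c, abs_nonneg T]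

theorem re_le_of_mem_closure (h : IsFatouBasin f p Ω α V₀ c₀) {V : Set Sphere} {c : ℝ}
    (hV : IsSheet α Ω V c) {x : Sphere} (hx : x ∈ closure V) (hxΩ : x ∈ Ω) : c ≤ (α x).re := by
  have h1 : ContinuousAt (fun z => (α z).re) x :=
    Complex.continuous_re.continuousAt.comp (h.holomorphicOn.continuousAt hxΩ)
  by_contra! hlt
  obtain ⟨z, hz, hzV⟩ := mem_closure_iff_nhds.1 hx _ (h1 (gt_mem_nhds hlt))
  have hzc : c < (α z).re := hV.bijOn.mapsTo hzV
  exact lt_asymm hz hzc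

/-- The closure of a sheet adds to it only the point `p` and points over the boundary line, which
`f` maps back into the sheet. -/
theorem eq_or_map_mem_of_mem_closure (h : IsFatouBasin f p Ω α V₀ c₀) {V : Set Sphere} {c : ℝ}
    (hV : IsSheet α Ω V c) (h0 : V₀ ⊆ V) {x : Sphere} (hx : x ∈ closure V) :
    x = p ∨ f x ∈ V := by
  by_contra! hcon
  obtain ⟨hxp, hfx⟩ := hcon
  obtain ⟨E, D, hE, hD, hxE, hpD, hdis⟩ := t2_separation hxp
  obtain ⟨T, hT⟩ := h.near_of_sheet hV h0 D (hD.mem_nhds hpD)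
  have : (𝓝[V] x).NeBot := mem_closure_iff_nhdsWithin_neBot.1 hx
  set F := Ultrafilter.of (𝓝[V] x) with hF
  have hFle : (F : Filter Sphere) ≤ 𝓝[V] x := Ultrafilter.of_le _
  have hFV : ∀ᶠ z in (F : Filter Sphere), z ∈ V := hFle self_mem_nhdsWithin
  have hFE : ∀ᶠ z in (F : Filter Sphere), z ∈ E :=
    hFle (mem_nhdsWithin_of_mem_nhds (hE.mem_nhds hxE))
  have hball : Metric.closedBall (0 : ℂ) T ∈ F.map α := by
    show ∀ᶠ z in (F : Filter Sphere), α z ∈ Metric.closedBall (0 : ℂ) T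
    filter_upwards [hFV, hFE] with z hzV hzE
    rw [mem_closedBall_zero_iff]
    by_contra! hlt
    exact Set.disjoint_left.1 hdis hzE (hT z hzV hlt)
  obtain ⟨w, -, hw⟩ := (isCompact_closedBall (0 : ℂ) T).ultrafilter_le_nhds' _ hball
  have hw' : Tendsto α F (𝓝 w) := hw
  have hcw : c ≤ w.re := by
    refine ge_of_tendsto ((Complex.continuous_re.tendsto w).comp hw') ?_
    filter_upwards [hFV] with z hz
    exact (hV.bijOn.mapsTo hz : c < (α z).re).le
  have hw1 : 1 + w ∈ rightHalfPlane c := by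
    show c < (1 + w).re
    simp only [Complex.add_re, Complex.one_re]
    linarith
  have hcont : ContinuousAt (Function.invFunOn α V) (1 + w) :=
    (h.continuousOn_invFunOn hV).continuousAt ((isOpen_rightHalfPlane c).mem_nhds hw1)
  have h1 : Tendsto f F (𝓝 (Function.invFunOn α V (1 + w))) := by
    refine (hcont.tendsto.comp (hw'.const_add 1)).congr' ?_
    filter_upwards [hFV] with z hz
    rw [Function.comp, ← h.abel z (hV.subset hz),
      hV.bijOn.injOn.leftInvOn_invFunOn (h.mapsTo_sheet hV h0 hz)]
  have h2 : Tendsto f F (𝓝 (f x)) :=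
    (h.holomorphic.continuous.tendsto x).mono_left (hFle.trans nhdsWithin_le_nhds)
  apply hfx
  rw [tendsto_nhds_unique h2 h1]
  exact hV.bijOn.surjOn.mapsTo_invFunOn hw1

theorem mem_of_mem_closure (h : IsFatouBasin f p Ω α V₀ c₀) {V : Set Sphere} {c : ℝ}
    (hV : IsSheet α Ω V c) {x : Sphere} (hx : x ∈ closure V) (hxΩ : x ∈ Ω) (hc : c < (α x).re) :
    x ∈ V := by
  have hcont : ContinuousAt (Function.invFunOn α V) (α x) :=
    (h.continuousOn_invFunOn hV).continuousAt ((isOpen_rightHalfPlane c).mem_nhds hc)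
  have : (𝓝[V] x).NeBot := mem_closure_iff_nhdsWithin_neBot.1 hx
  have h1 : Tendsto id (𝓝[V] x) (𝓝 (Function.invFunOn α V (α x))) := by
    refine (hcont.tendsto.comp ((h.holomorphicOn.continuousAt hxΩ).mono_left
      nhdsWithin_le_nhds)).congr' ?_
    filter_upwards [self_mem_nhdsWithin] with z hz
    exact hV.bijOn.injOn.leftInvOn_invFunOn hz
  have h2 : Tendsto id (𝓝[V] x) (𝓝 x) := tendsto_id.mono_left nhdsWithin_le_nhds
  rw [tendsto_nhds_unique h2 h1]
  exact hV.bijOn.surjOn.mapsTo_invFunOn hc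

theorem injOn_map_sheet (h : IsFatouBasin f p Ω α V₀ c₀) {V : Set Sphere} (hs : V ⊆ Ω)
    (hi : InjOn α V) : InjOn f V := by
  intro x hx y hy hxy
  refine hi hx hy (add_left_cancel (a := 1) ?_)
  rw [← h.abel _ (hs hx), ← h.abel _ (hs hy), hxy]

/-- If no critical point lies on the boundary of a sheet, then `f` is injective on its closure:
over a small half-disc at a boundary point, local inverse branches of `α` at two preimages would
both continue the branch that defines the sheet. -/
theorem injOn_closure_sheet (h : IsFatouBasin f p Ω α V₀ c₀) {V : Set Sphere} {c : ℝ}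
    (hV : IsSheet α Ω V c) (h0 : V₀ ⊆ V) (hcrit : ∀ x ∈ frontier V, ¬ IsCriticalPoint f x) :
    InjOn f (closure V) := by
  have hpV : p ∉ V := fun hp => h.notMem (hV.subset hp)
  have hloc : ∀ x ∈ closure V, f x ∈ V → ∀ E, IsOpen E → x ∈ E →
      ∃ O, IsOpen O ∧ x ∈ O ∧ O ⊆ E ∩ Ω ∧ InjOn α O := by
    intro x hx hfx E hE hxE
    have hxΩ : x ∈ Ω := (h.map_mem_iff x).1 (hV.subset hfx)
    by_cases hxV : x ∈ V
    · exact ⟨E ∩ V, hE.inter hV.isOpen, ⟨hxE, hxV⟩, inter_subset_inter_right _ hV.subset,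
        hV.bijOn.injOn.mono inter_subset_right⟩
    · have hxf : x ∈ frontier V := by rw [hV.isOpen.frontier_eq]; exact ⟨hx, hxV⟩
      obtain ⟨O, hO, hi⟩ := h.holomorphic.exists_injOn_of_not_isCriticalPoint (hcrit x hxf)
      refine ⟨(E ∩ Ω) ∩ (interior O ∩ f ⁻¹' V), (hE.inter h.isOpen).inter
        (isOpen_interior.inter (hV.isOpen.preimage h.holomorphic.continuous)),
        ⟨⟨hxE, hxΩ⟩, mem_interior_iff_mem_nhds.2 hO, hfx⟩, inter_subset_left, ?_⟩
      rintro u ⟨⟨-, hu⟩, huO, hfu⟩ v ⟨⟨-, hv⟩, hvO, hfv⟩ huv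
      refine hi (interior_subset huO) (interior_subset hvO) (hV.bijOn.injOn hfu hfv ?_)
      rw [h.abel _ hu, h.abel _ hv, huv]
  intro x hx y hy hxy
  rcases h.eq_or_map_mem_of_mem_closure hV h0 hx with rfl | hfx
  · rcases h.eq_or_map_mem_of_mem_closure hV h0 hy with rfl | hfy
    · rfl
    · rw [← hxy, h.map_self] at hfy
      exact absurd hfy hpV
  have hfy : f y ∈ V := hxy ▸ hfx
  by_contra hne
  obtain ⟨Ex, Ey, hEx, hEy, hxE, hyE, hdis⟩ := t2_separation hne
  obtain ⟨X, hXo, hxX, hXs, hXi⟩ := hloc x hx hfx Ex hEx hxE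
  obtain ⟨Y, hYo, hyY, hYs, hYi⟩ := hloc y hy hfy Ey hEy hyE
  have hxy' : α x = α y := by
    refine add_left_cancel (a := 1) ?_
    rw [← h.abel _ (hXs hxX).2, ← h.abel _ (hYs hyY).2, hxy]
  have hhX : HolomorphicOn α X := h.holomorphicOn.mono fun z hz => (hXs hz).2
  have hhY : HolomorphicOn α Y := h.holomorphicOn.mono fun z hz => (hYs hz).2
  have hnX : α '' X ∈ 𝓝 (α x) := hhX.nhds_le_map hXo hXi hxX (image_mem_map (hXo.mem_nhds hxX))
  have hnY : α '' Y ∈ 𝓝 (α x) := by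
    rw [hxy']
    exact hhY.nhds_le_map hYo hYi hyY (image_mem_map (hYo.mem_nhds hyY))
  obtain ⟨r, hr, hrs⟩ := Metric.mem_nhds_iff.1 (inter_mem hnX hnY)
  set S := Metric.ball (α x) r ∩ rightHalfPlane c with hS
  have hSo : IsOpen S := Metric.isOpen_ball.inter (isOpen_rightHalfPlane c)
  have hSc : IsPreconnected S :=
    ((convex_ball (α x) r).inter (convex_rightHalfPlane c)).isPreconnected
  have key : ∀ u ∈ closure V, ∀ Z, IsOpen Z → u ∈ Z → Z ⊆ Ω → InjOn α Z → α u = α x →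
      Metric.ball (α x) r ⊆ α '' Z →
      ∀ w ∈ S, Function.invFunOn α V w ∈ Z := by
    intro u hu Z hZ huZ hZΩ hZi hux hZr
    have hcu : ContinuousAt α u := h.holomorphicOn.continuousAt (hZΩ huZ)
    have hball : α ⁻¹' Metric.ball (α x) r ∈ 𝓝 u :=
      hcu (by rw [hux]; exact Metric.ball_mem_nhds _ hr)
    obtain ⟨v, ⟨hvZ, hvr⟩, hvV⟩ := mem_closure_iff_nhds.1 hu _ (inter_mem (hZ.mem_nhds huZ) hball)
    have hsurj : SurjOn α Z (Metric.ball (α x) r) := hZr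
    have he := eqOn_of_sections hSo hSc
      ((h.continuousOn_invFunOn hV).mono inter_subset_right)
      (((h.holomorphicOn.mono hZΩ).continuousOn_invFunOn hZ hZi).mono
        (inter_subset_left.trans hZr))
      hZ hZi (fun w hw => hsurj.mapsTo_invFunOn hw.1)
      (fun w hw => hV.bijOn.surjOn.rightInvOn_invFunOn hw.2)
      (fun w hw => hsurj.rightInvOn_invFunOn hw.1)
      (⟨hvr, hV.bijOn.mapsTo hvV⟩ : α v ∈ S)
      (by rw [hV.bijOn.injOn.leftInvOn_invFunOn hvV, hZi.leftInvOn_invFunOn hvZ])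
    intro w hw
    rw [he hw]
    exact hsurj.mapsTo_invFunOn hw.1
  have hSne : S.Nonempty := by
    have hball : α ⁻¹' Metric.ball (α x) r ∈ 𝓝 x :=
      h.holomorphicOn.continuousAt (hXs hxX).2 (Metric.ball_mem_nhds _ hr)
    obtain ⟨v, hvr, hvV⟩ := mem_closure_iff_nhds.1 hx _ hball
    exact ⟨α v, hvr, hV.bijOn.mapsTo hvV⟩
  obtain ⟨w, hw⟩ := hSne
  have h1 := key x hx X hXo hxX (fun z hz => (hXs hz).2) hXi rfl
    (hrs.trans inter_subset_left) w hw
  have h2 := key y hy Y hYo hyY (fun z hz => (hYs hz).2) hYi hxy'.symm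
    (hrs.trans inter_subset_right) w hw
  exact Set.disjoint_left.1 hdis (hXs h1).1 (hYs h2).1

/-- A sheet without critical points on its boundary extends to a larger half-plane, by pulling it
back under the inverse of `f` on a neighbourhood of its closure. -/
theorem exists_sheet_extension (h : IsFatouBasin f p Ω α V₀ c₀) {V : Set Sphere} {c : ℝ}
    (hV : IsSheet α Ω V c) (h0 : V₀ ⊆ V) (hcrit : ∀ x ∈ frontier V, ¬ IsCriticalPoint f x) :
    ∃ c' < c, ∃ V', IsSheet α Ω V' c' ∧ V ⊆ V' := by
  have hpV : p ∉ V := fun hp => h.notMem (hV.subset hp)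
  obtain ⟨O, hO, hclO, hOi⟩ := (h.injOn_closure_sheet hV h0 hcrit).exists_isOpen_superset
    isClosed_closure.isCompact (fun x _ => h.holomorphic.continuous.continuousAt) (by
      intro x hx
      by_cases hxV : x ∈ V
      · exact ⟨V, hV.isOpen.mem_nhds hxV, h.injOn_map_sheet hV.subset hV.bijOn.injOn⟩
      · refine h.holomorphic.exists_injOn_of_not_isCriticalPoint (hcrit x ?_)
        rw [hV.isOpen.frontier_eq]
        exact ⟨hx, hxV⟩)
  have hfO : IsOpen (f '' O) := h.holomorphic.isOpen_image hO hOi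
  -- over `re w ≥ c + 1` the sheet lies in `f (closure V)`, hence in `f '' O`
  have hright : ∀ z ∈ V, c + 1 ≤ (α z).re → z ∈ f '' O := by
    intro z hz hcz
    refine image_mono hclO ?_
    have hcl : IsClosed (f '' closure V) :=
      (isClosed_closure.isCompact.image h.holomorphic.continuous).isClosed
    have hzc : c < (α z).re := hV.bijOn.mapsTo hz
    have hcont : ContinuousAt (Function.invFunOn α V) (α z) :=
      (h.continuousOn_invFunOn hV).continuousAt ((isOpen_rightHalfPlane c).mem_nhds hzc)
    have ht : Tendsto (fun t : ℝ => α z + t) (𝓝[>] 0) (𝓝 (α z)) := by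
      have : Continuous fun t : ℝ => α z + t := by fun_prop
      have h1 := this.tendsto 0
      simp only [Complex.ofReal_zero, add_zero] at h1
      exact h1.mono_left nhdsWithin_le_nhds
    have h1 := hcont.tendsto.comp ht
    rw [hV.bijOn.injOn.leftInvOn_invFunOn hz] at h1
    refine hcl.mem_of_tendsto h1 ?_
    filter_upwards [self_mem_nhdsWithin] with t ht
    have ht' : (0 : ℝ) < t := ht
    have hw : α z + t - 1 ∈ rightHalfPlane c := by
      show c < (α z + t - 1).re
      simp only [Complex.sub_re, Complex.add_re, Complex.ofReal_re, Complex.one_re]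
      linarith
    obtain ⟨y, hy, hyw⟩ := hV.bijOn.surjOn hw
    refine ⟨y, subset_closure hy, ?_⟩
    rw [← hV.bijOn.injOn.leftInvOn_invFunOn (h.mapsTo_sheet hV h0 hy),
      h.abel _ (hV.subset hy), hyw]
    simp only [Function.comp]
    congr 1
    ring
  set K := (f '' O)ᶜ ∩ closure (V ∩ α ⁻¹' rightHalfPlane (c + 1 / 2)) with hK
  have hKc : IsCompact K := (hfO.isClosed_compl.inter isClosed_closure).isCompact
  have hKV : K ⊆ V := by
    rintro x ⟨hxO, hx⟩
    have hxcl : x ∈ closure V := closure_mono inter_subset_left hx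
    rcases h.eq_or_map_mem_of_mem_closure hV h0 hxcl with rfl | hfx
    · exact absurd ⟨x, hclO hxcl, h.map_self⟩ hxO
    · have hxΩ : x ∈ Ω := (h.map_mem_iff x).1 (hV.subset hfx)
      refine h.mem_of_mem_closure hV hxcl hxΩ ?_
      have h1 : ContinuousAt (fun z => (α z).re) x :=
        Complex.continuous_re.continuousAt.comp (h.holomorphicOn.continuousAt hxΩ)
      by_contra! hlt
      obtain ⟨z, hz, -, hzV⟩ := mem_closure_iff_nhds.1 hx _
        (h1 (gt_mem_nhds (lt_of_le_of_lt hlt (by linarith : c < c + 1 / 2))))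
      have hzc : c + 1 / 2 < (α z).re := hzV
      exact lt_asymm hz hzc
  obtain ⟨m, hm, hKm⟩ : ∃ m < c + 1, ∀ x ∈ K, (α x).re ≤ m := by
    rcases K.eq_empty_or_nonempty with hKe | hKne
    · exact ⟨c, by linarith, by simp [hKe]⟩
    · obtain ⟨x, hx, hmax⟩ := hKc.exists_isMaxOn hKne (f := fun z => (α z).re) fun x hx =>
        (Complex.continuous_re.continuousAt.comp
          (h.holomorphicOn.continuousAt (hV.subset (hKV hx)))).continuousWithinAt
      refine ⟨(α x).re, ?_, fun y hy => hmax hy⟩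
      by_contra! hle
      exact hx.1 (hright x (hKV hx) hle)
  set c' := max (m - 1) (c - 1 / 2) with hc'
  have hc'c : c' < c := max_lt (by linarith) (by linarith)
  have hm' : m ≤ c' + 1 := by linarith [le_max_left (m - 1) (c - 1 / 2)]
  have hc2 : c + 1 / 2 ≤ c' + 1 := by linarith [le_max_right (m - 1) (c - 1 / 2)]
  have hin : ∀ z ∈ V, c' + 1 < (α z).re → z ∈ f '' O := by
    intro z hz hcz
    by_contra hzO
    have : z ∈ K := ⟨hzO, subset_closure ⟨hz, lt_of_le_of_lt hc2 hcz⟩⟩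
    linarith [hKm z this]
  have hαV : ContinuousOn α V := fun z hz =>
    (h.holomorphicOn.continuousAt (hV.subset hz)).continuousWithinAt
  refine ⟨c', hc'c, O ∩ f ⁻¹' (V ∩ α ⁻¹' rightHalfPlane (c' + 1)), ⟨?_, ?_, ?_, ?_, ?_⟩, ?_⟩
  · exact hO.inter ((hαV.isOpen_inter_preimage hV.isOpen
      (isOpen_rightHalfPlane _)).preimage h.holomorphic.continuous)
  · exact fun z hz => (h.map_mem_iff z).1 (hV.subset hz.2.1)
  · rintro z ⟨-, hz, hz'⟩
    have h1 : c' + 1 < (α (f z)).re := hz'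
    rw [h.abel _ ((h.map_mem_iff z).1 (hV.subset hz)), Complex.add_re, Complex.one_re] at h1
    show c' < (α z).re
    linarith
  · rintro u ⟨huO, hu, -⟩ v ⟨hvO, hv, -⟩ huv
    refine hOi huO hvO (hV.bijOn.injOn hu hv ?_)
    rw [h.abel _ ((h.map_mem_iff u).1 (hV.subset hu)),
      h.abel _ ((h.map_mem_iff v).1 (hV.subset hv)), huv]
  · intro w hw
    have hw' : c' < w.re := hw
    have hw1 : (1 + w).re = 1 + w.re := by simp
    obtain ⟨y, hy, hyw⟩ := hV.bijOn.surjOn (show 1 + w ∈ rightHalfPlane c by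
      show c < (1 + w).re
      linarith)
    have hyre : c' + 1 < (α y).re := by rw [hyw]; linarith
    obtain ⟨z, hz, rfl⟩ := hin y hy hyre
    refine ⟨z, ⟨hz, hy, hyre⟩, add_left_cancel (a := 1) ?_⟩
    rw [← h.abel _ ((h.map_mem_iff z).1 (hV.subset hy)), hyw]
  · intro z hz
    refine ⟨hclO (subset_closure hz), h.mapsTo_sheet hV h0 hz, ?_⟩
    have h1 : c < (α z).re := hV.bijOn.mapsTo hz
    show c' + 1 < (α (f z)).re
    rw [h.abel _ (hV.subset hz), Complex.add_re, Complex.one_re]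
    linarith

end IsFatouBasin

/-- A holomorphic function, expressed in terms of an injective holomorphic function `α` on the same
domain, is holomorphic. -/
theorem HolomorphicOn.differentiableAt_comp_invFunOn {α μ : Sphere → ℂ} {V : Set Sphere}
    (hV : IsOpen V) (hα : HolomorphicOn α V) (hi : InjOn α V) (hμ : HolomorphicOn μ V)
    {z : Sphere} (hz : z ∈ V) :
    DifferentiableAt ℂ (fun w => μ (Function.invFunOn α V w)) (α z) := by
  set g : ℂ → ℂ := fun w => α (param z w) with hg
  set O := param z ⁻¹' V with hO
  have hOo : IsOpen O := hV.preimage (isOpenEmbedding_param z).continuous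
  have hgd : DifferentiableOn ℂ g O := hα.differentiableOn z
  have hgi : InjOn g O := fun u hu v hv huv => (isOpenEmbedding_param z).injective (hi hu hv huv)
  have h0 : (0 : ℂ) ∈ O := by simpa [hO] using hz
  have hg0 : g 0 = α z := by simp [hg]
  have h1 := (hasDerivAt_invFunOn hOo hgd hgi h0).differentiableAt
  rw [hg0] at h1
  have h2 : DifferentiableAt ℂ (fun w => μ (param z w)) (Function.invFunOn g O (α z)) := by
    rw [← hg0, hgi.leftInvOn_invFunOn h0]
    exact hμ z hz
  refine (h2.comp (α z) h1).congr_of_eventuallyEq ?_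
  have hmem : g '' O ∈ 𝓝 (α z) := by
    rw [← hg0]
    exact (isOpen_image_of_injOn hOo hgd hgi).mem_nhds (mem_image_of_mem g h0)
  filter_upwards [hmem]
  rintro _ ⟨u, hu, rfl⟩
  simp only [Function.comp, hgi.leftInvOn_invFunOn hu]
  rw [show g u = α (param z u) from rfl, hi.leftInvOn_invFunOn hu]

/-- A global holomorphic coordinate on the complement of the point `p` of the sphere: the identity
for `p = ∞`, and `1 / (z - p)` for finite `p`. -/
theorem exists_holomorphicOn_injOn_compl (p : Sphere) :
    ∃ μ : Sphere → ℂ, HolomorphicOn μ {p}ᶜ ∧ InjOn μ {p}ᶜ := by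
  cases p using OnePoint.rec with
  | infty =>
    refine ⟨coord ((0 : ℂ) : Sphere), fun x hx => ?_, fun x hx y hy hxy => ?_⟩
    · cases x using OnePoint.rec with
      | infty => exact absurd rfl hx
      | coe a => simp only [param_coe, coord_coe_coe]; fun_prop
    · cases x using OnePoint.rec with
      | infty => exact absurd rfl hx
      | coe a =>
        cases y using OnePoint.rec with
        | infty => exact absurd rfl hy
        | coe b => simpa using hxy
  | coe a =>
    set μ : Sphere → ℂ := fun x => coord OnePoint.infty (OnePoint.map (fun z => z - a) x) with hμ
    have hμc : ∀ z : ℂ, μ z = (z - a)⁻¹ := fun z => rfl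
    have hμi : μ OnePoint.infty = 0 := rfl
    refine ⟨μ, fun x hx => ?_, fun x hx y hy hxy => ?_⟩
    · cases x using OnePoint.rec with
      | infty =>
        have h1 : DifferentiableAt ℂ (fun w : ℂ => w * (1 - a * w)⁻¹) 0 := by
          refine differentiableAt_id.mul (DifferentiableAt.inv (by fun_prop) (by simp))
        refine h1.congr_of_eventuallyEq (Eventually.of_forall fun w => ?_)
        by_cases hw : w = 0
        · simp [hw, hμi]
        · simp only [param_infty, quot_of_ne_zero _ hw, hμc]
          rw [show 1 / w - a = (1 - a * w) / w by field_simp, inv_div, div_eq_mul_inv]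
      | coe b =>
        have hba : b ≠ a := fun h => hx (by rw [h]; rfl)
        have h1 : DifferentiableAt ℂ (fun w : ℂ => (b + w - a)⁻¹) 0 :=
          DifferentiableAt.inv (by fun_prop) (by simpa using sub_ne_zero.2 hba)
        exact h1
    · have hne : ∀ b : ℂ, (b : Sphere) ∈ ({(a : Sphere)}ᶜ : Set Sphere) → b - a ≠ 0 := by
        intro b hb h
        exact hb (by rw [sub_eq_zero.1 h]; rfl)
      cases x using OnePoint.rec with
      | infty =>
        cases y using OnePoint.rec with
        | infty => rfl
        | coe b => rw [hμi, hμc] at hxy; exact absurd hxy.symm (inv_ne_zero (hne b hy))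
      | coe b =>
        cases y using OnePoint.rec with
        | infty => rw [hμi, hμc] at hxy; exact absurd hxy (inv_ne_zero (hne b hx))
        | coe c =>
          rw [hμc, hμc, inv_inj] at hxy
          rw [sub_left_injective hxy]

/-- A domain that avoids `p` and is conformally equivalent to the plane is the whole complement of
`p`, because the equivalence with the plane is affine in a coordinate that sends `p` to `∞`. -/
theorem eq_compl_singleton_of_bijOn_univ {α : Sphere → ℂ} {V : Set Sphere} {p : Sphere}
    (hV : IsOpen V) (hp : p ∉ V) (hα : HolomorphicOn α V) (hb : BijOn α V univ) : V = {p}ᶜ := by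
  have hsub : V ⊆ {p}ᶜ := fun z hz h => hp (by rwa [mem_singleton_iff.1 h] at hz)
  refine Subset.antisymm hsub fun y hy => ?_
  obtain ⟨μ, hμ, hμi⟩ := exists_holomorphicOn_injOn_compl p
  have hd : Differentiable ℂ fun w => μ (Function.invFunOn α V w) := by
    intro w
    obtain ⟨z, hz, rfl⟩ := hb.surjOn (mem_univ w)
    exact hα.differentiableAt_comp_invFunOn hV hb.injOn (hμ.mono hsub) hz
  have hm : ∀ w, Function.invFunOn α V w ∈ V := fun w =>
    hb.surjOn.mapsTo_invFunOn (mem_univ w)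
  have hi : Function.Injective fun w => μ (Function.invFunOn α V w) := by
    intro u v huv
    have h1 := hμi (hsub (hm u)) (hsub (hm v)) huv
    have h2 := congrArg α h1
    rwa [hb.surjOn.rightInvOn_invFunOn (mem_univ u),
      hb.surjOn.rightInvOn_invFunOn (mem_univ v)] at h2
  obtain ⟨a, b, ha, hab⟩ := exists_eq_affine_of_injective hd hi
  have h1 := hab ((μ y - b) / a)
  rw [mul_div_cancel₀ _ ha, sub_add_cancel] at h1
  rw [← hμi (hsub (hm _)) hy h1]
  exact hm _

namespace IsFatouBasin

variable {f : Sphere → Sphere} {p : Sphere} {Ω V₀ : Set Sphere} {α : Sphere → ℂ} {c₀ : ℝ}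

/-- The union of all sheets is the largest one. If the sheets extended over the whole plane, then
their union would be the complement of `p`, and `f` would be injective there. -/
theorem exists_maximal_sheet (h : IsFatouBasin f p Ω α V₀ c₀) (hn : ¬ InjOn f {p}ᶜ) :
    ∃ V c, IsSheet α Ω V c ∧ V₀ ⊆ V ∧ ∀ V' c', IsSheet α Ω V' c' → V₀ ⊆ V' → c ≤ c' := by
  set C : Set ℝ := {c | ∃ V, IsSheet α Ω V c ∧ V₀ ⊆ V} with hC
  have hne : C.Nonempty := ⟨c₀, V₀, h.sheet, Subset.rfl⟩
  set V : Set Sphere := ⋃₀ {V | ∃ c, IsSheet α Ω V c ∧ V₀ ⊆ V} with hVdef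
  have hVo : IsOpen V := isOpen_sUnion fun V ⟨c, hc, _⟩ => hc.isOpen
  have hVΩ : V ⊆ Ω := sUnion_subset fun V ⟨c, hc, _⟩ => hc.subset
  have h0 : V₀ ⊆ V := subset_sUnion_of_mem ⟨c₀, h.sheet, Subset.rfl⟩
  have hi : InjOn α V := by
    rintro x ⟨X, ⟨c, hX, hX0⟩, hx⟩ y ⟨Y, ⟨d, hY, hY0⟩, hy⟩ hxy
    obtain ⟨z, hz⟩ := h.sheet.nonempty
    rcases le_total c d with hcd | hcd
    · exact hX.bijOn.injOn hx (h.sheet_subset hY hX hcd ⟨z, hY0 hz, hX0 hz⟩ hy) hxy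
    · exact hY.bijOn.injOn (h.sheet_subset hX hY hcd ⟨z, hX0 hz, hY0 hz⟩ hx) hy hxy
  have himage : α '' V = {w : ℂ | ∃ c ∈ C, c < w.re} := by
    ext w
    constructor
    · rintro ⟨x, ⟨X, ⟨c, hX, hX0⟩, hx⟩, rfl⟩
      exact ⟨c, ⟨X, hX, hX0⟩, hX.bijOn.mapsTo hx⟩
    · rintro ⟨c, ⟨X, hX, hX0⟩, hw⟩
      obtain ⟨x, hx, rfl⟩ := hX.bijOn.surjOn hw
      exact ⟨x, ⟨X, ⟨c, hX, hX0⟩, hx⟩, rfl⟩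
  have hbdd : BddBelow C := by
    by_contra hb
    have huniv : α '' V = univ := by
      rw [himage]
      refine eq_univ_of_forall fun w => ?_
      obtain ⟨c, hc, hcw⟩ := not_bddBelow_iff.1 hb w.re
      exact ⟨c, hc, hcw⟩
    have hb : BijOn α V univ := huniv ▸ hi.bijOn_image
    apply hn
    rw [← eq_compl_singleton_of_bijOn_univ hVo (fun hp => h.notMem (hVΩ hp))
      (h.holomorphicOn.mono hVΩ) hb]
    exact h.injOn_map_sheet hVΩ hi
  have himage' : α '' V = rightHalfPlane (sInf C) := by
    rw [himage]
    ext w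
    constructor
    · rintro ⟨c, hc, hw⟩
      exact (csInf_le hbdd hc).trans_lt hw
    · intro hw
      obtain ⟨c, hc, hcw⟩ := exists_lt_of_csInf_lt hne hw
      exact ⟨c, hc, hcw⟩
  exact ⟨V, sInf C, ⟨hVo, hVΩ, himage' ▸ hi.bijOn_image⟩, h0,
    fun V' c' hV' h0' => csInf_le hbdd ⟨V', hV', h0'⟩⟩

/-- Iterates of the closure of a sheet shrink to `p`, as `f` increases `re α` by one. -/
theorem isPetalLike_sheet (h : IsFatouBasin f p Ω α V₀ c₀) {V : Set Sphere} {c : ℝ}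
    (hV : IsSheet α Ω V c) (h0 : V₀ ⊆ V) : IsPetalLike f p V := by
  have hcl : ∀ x ∈ closure V, f x ∈ V ∪ {p} := by
    intro x hx
    rcases h.eq_or_map_mem_of_mem_closure hV h0 hx with rfl | hfx
    · exact Or.inr h.map_self
    · exact Or.inl hfx
  refine ⟨hV.isOpen, ⟨hV.nonempty, h.isPreconnected_sheet hV⟩, ?_, ?_⟩
  · rintro _ ⟨x, hx, rfl⟩
    exact hcl x hx
  · refine Subset.antisymm (fun y hy => ?_) (fun y hy => ?_)
    · by_contra hyp
      have hyp' : y ≠ p := hyp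
      -- a point in the image of `f^k` has `re (α y) ≥ c + k`
      have hre : ∀ k : ℕ, c + k ≤ (α y).re := by
        intro k
        obtain ⟨x, hx, hxy⟩ := mem_iInter.1 hy k
        have hind : ∀ m : ℕ, f^[m] x ≠ p →
            f^[m] x ∈ closure V ∩ Ω ∧ c + m ≤ (α (f^[m] x)).re := by
          intro m
          induction m with
          | zero =>
            intro hne
            have hxΩ : x ∈ Ω := (h.map_mem_iff x).1 (hV.subset
              ((h.eq_or_map_mem_of_mem_closure hV h0 hx).resolve_left hne))
            simpa using ⟨⟨hx, hxΩ⟩, h.re_le_of_mem_closure hV hx hxΩ⟩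
          | succ m ih =>
            intro hne
            rw [Function.iterate_succ_apply'] at hne ⊢
            have hne' : f^[m] x ≠ p := fun he => hne (by rw [he, h.map_self])
            obtain ⟨⟨h1, h2⟩, h3⟩ := ih hne'
            have h4 := (h.eq_or_map_mem_of_mem_closure hV h0 h1).resolve_left hne'
            refine ⟨⟨subset_closure h4, hV.subset h4⟩, ?_⟩
            rw [h.abel _ h2, Complex.add_re, Complex.one_re]
            push_cast
            linarith
        have := (hind k (by rwa [hxy])).2
        rwa [hxy] at this
      obtain ⟨k, hk⟩ := exists_nat_gt ((α y).re - c)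
      linarith [hre k]
    · rw [mem_singleton_iff.1 hy]
      exact mem_iInter.2 fun k => ⟨p, h.mem_closure_sheet hV h0, Function.iterate_fixed h.map_self k⟩

theorem not_isCriticalPoint_of_mem_sheet (h : IsFatouBasin f p Ω α V₀ c₀) {V : Set Sphere} {c : ℝ}
    (hV : IsSheet α Ω V c) {x : Sphere} (hx : x ∈ V) : ¬ IsCriticalPoint f x := fun hc =>
  h.holomorphic.not_injOn_of_isCriticalPoint h.holomorphicOn h.isOpen
    (fun z hz => (h.map_mem_iff z).2 hz) h.abel hV.isOpen hV.subset hx hc hV.bijOn.injOn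

/-- The maximal sheet is the unique sheet invariant under `f` with a critical point of `f` on its
boundary. -/
theorem exists_unique_critical_sheet (h : IsFatouBasin f p Ω α V₀ c₀) (hn : ¬ InjOn f {p}ᶜ) :
    ∃ V c, IsSheet α Ω V c ∧ V₀ ⊆ V ∧ (∃ x ∈ frontier V, x ∈ Ω ∧ IsCriticalPoint f x) ∧
      ∀ W d, IsSheet α Ω W d → MapsTo f W W → (∃ x ∈ frontier W, IsCriticalPoint f x) →
        W = V := by
  obtain ⟨V, c, hV, h0, hmax⟩ := h.exists_maximal_sheet hn
  have hΩ : ∀ x ∈ closure V, IsCriticalPoint f x → x ∈ Ω := by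
    intro x hx hc
    rcases h.eq_or_map_mem_of_mem_closure hV h0 hx with rfl | hfx
    · exact absurd hc h.not_isCriticalPoint
    · exact (h.map_mem_iff x).1 (hV.subset hfx)
  refine ⟨V, c, hV, h0, ?_, fun W d hW hfW ⟨x, hx, hc⟩ => ?_⟩
  · by_contra! hcon
    obtain ⟨c', hc', V', hV', hVV'⟩ := h.exists_sheet_extension hV h0
      fun x hx hc => hcon x hx (hΩ x (frontier_subset_closure hx) hc) hc
    exact absurd (hmax V' c' hV' (h0.trans hVV')) (not_le.2 hc')
  · obtain ⟨w, hw⟩ := hW.nonempty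
    obtain ⟨k, hk⟩ := h.absorb w (hW.subset hw)
    have hne : (W ∩ V).Nonempty := ⟨_, hfW.iterate k hw, h0 hk⟩
    rcases le_total d c with hdc | hdc
    · have hVW : V ⊆ W := h.sheet_subset hV hW hdc (by rwa [inter_comm])
      exact (h.sheet_subset hW hV (hmax W d hW (h0.trans hVW)) hne).antisymm hVW
    · have hWV : W ⊆ V := h.sheet_subset hW hV hdc hne
      have hxW := frontier_subset_closure hx
      have hxV := closure_mono hWV hxW
      have hxΩ := hΩ x hxV hc
      have hle := h.re_le_of_mem_closure hW hxW hxΩ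
      have hdc' : d ≤ c := by
        by_contra! hlt
        exact h.not_isCriticalPoint_of_mem_sheet hV
          (h.mem_of_mem_closure hV hxV hxΩ (hlt.trans_le hle)) hc
      exact hWV.antisymm (h.sheet_subset hV hW hdc' (by rwa [inter_comm]))

end IsFatouBasin

/-! ### Petals of a parabolic fixed point -/

/-- The branch of `z ↦ z ^ (-1 / n)` given by the principal branch of the logarithm. -/
def invRoot (n : ℕ) (z : ℂ) : ℂ := Complex.exp (-Complex.log z / n)

theorem invRoot_ne_zero (n : ℕ) (z : ℂ) : invRoot n z ≠ 0 := Complex.exp_ne_zero _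

theorem invRoot_pow {n : ℕ} (hn : n ≠ 0) {z : ℂ} (hz : z ≠ 0) : invRoot n z ^ n = z⁻¹ := by
  have hn' : (n : ℂ) ≠ 0 := Nat.cast_ne_zero.2 hn
  rw [invRoot, ← Complex.exp_nat_mul, mul_div_cancel₀ _ hn', Complex.exp_neg, Complex.exp_log hz]

theorem norm_invRoot (n : ℕ) {z : ℂ} (hz : z ≠ 0) :
    ‖invRoot n z‖ = ‖z‖ ^ (-(1 / n : ℝ)) := by
  rw [invRoot, Complex.norm_exp, Real.rpow_def_of_pos (norm_pos_iff.2 hz)]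
  congr 1
  rw [Complex.div_natCast_re, Complex.neg_re, Complex.log_re]
  ring

theorem hasDerivAt_invRoot (n : ℕ) {z : ℂ} (hz : z ∈ Complex.slitPlane) :
    HasDerivAt (invRoot n) (invRoot n z * (-z⁻¹ / n)) z :=
  (((Complex.hasDerivAt_log hz).neg).div_const _).cexp

theorem tendsto_invRoot {n : ℕ} (hn : n ≠ 0) : Tendsto (invRoot n) (cocompact ℂ) (𝓝 0) := by
  rw [tendsto_zero_iff_norm_tendsto_zero]
  have h1 : Tendsto (fun x : ℝ => x ^ (-(1 / n : ℝ))) atTop (𝓝 0) :=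
    tendsto_rpow_neg_atTop (by positivity)
  have h2 : Tendsto (fun z : ℂ => ‖z‖) (cocompact ℂ) atTop := tendsto_norm_cocompact_atTop
  refine (h1.comp h2).congr' ?_
  have h3 : ∀ᶠ z : ℂ in cocompact ℂ, z ≠ 0 :=
    (isCompact_singleton (x := (0 : ℂ))).compl_mem_cocompact
  filter_upwards [h3] with z hz
  rw [norm_invRoot n hz]
  rfl

theorem mem_slitPlane_of_mem_sector {R : ℝ} (hR : 0 ≤ R) {z : ℂ} (hz : z ∈ sector R) :
    z ∈ Complex.slitPlane := by
  rw [Complex.mem_slitPlane_iff]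
  by_contra! h
  have hz' : R < z.re + |z.im| := hz
  rw [h.2, abs_zero, add_zero] at hz'
  linarith [h.1]

/-- The sector stays away from the cut of the logarithm, which leaves room for a small change of
argument before the principal branch jumps. -/
theorem abs_arg_lt_of_mem_sector {R : ℝ} (hR : 0 ≤ R) {z : ℂ} (hz : z ∈ sector R) :
    |z.arg| < 3 * Real.pi / 4 := by
  have key : ∀ z : ℂ, 0 ≤ z.im → 0 < z.re + z.im → |z.arg| < 3 * Real.pi / 4 := by
    intro z him hz
    rw [abs_of_nonneg (Complex.arg_nonneg_iff.2 him)]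
    by_contra! hle
    have hcos : Real.cos (z.arg - Real.pi / 4) ≤ 0 :=
      Real.cos_nonpos_of_pi_div_two_le_of_le (by linarith [Real.pi_pos])
        (by linarith [Real.pi_pos, Complex.arg_le_pi z])
    rw [Real.cos_sub, Real.cos_pi_div_four, Real.sin_pi_div_four, ← add_mul] at hcos
    have h1 : Real.cos z.arg + Real.sin z.arg ≤ 0 :=
      nonpos_of_mul_nonpos_left hcos (by positivity)
    have h2 : z.re + z.im = ‖z‖ * (Real.cos z.arg + Real.sin z.arg) := by
      rw [mul_add, Complex.norm_mul_cos_arg, Complex.norm_mul_sin_arg]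
    have h3 := mul_nonpos_of_nonneg_of_nonpos (norm_nonneg z) h1
    linarith
  have hz' : R < z.re + |z.im| := hz
  rcases le_or_gt 0 z.im with him | him
  · rw [abs_of_nonneg him] at hz'
    exact key z him (hR.trans_lt hz')
  · rw [abs_of_neg him] at hz'
    have h1 := key ((starRingEnd ℂ) z) (by simpa using him.le) (by
      simp only [Complex.conj_re, Complex.conj_im]; linarith)
    rw [Complex.arg_conj, if_neg, abs_neg] at h1
    · exact h1
    · intro h
      have := Complex.arg_eq_pi_iff.1 h
      linarith [this.2]

/-- In the coordinate `z = A / w ^ n`, for a suitable constant `A`, a map with a parabolic fixed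
point of multiplicity `n + 1` at `w = 0` is a translation by one up to a term that vanishes at the
fixed point. -/
theorem exists_parabolic_coordinate {f : Sphere → Sphere} {p : Sphere} {n : ℕ}
    (hf : IsHolomorphicMap f) (hp : IsFixedPointOfMultiplicity f p (n + 1)) (hn : n ≠ 0) :
    ∃ A : ℂ, A ≠ 0 ∧ ∃ e Q : ℂ → ℂ, AnalyticAt ℂ e 0 ∧ e 0 = 1 ∧ AnalyticAt ℂ Q 0 ∧ Q 0 = 0 ∧
      ∀ᶠ w in 𝓝 0, f (param p w) = param p (w * e w) ∧
        (w ≠ 0 → A / w ^ n * (e w ^ n)⁻¹ = A / w ^ n + 1 + Q w) := by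
  obtain ⟨hfp, hord⟩ := hp
  have hg := hf.analyticAt p
  obtain ⟨s, hs, hs0, hsw⟩ := ((hg.sub analyticAt_id).analyticOrderAt_eq_natCast).1 hord
  have hn' : (n : ℂ) ≠ 0 := Nat.cast_ne_zero.2 hn
  set e : ℂ → ℂ := fun w => 1 + w ^ n * s w with he
  have hea : AnalyticAt ℂ e 0 := analyticAt_const.add ((analyticAt_id.pow n).mul hs)
  have he0 : e 0 = 1 := by simp [he, hn]
  set q : ℂ → ℂ := fun w => -s w * (∑ i ∈ Finset.range n, e w ^ i) / e w ^ n with hq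
  have hqa : AnalyticAt ℂ q 0 := by
    refine AnalyticAt.div (hs.neg.mul ?_) (hea.pow n) (by simp [he0])
    exact Finset.analyticAt_fun_sum _ fun i _ => hea.pow i
  have hq0 : q 0 = -(n * s 0) := by simp [hq, he0]; ring
  set A : ℂ := (q 0)⁻¹ with hA
  have hq0' : q 0 ≠ 0 := by rw [hq0]; exact neg_ne_zero.2 (mul_ne_zero hn' hs0)
  refine ⟨A, inv_ne_zero hq0', e, fun w => A * q w - 1, hea, he0,
    (analyticAt_const.mul hqa).sub analyticAt_const, by simp [hA, hq0'], ?_⟩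
  filter_upwards [hsw, hf.eventually_eq p, hea.continuousAt.eventually_ne (by simp [he0] : e 0 ≠ 0)]
    with w hw hfw hew
  refine ⟨?_, fun hw0 => ?_⟩
  · rw [hfw, hfp]
    congr 1
    simp only [Pi.sub_apply, id_eq, sub_zero, smul_eq_mul] at hw
    rw [he]
    linear_combination hw
  · have h1 : e w ^ n - 1 = w ^ n * s w * ∑ i ∈ Finset.range n, e w ^ i := by
      rw [← mul_geom_sum, he]; ring
    have h2 : (e w ^ n)⁻¹ = 1 + w ^ n * q w := by
      have hen := pow_ne_zero n hew
      rw [hq]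
      simp only
      field_simp
      linear_combination -h1
    have hwn := pow_ne_zero n hw0
    rw [h2]
    field_simp
    ring

/-- A petal `P` at the parabolic fixed point `p` with its Fatou coordinate `A`, wide enough for
the image of `P` under `A` to contain a right half-plane. -/
structure IsParabolicPetal (f : Sphere → Sphere) (p : Sphere) (P : Set Sphere)
    (A : Sphere → ℂ) : Prop where
  isOpen : IsOpen P
  nonempty : P.Nonempty
  mapsTo : MapsTo f P P
  notMem : p ∉ P
  tendsto : ∀ z ∈ P, Tendsto (fun k => f^[k] z) atTop (𝓝 p)
  holomorphicOn : HolomorphicOn A P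
  injOn : InjOn A P
  abel : ∀ z ∈ P, A (f z) = 1 + A z
  exists_halfPlane : ∃ c, rightHalfPlane c ⊆ A '' P
  near : ∀ D ∈ 𝓝 p, ∃ T : ℝ, ∀ z ∈ P, T < ‖A z‖ → z ∈ D

/-- The change from the chart around a point near `x` to the chart around `x`. -/
theorem exists_transition_symm (x : Sphere) (w₀ : ℂ) : ∃ σ : ℂ → ℂ, DifferentiableAt ℂ σ 0 ∧
    σ 0 = w₀ ∧ ∀ᶠ u in 𝓝 0, param (param x w₀) u = param x (σ u) := by
  cases x using OnePoint.rec with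
  | infty =>
    by_cases hw : w₀ = 0
    · exact ⟨id, differentiableAt_id, hw.symm, by simp [hw]⟩
    · have h0 : w₀⁻¹ + 0 ≠ 0 := by simpa using hw
      refine ⟨fun u => (w₀⁻¹ + u)⁻¹, DifferentiableAt.inv (by fun_prop) h0, by simp, ?_⟩
      have hc : ContinuousAt (fun u : ℂ => w₀⁻¹ + u) 0 := by fun_prop
      filter_upwards [hc.eventually_ne h0] with u hu
      simp [quot_of_ne_zero _ hw, quot_of_ne_zero _ (inv_ne_zero hu)]
  | coe a =>
    exact ⟨fun u => w₀ + u, by fun_prop, by simp, by simp [add_assoc]⟩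

theorem holomorphicOn_image_param {α : Sphere → ℂ} {x : Sphere} {O : Set ℂ} (hO : IsOpen O)
    (h : DifferentiableOn ℂ (fun w => α (param x w)) O) : HolomorphicOn α (param x '' O) := by
  rintro _ ⟨w₀, hw₀, rfl⟩
  obtain ⟨σ, hσ, hσ0, he⟩ := exists_transition_symm x w₀
  have h1 : DifferentiableAt ℂ (fun w => α (param x w)) (σ 0) := by
    rw [hσ0]; exact h.differentiableAt (hO.mem_nhds hw₀)
  refine (h1.comp 0 hσ).congr_of_eventuallyEq ?_
  filter_upwards [he] with u hu
  simp [hu]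

/-- Each of the `n` choices of an `n`-th root `κ` of the constant `A` gives one petal, the image of
a sector in the coordinate `z = A / w ^ n`. -/
theorem exists_isParabolicPetal {f : Sphere → Sphere} {p : Sphere} {n : ℕ} (hn : n ≠ 0)
    {A κ : ℂ} (hA : A ≠ 0) (hκ : κ ^ n = A) {e Q : ℂ → ℂ} (he : AnalyticAt ℂ e 0) (he0 : e 0 = 1)
    (hQ : AnalyticAt ℂ Q 0) (hQ0 : Q 0 = 0)
    (hfe : ∀ᶠ w in 𝓝 0, f (param p w) = param p (w * e w) ∧
        (w ≠ 0 → A / w ^ n * (e w ^ n)⁻¹ = A / w ^ n + 1 + Q w)) :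
    ∃ (P : Set Sphere) (α : Sphere → ℂ) (S : ℝ), IsParabolicPetal f p P α ∧
      (∀ x ∈ P, ∃ z ≠ 0, x = param p (κ * invRoot n z)) ∧
      ∀ z : ℂ, S < z.re → param p (κ * invRoot n z) ∈ P := by
  have hκ0 : κ ≠ 0 := by
    rintro rfl
    exact hA (by rw [← hκ, zero_pow hn])
  have hn' : (n : ℂ) ≠ 0 := Nat.cast_ne_zero.2 hn
  set Φ : ℂ → ℂ := fun z => κ * invRoot n z with hΦ
  have hΦ0 : ∀ z, Φ z ≠ 0 := fun z => mul_ne_zero hκ0 (invRoot_ne_zero n z)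
  have hΦt : Tendsto Φ (cocompact ℂ) (𝓝 0) := by
    simpa using (tendsto_invRoot hn).const_mul κ
  have hΦpow : ∀ z, z ≠ 0 → A / Φ z ^ n = z := by
    intro z hz
    rw [hΦ]
    simp only
    rw [mul_pow, invRoot_pow hn hz, hκ]
    field_simp
  have hΦi : ∀ y z, y ≠ 0 → z ≠ 0 → Φ y = Φ z → y = z := by
    intro y z hy hz h
    rw [← hΦpow y hy, h, hΦpow z hz]
  set G : ℂ → ℂ := fun z => Q (Φ z) with hG
  have hGt : Tendsto G (cocompact ℂ) (𝓝 0) := by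
    have := hQ.continuousAt.tendsto
    rw [hQ0] at this
    exact this.comp hΦt
  have hdQ : ∀ᶠ w in 𝓝 (0 : ℂ), ‖deriv Q w‖ < ‖deriv Q 0‖ + 1 :=
    hQ.deriv.continuousAt.norm.eventually (gt_mem_nhds (by linarith))
  have hlog : ∀ᶠ w in 𝓝 (0 : ℂ), ‖n * Complex.log (e w)‖ < Real.pi / 4 := by
    have h1 : ContinuousAt (fun w => ‖n * Complex.log (e w)‖) 0 := by
      refine (continuousAt_const.mul (he.continuousAt.clog ?_)).norm
      rw [he0]; exact Complex.one_mem_slitPlane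
    refine h1.eventually (gt_mem_nhds ?_)
    simp [he0, Real.pi_pos]
  have hsmall : ∀ᶠ z in cocompact ℂ, (f (param p (Φ z)) = param p (Φ z * e (Φ z)) ∧
      (Φ z ≠ 0 → A / Φ z ^ n * (e (Φ z) ^ n)⁻¹ = A / Φ z ^ n + 1 + Q (Φ z))) ∧
      DifferentiableAt ℂ Q (Φ z) ∧ ‖deriv Q (Φ z)‖ < ‖deriv Q 0‖ + 1 ∧
      ‖n * Complex.log (e (Φ z))‖ < Real.pi / 4 ∧ e (Φ z) ≠ 0 ∧ ‖G z‖ ≤ 1 / 4 := by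
    have h1 := hΦt.eventually (hfe.and ((hQ.eventually_analyticAt.mono fun w hw =>
      hw.differentiableAt).and (hdQ.and (hlog.and
        (he.continuousAt.eventually_ne (by simp [he0] : e 0 ≠ 0))))))
    have h2 : ∀ᶠ z in cocompact ℂ, ‖G z‖ < 1 / 4 := by
      have := hGt.norm.eventually (gt_mem_nhds (by simp : ‖(0 : ℂ)‖ < 1 / 4))
      exact this
    filter_upwards [h1, h2] with z hz hz2
    exact ⟨hz.1, hz.2.1, hz.2.2.1, hz.2.2.2.1, hz.2.2.2.2, hz2.le⟩
  rw [← Metric.cobounded_eq_cocompact, ← comap_norm_atTop, eventually_comap,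
    eventually_atTop] at hsmall
  obtain ⟨T, hT⟩ := hsmall
  set R : ℝ := 2 * (|T| + 1) with hR
  have hRpos : 0 < R := by positivity
  have hsec : ∀ z ∈ sector R, z ≠ 0 ∧ z ∈ Complex.slitPlane ∧ T ≤ ‖z‖ := by
    intro z hz
    refine ⟨?_, mem_slitPlane_of_mem_sector hRpos.le hz, ?_⟩
    · exact Complex.slitPlane_ne_zero (mem_slitPlane_of_mem_sector hRpos.le hz)
    · linarith [half_lt_norm_of_mem_sector hz, le_abs_self T]
  have hΦd : ∀ z ∈ sector R, HasDerivAt Φ (κ * (invRoot n z * (-z⁻¹ / n))) z := fun z hz =>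
    (hasDerivAt_invRoot n (hsec z hz).2.1).const_mul κ
  -- the functional equation `f ∘ Φ = Φ ∘ F`, for the principal branch of the root
  have hconj : ∀ z ∈ sector R, f (param p (Φ z)) = param p (Φ (z + 1 + G z)) := by
    intro z hz
    obtain ⟨hz0, -, hzT⟩ := hsec z hz
    obtain ⟨⟨h1, h2⟩, -, -, h5, h6, -⟩ := hT ‖z‖ hzT z rfl
    have h7 := h2 (hΦ0 z)
    rw [hΦpow z hz0] at h7
    rw [h1]
    congr 1
    have hexp : Complex.exp (Complex.log z - n * Complex.log (e (Φ z))) = z + 1 + G z := by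
      rw [Complex.exp_sub, Complex.exp_nat_mul, Complex.exp_log hz0, Complex.exp_log h6, ← h7]
      rfl
    have him : |(Complex.log z - n * Complex.log (e (Φ z))).im| < Real.pi := by
      have h8 := (Complex.abs_im_le_norm (n * Complex.log (e (Φ z)))).trans_lt h5
      have h9 := abs_arg_lt_of_mem_sector hRpos.le hz
      rw [Complex.sub_im, Complex.log_im]
      refine (abs_sub _ _).trans_lt ?_
      linarith
    rw [abs_lt] at him
    have hlogF : Complex.log (z + 1 + G z) = Complex.log z - n * Complex.log (e (Φ z)) := by
      rw [← hexp, Complex.log_exp him.1 him.2.le]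
    have : invRoot n (z + 1 + G z) = invRoot n z * e (Φ z) := by
      rw [invRoot, invRoot, hlogF]
      conv_rhs => rw [← Complex.exp_log h6]
      rw [← Complex.exp_add]
      congr 1
      field_simp
      ring
    simp only [hΦ] at this ⊢
    rw [this]
    ring
  have hGd : ∀ z ∈ sector R, DifferentiableAt ℂ Q (Φ z) := fun z hz =>
    (hT _ (hsec z hz).2.2 z rfl).2.1
  obtain ⟨S, hRS, β, hβd, hβa, hβ⟩ := exists_abel_of_sector (G := G) (R := R)
    (M := (‖deriv Q 0‖ + 1) * ‖κ‖ / n) (δ := 1 / n) hRpos (by positivity)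
    (fun z hz => (hGd z hz).comp z (hΦd z hz).differentiableAt)
    (fun z hz => (hT _ (hsec z hz).2.2 z rfl).2.2.2.2.2)
    (fun z hz => by
      have hd := ((hGd z hz).hasDerivAt.comp z (hΦd z hz)).deriv
      have hz0 := (hsec z hz).1
      have hpos := norm_pos_iff.2 hz0
      have h1 : ‖z‖ ^ (-(1 + 1 / n : ℝ)) = ‖z‖ ^ (-(1 / n : ℝ)) * ‖z‖⁻¹ := by
        rw [neg_add, add_comm, Real.rpow_add hpos, Real.rpow_neg_one]
      have h2 : deriv G z = deriv Q (Φ z) * (κ * (invRoot n z * (-z⁻¹ / n))) := hd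
      rw [h2, h1]
      simp only [norm_mul, norm_div, norm_neg, norm_inv, Complex.norm_natCast]
      rw [norm_invRoot n hz0]
      have h3 := (hT _ (hsec z hz).2.2 z rfl).2.2.1.le
      calc ‖deriv Q (Φ z)‖ * (‖κ‖ * (‖z‖ ^ (-(1 / n : ℝ)) * (‖z‖⁻¹ / n)))
          ≤ (‖deriv Q 0‖ + 1) * (‖κ‖ * (‖z‖ ^ (-(1 / n : ℝ)) * (‖z‖⁻¹ / n))) := by gcongr
        _ = _ := by ring) hGt
  have hGle : ∀ z ∈ sector R, ‖G z‖ ≤ 1 / 4 := fun z hz =>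
    (hT _ (hsec z hz).2.2 z rfl).2.2.2.2.2
  have hSR : sector S ⊆ sector R := sector_anti hRS
  have hFS : ∀ z ∈ sector S, z + 1 + G z ∈ sector S := fun z hz =>
    sector_anti (by linarith) (add_mem_sector hz (hGle z (hSR hz)))
  set χ : ℂ → Sphere := fun z => param p (Φ z) with hχ
  have hΦinj : InjOn Φ (sector S) := fun y hy z hz h =>
    hΦi y z (hsec y (hSR hy)).1 (hsec z (hSR hz)).1 h
  have hχi : InjOn χ (sector S) := fun y hy z hz h =>
    hΦinj hy hz ((isOpenEmbedding_param p).injective h)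
  have hΦdS : DifferentiableOn ℂ Φ (sector S) := fun z hz =>
    (hΦd z (hSR hz)).differentiableAt.differentiableWithinAt
  have hΦo : IsOpen (Φ '' sector S) := isOpen_image_of_injOn (isOpen_sector S) hΦdS hΦinj
  have hχt : Tendsto χ (cocompact ℂ) (𝓝 p) := (tendsto_param p).comp hΦt
  have hβi : InjOn β (sector S) := by
    intro x hx y hy hxy
    have h1 := hβ x hx y hy
    rw [hxy, sub_self, zero_sub, norm_neg] at h1
    have h2 : ‖x - y‖ ≤ 0 := by linarith
    exact sub_eq_zero.1 (norm_le_zero_iff.1 h2)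
  set α : Sphere → ℂ := fun x => β (Function.invFunOn χ (sector S) x) with hα
  have hαχ : ∀ z ∈ sector S, α (χ z) = β z := fun z hz => by
    rw [hα]; simp only; rw [hχi.leftInvOn_invFunOn hz]
  have himage : χ '' sector S = param p '' (Φ '' sector S) := by rw [image_image]
  have hmem1 : ((S + 1 : ℝ) : ℂ) ∈ sector S := mem_sector_of_lt_re (by simp)
  have hfχ : ∀ z ∈ sector S, f (χ z) = χ (z + 1 + G z) := fun z hz => hconj z (hSR hz)
  refine ⟨χ '' sector S, α, S, ⟨?_, ⟨_, mem_image_of_mem χ hmem1⟩, ?_, ?_, ?_, ?_, ?_, ?_, ?_, ?_⟩,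
    ?_, ?_⟩
  · rw [himage]
    exact (isOpenEmbedding_param p).isOpenMap _ hΦo
  · rintro _ ⟨z, hz, rfl⟩
    rw [hfχ z hz]
    exact mem_image_of_mem χ (hFS z hz)
  · rintro ⟨z, hz, h⟩
    refine hΦ0 z ((isOpenEmbedding_param p).injective ?_)
    rw [param_zero]
    exact h
  · rintro _ ⟨z, hz, rfl⟩
    have h1 : ∀ k : ℕ, f^[k] (χ z) = χ ((fun w => w + 1 + G w)^[k] z) := by
      intro k
      induction k with
      | zero => rfl
      | succ k ih =>
        rw [Function.iterate_succ_apply', Function.iterate_succ_apply', ih]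
        exact hfχ _ (sector_anti (by linarith [Nat.cast_nonneg (α := ℝ) k])
          (iterate_mem_sector hGle hRS hz k))
    simp only [h1]
    exact hχt.comp (tendsto_cocompact_of_mem_sector fun k => iterate_mem_sector hGle hRS hz k)
  · rw [himage]
    refine holomorphicOn_image_param hΦo ?_
    rintro _ ⟨z, hz, rfl⟩
    have h1 := (hasDerivAt_invFunOn (isOpen_sector S) hΦdS hΦinj hz).differentiableAt
    have h2 : DifferentiableAt ℂ β (Function.invFunOn Φ (sector S) (Φ z)) := by
      rw [hΦinj.leftInvOn_invFunOn hz]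
      exact hβd.differentiableAt ((isOpen_sector S).mem_nhds hz)
    refine ((h2.comp _ h1).congr_of_eventuallyEq ?_).differentiableWithinAt
    filter_upwards [hΦo.mem_nhds (mem_image_of_mem Φ hz)]
    rintro _ ⟨y, hy, rfl⟩
    rw [Function.comp, hΦinj.leftInvOn_invFunOn hy]
    exact hαχ y hy
  · rintro _ ⟨y, hy, rfl⟩ _ ⟨z, hz, rfl⟩ h
    rw [hαχ y hy, hαχ z hz] at h
    rw [hβi hy hz h]
  · rintro _ ⟨z, hz, rfl⟩
    rw [hfχ z hz, hαχ _ (hFS z hz), hαχ z hz, hβa z hz, add_comm]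
  · obtain ⟨c, hc⟩ := exists_halfPlane_subset_image_sector hβ
    refine ⟨c, fun w hw => ?_⟩
    obtain ⟨z, hz, rfl⟩ := hc hw
    exact ⟨χ z, mem_image_of_mem χ hz, hαχ z hz⟩
  · intro D hD
    have h1 := hχt.eventually hD
    rw [← Metric.cobounded_eq_cocompact, ← comap_norm_atTop, eventually_comap,
      eventually_atTop] at h1
    obtain ⟨T₀, hT₀⟩ := h1
    set z₀ : ℂ := ((S + 1 : ℝ) : ℂ) with hz₀
    refine ⟨‖β z₀‖ + 5 / 4 * (T₀ + ‖z₀‖), ?_⟩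
    rintro _ ⟨z, hz, rfl⟩ hlt
    rw [hαχ z hz] at hlt
    refine hT₀ ‖z‖ ?_ z rfl
    have h2 := hβ z hz z₀ hmem1
    have h3 : ‖β z‖ ≤ ‖β z - β z₀ - (z - z₀)‖ + ‖z - z₀‖ + ‖β z₀‖ := by
      have h4 := norm_add₃_le (a := β z - β z₀ - (z - z₀)) (b := z - z₀) (c := β z₀)
      rwa [show β z - β z₀ - (z - z₀) + (z - z₀) + β z₀ = β z by ring] at h4
    have h5 := norm_sub_le z z₀
    linarith
  · rintro _ ⟨z, hz, rfl⟩
    exact ⟨z, (hsec z (hSR hz)).1, rfl⟩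
  · intro z hz
    exact mem_image_of_mem χ (mem_sector_of_lt_re hz)

/-- The `n` petals at a parabolic fixed point of multiplicity `n + 1`; an orbit that converges to
the fixed point without reaching it is absorbed by one of them. -/
theorem exists_parabolicPetals {f : Sphere → Sphere} {p : Sphere} {n : ℕ}
    (hf : IsHolomorphicMap f) (hp : IsFixedPointOfMultiplicity f p (n + 1)) (hn : n ≠ 0) :
    ∃ (P : Fin n → Set Sphere) (α : Fin n → Sphere → ℂ), (∀ j, IsParabolicPetal f p (P j) (α j)) ∧
      (Pairwise fun i j => Disjoint (P i) (P j)) ∧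
      ∀ z, Tendsto (fun k => f^[k] z) atTop (𝓝 p) → (∀ k, f^[k] z ≠ p) →
        ∃ j k, f^[k] z ∈ P j := by
  obtain ⟨A, hA, e, Q, he, he0, hQ, hQ0, hfe⟩ := exists_parabolic_coordinate hf hp hn
  obtain ⟨κ, hκ⟩ := IsAlgClosed.exists_pow_nat_eq A (Nat.pos_of_ne_zero hn)
  have hκ0 : κ ≠ 0 := by
    rintro rfl
    exact hA (by rw [← hκ, zero_pow hn])
  set ω : ℂ := Complex.exp (2 * Real.pi * Complex.I / n) with hω
  have hprim : IsPrimitiveRoot ω n := Complex.isPrimitiveRoot_exp n hn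
  have hκj : ∀ j : Fin n, (κ * ω ^ (j : ℕ)) ^ n = A := by
    intro j
    rw [mul_pow, ← pow_mul, mul_comm (j : ℕ), pow_mul, hprim.pow_eq_one, one_pow, mul_one, hκ]
  choose P α S hP hPsub hPmem using fun j : Fin n =>
    exists_isParabolicPetal hn hA (hκj j) he he0 hQ hQ0 hfe
  refine ⟨P, α, hP, ?_, ?_⟩
  · intro i j hij
    rw [Set.disjoint_left]
    intro x hxi hxj
    obtain ⟨y, hy0, hy⟩ := hPsub i x hxi
    obtain ⟨z, hz0, hz⟩ := hPsub j x hxj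
    have h1 := (isOpenEmbedding_param p).injective (hy.symm.trans hz)
    have h2 := congrArg (· ^ n) h1
    simp only [mul_pow (κ * _) (invRoot n _), hκj, invRoot_pow hn hy0, invRoot_pow hn hz0] at h2
    have h3 : y = z := inv_injective (mul_left_cancel₀ hA h2)
    rw [h3] at h1
    have h4 := mul_left_cancel₀ hκ0 (mul_right_cancel₀ (invRoot_ne_zero n z) h1)
    exact hij (Fin.ext (hprim.pow_inj i.2 j.2 h4))
  · intro z hz hzp
    set w : ℕ → ℂ := fun k => coord p (f^[k] z) with hw
    have hwt : Tendsto w atTop (𝓝 0) := (tendsto_coord p).comp hz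
    have hQs : ∀ᶠ w in 𝓝 (0 : ℂ), ‖Q w‖ < 1 / 2 := by
      have := hQ.continuousAt.norm.eventually (gt_mem_nhds (by simp [hQ0] : ‖Q 0‖ < 1 / 2))
      exact this
    obtain ⟨K, hK⟩ := eventually_atTop.1 ((hwt.eventually (hfe.and hQs)).and
      (hz.eventually (range_param_mem_nhds p)))
    have hpw : ∀ k ≥ K, param p (w k) = f^[k] z := fun k hk => param_coord (hK k hk).2
    have hw0 : ∀ k ≥ K, w k ≠ 0 := by
      intro k hk h
      have := hpw k hk
      rw [h, param_zero] at this
      exact hzp k this.symm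
    have hstep : ∀ k ≥ K, A / w (k + 1) ^ n = A / w k ^ n + 1 + Q (w k) := by
      intro k hk
      obtain ⟨⟨⟨h1, h2⟩, -⟩, -⟩ := hK k hk
      have h3 : w (k + 1) = w k * e (w k) := by
        refine (isOpenEmbedding_param p).injective ?_
        rw [hpw (k + 1) (by omega), ← h1, hpw k hk, Function.iterate_succ_apply']
      rw [← h2 (hw0 k hk), h3, mul_pow]
      ring
    have hgrow : ∀ m : ℕ, (A / w K ^ n).re + m / 2 ≤ (A / w (K + m) ^ n).re := by
      intro m
      induction m with
      | zero => simp
      | succ m ih =>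
        have h1 := hstep (K + m) (by omega)
        have h2 := neg_le_of_abs_le ((Complex.abs_re_le_norm _).trans
          (hK (K + m) (by omega)).1.2.le)
        rw [← add_assoc, h1, Complex.add_re, Complex.add_re, Complex.one_re]
        push_cast
        linarith
    obtain ⟨B, hB⟩ := (Set.finite_range S).bddAbove
    obtain ⟨m, hm⟩ := exists_nat_gt (2 * (|B| - (A / w K ^ n).re))
    set ζ := A / w (K + m) ^ n with hζ
    have hζB : |B| < ζ.re := by linarith [hgrow m]
    have hwn := pow_ne_zero n (hw0 (K + m) (by omega))
    have hζ0 : ζ ≠ 0 := div_ne_zero hA hwn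
    -- the quotient of `w` by the principal root is an `n`-th root of unity times `κ`
    have hroot : (w (K + m) / (κ * invRoot n ζ)) ^ n = 1 := by
      rw [div_pow, mul_pow, hκ, invRoot_pow hn hζ0, hζ]
      field_simp
    have : NeZero n := ⟨hn⟩
    obtain ⟨i, hi, hiω⟩ := hprim.eq_pow_of_pow_eq_one hroot
    refine ⟨⟨i, hi⟩, K + m, ?_⟩
    rw [← hpw (K + m) (by omega)]
    have hne : κ * invRoot n ζ ≠ 0 := mul_ne_zero hκ0 (invRoot_ne_zero n ζ)
    have h5 : w (K + m) = κ * ω ^ i * invRoot n ζ := by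
      rw [eq_div_iff hne] at hiω
      rw [← hiω]; ring
    rw [h5]
    exact hPmem ⟨i, hi⟩ ζ (lt_of_le_of_lt ((hB ⟨⟨i, hi⟩, rfl⟩).trans (le_abs_self B)) hζB)

/-! ### Basins of the petals of a flower -/

theorem isOpen_basin {f : Sphere → Sphere} {P : Set Sphere} (hf : Continuous f) (hP : IsOpen P) :
    IsOpen (basin f P) := by
  have : basin f P = ⋃ k : ℕ, f^[k] ⁻¹' P := by ext z; simp [basin]
  rw [this]
  exact isOpen_iUnion fun k => hP.preimage (hf.iterate k)

theorem tendsto_iterate_of_iInter_image {g : Sphere → Sphere} {p : Sphere} {K : Set Sphere}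
    (hK : IsClosed K) (hg : ContinuousOn g K) (hm : MapsTo g K K)
    (hi : ⋂ k : ℕ, g^[k] '' K = {p}) {z : Sphere} (hz : z ∈ K) :
    Tendsto (fun k => g^[k] z) atTop (𝓝 p) := by
  have hcont : ∀ k : ℕ, ContinuousOn g^[k] K := by
    intro k
    induction k with
    | zero => exact continuousOn_id
    | succ k ih => exact ih.comp hg hm
  have hcomp : ∀ k : ℕ, IsCompact (g^[k] '' K) := fun k => hK.isCompact.image_of_continuousOn
    (hcont k)
  have hanti : Antitone fun k : ℕ => g^[k] '' K := by
    refine antitone_nat_of_succ_le fun k => ?_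
    rintro _ ⟨x, hx, rfl⟩
    exact ⟨g x, hm hx, rfl⟩
  intro D hD
  obtain ⟨k, hk⟩ := exists_subset_nhds_of_isCompact' (V := fun k : ℕ => g^[k] '' K)
    hanti.directed_ge hcomp (fun k => (hcomp k).isClosed) (U := D) (by
      rw [hi]
      intro x hx
      rwa [mem_singleton_iff.1 hx])
  rw [mem_map]
  filter_upwards [eventually_ge_atTop k] with m hmk
  exact hk (hanti hmk (mem_image_of_mem _ hz))

namespace IsPetalLike

variable {g : Sphere → Sphere} {p : Sphere} {U : Set Sphere}

theorem mem_closure (h : IsPetalLike g p U) : p ∈ closure U := by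
  have h1 : p ∈ ⋂ k : ℕ, g^[k] '' closure U := by rw [h.iInter_image]; rfl
  simpa using mem_iInter.1 h1 0

theorem mapsTo_closure (h : IsPetalLike g p U) : MapsTo g (closure U) (closure U) := by
  intro x hx
  rcases h.image_closure (mem_image_of_mem g hx) with h1 | h1
  · exact subset_closure h1
  · rw [mem_singleton_iff.1 h1]
    exact h.mem_closure

end IsPetalLike

namespace IsFlower

variable {f : Sphere → Sphere} {p : Sphere} {n : ℕ} {N : Set Sphere} {U U' : Fin n → Set Sphere}

/-- An attracting petal does not contain the fixed point: otherwise it would absorb a backward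
orbit in a repelling petal, whose starting point would lie in all forward images of the petal. -/
theorem notMem (h : IsFlower f p n N U U') (hf : IsHolomorphicMap f) (i : Fin n) : p ∉ U i := by
  intro hp
  set g := Function.invFunOn f N with hg
  have hU := (h.attracting i).petalLike
  have hU' := (h.repelling i).petalLike
  have hcl' : closure (U' i) ⊆ f '' N := (h.repelling i).closure_subset.trans inter_subset_right
  have hgc : ContinuousOn g (closure (U' i)) :=
    (hf.continuousOn_invFunOn h.isOpen h.injOn).mono hcl'
  have hfg : ∀ x ∈ closure (U' i), f (g x) = x := fun x hx => Function.invFunOn_eq (hcl' hx)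
  obtain ⟨z, hz, hzp⟩ : ∃ z ∈ U' i, z ≠ p := by
    by_contra! hall
    obtain ⟨y, hy⟩ := hU'.isConnected.nonempty
    have hmem : ({p} : Set Sphere) ∈ 𝓝 p := by
      have hpU : p ∈ U' i := by rwa [← hall y hy]
      exact mem_of_superset (hU'.isOpen.mem_nhds hpU) fun x hx => hall x hx
    have h1 : ({p} : Set Sphere)ᶜ ∩ {p} ∈ 𝓝[≠] p :=
      inter_mem self_mem_nhdsWithin (mem_nhdsWithin_of_mem_nhds hmem)
    rw [compl_inter_self] at h1
    exact empty_notMem _ h1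
  have hzc := subset_closure hz
  have hfgk : ∀ k : ℕ, ∀ x ∈ closure (U' i), f^[k] (g^[k] x) = x := by
    intro k
    induction k with
    | zero => exact fun x _ => rfl
    | succ k ih =>
      intro x hx
      rw [Function.iterate_succ_apply', Function.iterate_succ_apply, ih _ (hU'.mapsTo_closure hx),
        hfg x hx]
  have ht := tendsto_iterate_of_iInter_image isClosed_closure hgc hU'.mapsTo_closure
    hU'.iInter_image hzc
  obtain ⟨K, hK⟩ := eventually_atTop.1 (ht.eventually (hU.isOpen.mem_nhds hp))
  apply hzp
  have hmem : z ∈ ⋂ k : ℕ, f^[k] '' closure (U i) := by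
    refine mem_iInter.2 fun m => ?_
    refine ⟨f^[K] (g^[m + K] z), hU.mapsTo_closure.iterate K
      (subset_closure (hK (m + K) (by omega))), ?_⟩
    rw [← Function.iterate_add_apply, hfgk _ z hzc]
  rw [hU.iInter_image] at hmem
  exact hmem

theorem mapsTo (h : IsFlower f p n N U U') (hf : IsHolomorphicMap f) (hfp : f p = p) (i : Fin n) :
    MapsTo f (U i) (U i) := by
  intro x hx
  rcases (h.attracting i).petalLike.image_closure (mem_image_of_mem f (subset_closure hx))
    with h1 | h1
  · exact h1
  · have hxN : x ∈ N := ((h.attracting i).closure_subset (subset_closure hx)).1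
    have : x = p := h.injOn hxN h.mem ((mem_singleton_iff.1 h1).trans hfp.symm)
    exact absurd (this ▸ hx) (h.notMem hf i)

theorem injOn_attracting (h : IsFlower f p n N U U') (i : Fin n) : InjOn f (U i) :=
  h.injOn.mono fun _ hx => ((h.attracting i).closure_subset (subset_closure hx)).1

/-- An orbit that converges to the fixed point without reaching it enters an attracting petal: it
cannot pass from one repelling petal to another, nor stay in one of them forever. -/
theorem exists_mem (h : IsFlower f p n N U U') {z : Sphere}
    (hz : Tendsto (fun k => f^[k] z) atTop (𝓝 p)) (hzp : ∀ k, f^[k] z ≠ p) :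
    ∃ m k, f^[k] z ∈ U m := by
  by_contra! hno
  set g := Function.invFunOn f N with hg
  obtain ⟨K, hK⟩ := eventually_atTop.1 (hz.eventually h.nhds)
  have hrep : ∀ k ≥ K, ∃ j, f^[k] z ∈ U' j := by
    intro k hk
    rcases hK k hk with (h1 | h1) | h1
    · obtain ⟨m, hm⟩ := mem_iUnion.1 h1
      exact absurd hm (hno m k)
    · exact mem_iUnion.1 h1
    · exact absurd h1 (hzp k)
  obtain ⟨j, hj⟩ := hrep K le_rfl
  have hN : ∀ k i, f^[k] z ∈ U' i → f^[k] z ∈ N := fun k i hi =>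
    ((h.repelling i).closure_subset (subset_closure hi)).1
  have hall : ∀ m, f^[K + m] z ∈ U' j := by
    intro m
    induction m with
    | zero => exact hj
    | succ m ih =>
      obtain ⟨i, hi⟩ := hrep (K + (m + 1)) (by omega)
      have h1 : g (f^[K + (m + 1)] z) = f^[K + m] z := by
        rw [← add_assoc, Function.iterate_succ_apply']
        exact h.injOn.leftInvOn_invFunOn (hN _ j ih)
      have h2 : f^[K + m] z ∈ U' i := by
        rcases (h.repelling i).petalLike.image_closure
          (mem_image_of_mem g (subset_closure hi)) with h3 | h3
        · rwa [h1] at h3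
        · rw [h1] at h3
          exact absurd h3 (hzp _)
      by_cases hij : i = j
      · rwa [← hij]
      · exact absurd ih (Set.disjoint_left.1 (h.disjoint_repelling hij) h2)
  have hback : ∀ m : ℕ, g^[m] (f^[K + m] z) = f^[K] z := by
    intro m
    induction m with
    | zero => rfl
    | succ m ih =>
      rw [Function.iterate_succ_apply, ← add_assoc, Function.iterate_succ_apply',
        show g (f (f^[K + m] z)) = f^[K + m] z from
          h.injOn.leftInvOn_invFunOn (hN _ j (hall m)), ih]
  have hmem : f^[K] z ∈ ⋂ k : ℕ, g^[k] '' closure (U' j) :=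
    mem_iInter.2 fun m => ⟨_, subset_closure (hall m), hback m⟩
  rw [(h.repelling j).petalLike.iInter_image] at hmem
  exact hzp K hmem

theorem tendsto_of_mem (h : IsFlower f p n N U U') (hf : IsHolomorphicMap f) {i : Fin n}
    {z : Sphere} (hz : z ∈ U i) : Tendsto (fun k => f^[k] z) atTop (𝓝 p) :=
  tendsto_iterate_of_iInter_image isClosed_closure hf.continuous.continuousOn
    (h.attracting i).petalLike.mapsTo_closure (h.attracting i).petalLike.iInter_image
    (subset_closure hz)

theorem ne_of_mem (h : IsFlower f p n N U U') (hf : IsHolomorphicMap f) (hfp : f p = p) {i : Fin n}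
    {z : Sphere} (hz : z ∈ U i) (k : ℕ) : f^[k] z ≠ p := fun hk =>
  h.notMem hf i (hk ▸ (h.mapsTo hf hfp i).iterate k hz)

/-- Every attracting petal of a flower has the same basin as one of the parabolic petals. Each
petal of the flower lies in the basin of a single parabolic petal by connectedness, every parabolic
petal occurs in this way, and there are equally many of both. -/
theorem exists_basin_eq (h : IsFlower f p n N U U') (hf : IsHolomorphicMap f)
    (hp : IsFixedPointOfMultiplicity f p (n + 1)) (i : Fin n) :
    ∃ P α, IsParabolicPetal f p P α ∧ basin f (U i) = basin f P := by
  have hfp := hp.1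
  have hn : n ≠ 0 := by rintro rfl; exact i.elim0
  obtain ⟨P, α, hP, hdis, habs⟩ := exists_parabolicPetals hf hp hn
  have hopen : ∀ j, IsOpen (basin f (P j)) := fun j => isOpen_basin hf.continuous (hP j).isOpen
  have hdisj : ∀ j l z, z ∈ basin f (P j) → z ∈ basin f (P l) → j = l := by
    rintro j l z ⟨a, ha⟩ ⟨b, hb⟩
    by_contra hjl
    refine (Set.disjoint_left.1 (hdis hjl) : ∀ ⦃x⦄, x ∈ P j → x ∉ P l) (a := f^[a + b] z) ?_ ?_
    · rw [add_comm, Function.iterate_add_apply]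
      exact (hP j).mapsTo.iterate b ha
    · rw [Function.iterate_add_apply]
      exact (hP l).mapsTo.iterate a hb
  have hex : ∀ m, ∃ j, U m ⊆ basin f (P j) := by
    intro m
    have hcov : ∀ z ∈ U m, ∃ j, z ∈ basin f (P j) := fun z hz =>
      habs z (h.tendsto_of_mem hf hz) (h.ne_of_mem hf hfp hz)
    obtain ⟨z₀, hz₀⟩ := (h.attracting m).petalLike.isConnected.nonempty
    obtain ⟨j, hj⟩ := hcov z₀ hz₀
    refine ⟨j, (h.attracting m).petalLike.isConnected.isPreconnected.subset_left_of_subset_union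
      (hopen j) (isOpen_biUnion fun l (_ : l ∈ {l | l ≠ j}) => hopen l) ?_ ?_ ⟨z₀, hz₀, hj⟩⟩
    · rw [Set.disjoint_left]
      intro z hz hz'
      obtain ⟨l, hl, hzl⟩ := mem_iUnion₂.1 hz'
      exact hl (hdisj l j z hzl hz)
    · intro z hz
      obtain ⟨l, hl⟩ := hcov z hz
      by_cases hlj : l = j
      · exact Or.inl (hlj ▸ hl)
      · exact Or.inr (mem_iUnion₂.2 ⟨l, hlj, hl⟩)
  choose σ hσ using hex
  have hland : ∀ j, ∀ z ∈ P j, ∃ m k, f^[k] z ∈ U m ∧ σ m = j := by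
    intro j z hz
    obtain ⟨m, k, hk⟩ := h.exists_mem ((hP j).tendsto z hz)
      fun k hk => (hP j).notMem (hk ▸ (hP j).mapsTo.iterate k hz)
    exact ⟨m, k, hk, hdisj _ _ _ (hσ m hk) ⟨0, (hP j).mapsTo.iterate k hz⟩⟩
  have hsurj : Function.Surjective σ := by
    intro j
    obtain ⟨z, hz⟩ := (hP j).nonempty
    obtain ⟨m, k, -, hm⟩ := hland j z hz
    exact ⟨m, hm⟩
  have hinj : Function.Injective σ := Finite.injective_iff_surjective.2 hsurj
  refine ⟨P (σ i), α (σ i), hP (σ i), Subset.antisymm ?_ ?_⟩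
  · rintro z ⟨k, hk⟩
    obtain ⟨l, hl⟩ := hσ i hk
    exact ⟨l + k, by rwa [Function.iterate_add_apply]⟩
  · rintro z ⟨k, hk⟩
    obtain ⟨m, l, hl, hm⟩ := hland (σ i) _ hk
    rw [hinj hm] at hl
    exact ⟨l + k, by rwa [Function.iterate_add_apply]⟩

end IsFlower

/-! ### Fatou coordinates on the basin -/

open Classical in
/-- The extension of a solution of the Abel equation on an absorbing set `P` to its basin, with the
value `0` off the basin. -/
def abelExtension (f : Sphere → Sphere) (P : Set Sphere) (α : Sphere → ℂ) (z : Sphere) : ℂ :=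
  if h : ∃ k : ℕ, f^[k] z ∈ P then α (f^[Nat.find h] z) - (Nat.find h : ℕ) else 0

theorem basin_map_mem_iff {f : Sphere → Sphere} {P : Set Sphere} (hm : MapsTo f P P) (z : Sphere) :
    f z ∈ basin f P ↔ z ∈ basin f P := by
  constructor
  · rintro ⟨k, hk⟩
    exact ⟨k + 1, hk⟩
  · rintro ⟨k, hk⟩
    refine ⟨k, ?_⟩
    rw [← Function.iterate_succ_apply, Function.iterate_succ_apply']
    exact hm hk

theorem apply_iterate_of_abel {f : Sphere → Sphere} {Ω : Set Sphere} {α : Sphere → ℂ}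
    (hm : MapsTo f Ω Ω) (habel : ∀ z ∈ Ω, α (f z) = 1 + α z) {z : Sphere} (hz : z ∈ Ω) (k : ℕ) :
    α (f^[k] z) = k + α z := by
  induction k with
  | zero => simp
  | succ k ih =>
    rw [Function.iterate_succ_apply', habel _ (hm.iterate k hz), ih]
    push_cast; ring

namespace IsParabolicPetal

variable {f : Sphere → Sphere} {p : Sphere} {P : Set Sphere} {α : Sphere → ℂ}

theorem abelExtension_eq (h : IsParabolicPetal f p P α) {z : Sphere} {k : ℕ} (hk : f^[k] z ∈ P) :
    abelExtension f P α z = α (f^[k] z) - k := by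
  classical
  have hex : ∃ k : ℕ, f^[k] z ∈ P := ⟨k, hk⟩
  rw [abelExtension, dif_pos hex]
  have hle : Nat.find hex ≤ k := Nat.find_min' hex hk
  obtain ⟨m, hm⟩ := Nat.exists_eq_add_of_le' hle
  have h1 := apply_iterate_of_abel h.mapsTo h.abel (Nat.find_spec hex) m
  rw [← Function.iterate_add_apply, ← hm] at h1
  have h2 : (k : ℂ) = m + (Nat.find hex : ℕ) := by exact_mod_cast hm
  rw [h1, h2]
  ring

theorem abelExtension_abel (h : IsParabolicPetal f p P α) {z : Sphere} (hz : z ∈ basin f P) :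
    abelExtension f P α (f z) = 1 + abelExtension f P α z := by
  obtain ⟨k, hk⟩ := hz
  have h1 : f^[k] (f z) = f (f^[k] z) := by
    rw [← Function.iterate_succ_apply, Function.iterate_succ_apply']
  have h2 : f^[k] (f z) ∈ P := by rw [h1]; exact h.mapsTo hk
  rw [h.abelExtension_eq h2, h.abelExtension_eq hk, h1, h.abel _ hk]
  ring

theorem holomorphicOn_abelExtension (h : IsParabolicPetal f p P α) (hf : IsHolomorphicMap f) :
    HolomorphicOn (abelExtension f P α) (basin f P) := by
  rintro z ⟨k, hk⟩
  have h1 := (hf.holomorphicOn_comp_iterate h.holomorphicOn k z hk).sub_const (k : ℂ)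
  refine h1.congr_of_eventuallyEq ?_
  have h2 : f^[k] ⁻¹' P ∈ 𝓝 z := (h.isOpen.preimage (hf.continuous.iterate k)).mem_nhds hk
  filter_upwards [tendsto_param z h2] with w hw
  exact h.abelExtension_eq hw

theorem notMem_basin (h : IsParabolicPetal f p P α) (hfp : f p = p) : p ∉ basin f P := by
  rintro ⟨k, hk⟩
  rw [Function.iterate_fixed hfp] at hk
  exact h.notMem hk

/-- The extended Fatou coordinate is injective on every forward invariant subset of the basin on
which the map is injective. -/
theorem injOn_abelExtension (h : IsParabolicPetal f p P α) {U : Set Sphere} (hU : U ⊆ basin f P)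
    (hm : MapsTo f U U) (hi : InjOn f U) : InjOn (abelExtension f P α) U := by
  intro x hx y hy hxy
  obtain ⟨a, ha⟩ := hU hx
  obtain ⟨b, hb⟩ := hU hy
  have hx' : f^[a + b] x ∈ P := by
    rw [add_comm, Function.iterate_add_apply]
    exact h.mapsTo.iterate b ha
  have hy' : f^[a + b] y ∈ P := by
    rw [Function.iterate_add_apply]
    exact h.mapsTo.iterate a hb
  rw [h.abelExtension_eq hx', h.abelExtension_eq hy', sub_left_inj] at hxy
  exact hi.iterate hm (a + b) hx hy (h.injOn hx' hy' hxy)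

theorem exists_isFatouBasin (h : IsParabolicPetal f p P α) (hf : IsHolomorphicMap f)
    (hfp : f p = p) (hc : ¬ IsCriticalPoint f p) :
    ∃ V₀ c₀, IsFatouBasin f p (basin f P) (abelExtension f P α) V₀ c₀ := by
  obtain ⟨c, hcP⟩ := h.exists_halfPlane
  have hPb : P ⊆ basin f P := fun z hz => ⟨0, hz⟩
  have heq : ∀ z ∈ P, abelExtension f P α z = α z := by
    intro z hz
    rw [h.abelExtension_eq (k := 0) hz]
    simp
  have hαc : ContinuousOn α P := fun z hz => (h.holomorphicOn.continuousAt hz).continuousWithinAt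
  refine ⟨P ∩ α ⁻¹' rightHalfPlane c, c, hf, hfp, hc, isOpen_basin hf.continuous h.isOpen,
    h.notMem_basin hfp, basin_map_mem_iff h.mapsTo, h.holomorphicOn_abelExtension hf,
    fun z hz => h.abelExtension_abel hz, ⟨?_, inter_subset_left.trans hPb, ?_, ?_, ?_⟩, ?_, ?_, ?_⟩
  · exact hαc.isOpen_inter_preimage h.isOpen (isOpen_rightHalfPlane c)
  · rintro z ⟨hz, hzc⟩
    rw [heq z hz]
    exact hzc
  · rintro y ⟨hy, -⟩ z ⟨hz, -⟩ hyz
    rw [heq y hy, heq z hz] at hyz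
    exact h.injOn hy hz hyz
  · intro w hw
    obtain ⟨z, hz, rfl⟩ := hcP hw
    exact ⟨z, ⟨hz, hw⟩, heq z hz⟩
  · rintro z ⟨hz, hzc⟩
    refine ⟨h.mapsTo hz, ?_⟩
    have h1 : c < (α z).re := hzc
    show c < (α (f z)).re
    rw [h.abel z hz, Complex.add_re, Complex.one_re]
    linarith
  · intro D hD
    obtain ⟨T, hT⟩ := h.near D hD
    exact ⟨T, fun z hz hlt => hT z hz.1 (by rwa [heq z hz.1] at hlt)⟩
  · rintro z ⟨k, hk⟩
    obtain ⟨m, hm⟩ := exists_nat_gt (c - (α (f^[k] z)).re)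
    refine ⟨m + k, ?_⟩
    rw [Function.iterate_add_apply]
    refine ⟨h.mapsTo.iterate m hk, ?_⟩
    show c < (α (f^[m] (f^[k] z))).re
    rw [apply_iterate_of_abel h.mapsTo h.abel hk, Complex.add_re, Complex.natCast_re]
    linarith

end IsParabolicPetal

/-- Fatou coordinates are unique up to an additive constant: `β ∘ α⁻¹` extends by the Abel equation
to an injective entire function that commutes with the translation by one. -/
theorem IsFatouBasin.exists_eq_add_const {f : Sphere → Sphere} {p : Sphere} {Ω V₀ U : Set Sphere}
    {α β : Sphere → ℂ} {c₀ : ℝ} (h : IsFatouBasin f p Ω α V₀ c₀) (hβ : HolomorphicOn β Ω)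
    (habel : ∀ z ∈ Ω, β (f z) = 1 + β z) (hi : InjOn β U) (hm : MapsTo f U U)
    (hU : ∀ z ∈ Ω, ∃ k : ℕ, f^[k] z ∈ U) : ∃ b : ℂ, ∀ z ∈ Ω, β z = α z + b := by
  have hV := h.sheet
  have hfΩ : MapsTo f Ω Ω := fun z hz => (h.map_mem_iff z).2 hz
  set ψ := Function.invFunOn α V₀ with hψ
  have hψV : ∀ w : ℂ, c₀ < w.re → ψ w ∈ V₀ ∧ α (ψ w) = w := fun w hw =>
    ⟨hV.bijOn.surjOn.mapsTo_invFunOn hw, hV.bijOn.surjOn.rightInvOn_invFunOn hw⟩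
  have hψf : ∀ (w : ℂ) (k : ℕ), c₀ < w.re → ψ (w + k) = f^[k] (ψ w) := by
    intro w k hw
    obtain ⟨h1, h2⟩ := hψV w hw
    have h3 := apply_iterate_of_abel hfΩ h.abel (hV.subset h1) k
    rw [h2, add_comm] at h3
    rw [← h3]
    exact hV.bijOn.injOn.leftInvOn_invFunOn (h.mapsTo.iterate k h1)
  set κ : ℂ → ℕ := fun w => ⌈c₀ - w.re⌉₊ + 1 with hκ
  have hκlt : ∀ w : ℂ, c₀ < w.re + κ w := by
    intro w
    have := Nat.le_ceil (c₀ - w.re)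
    simp only [hκ]
    push_cast
    linarith
  set F : ℂ → ℂ := fun w => β (ψ (w + κ w)) - κ w with hF
  have hre : ∀ (w : ℂ) (k : ℕ), (w + k).re = w.re + k := fun w k => by simp
  have hFk : ∀ (w : ℂ) (k : ℕ), c₀ < w.re + k → F w = β (ψ (w + k)) - k := by
    have key : ∀ (w : ℂ) (k m : ℕ), c₀ < w.re + k →
        β (ψ (w + (k + m : ℕ))) - (k + m : ℕ) = β (ψ (w + k)) - k := by
      intro w k m hk
      have hk' : c₀ < (w + k).re := by rwa [hre]
      have h1 := hψf (w + k) m hk'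
      rw [Nat.cast_add, ← add_assoc, h1,
        apply_iterate_of_abel hfΩ habel (hV.subset (hψV _ hk').1)]
      ring
    intro w k hk
    rw [hF]
    simp only
    rw [← key w k (κ w) hk, ← key w (κ w) k (hκlt w), Nat.add_comm]
  have hFd : Differentiable ℂ F := by
    intro w
    have hw : c₀ < (w + κ w).re := by rw [hre]; exact hκlt w
    obtain ⟨h1, h2⟩ := hψV _ hw
    have h3 := (h.holomorphicOn.mono hV.subset).differentiableAt_comp_invFunOn hV.isOpen
      hV.bijOn.injOn (hβ.mono hV.subset) h1
    rw [h2] at h3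
    have h4 : DifferentiableAt ℂ (fun v => β (ψ (v + κ w)) - κ w) w :=
      (h3.comp w (f := fun v : ℂ => v + κ w) (by fun_prop)).sub_const _
    refine h4.congr_of_eventuallyEq ?_
    have hc : ContinuousAt (fun v : ℂ => v.re + κ w) w := by fun_prop
    filter_upwards [hc.eventually (lt_mem_nhds (hκlt w))] with v hv
    exact hFk v (κ w) hv
  have hFi : Function.Injective F := by
    intro v w hvw
    set k := κ v + κ w with hk
    have hvk : c₀ < (v + k).re := by
      have := hκlt v
      rw [hre, hk]; push_cast; linarith [Nat.cast_nonneg (α := ℝ) (κ w)]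
    have hwk : c₀ < (w + k).re := by
      have := hκlt w
      rw [hre, hk]; push_cast; linarith [Nat.cast_nonneg (α := ℝ) (κ v)]
    rw [hFk v k (by rwa [← hre]), hFk w k (by rwa [← hre]), sub_left_inj] at hvw
    obtain ⟨a, ha⟩ := hU _ (hV.subset (hψV _ hvk).1)
    obtain ⟨b, hb⟩ := hU _ (hV.subset (hψV _ hwk).1)
    have h1 : f^[a + b] (ψ (v + k)) ∈ U := by
      rw [add_comm, Function.iterate_add_apply]
      exact hm.iterate b ha
    have h2 : f^[a + b] (ψ (w + k)) ∈ U := by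
      rw [Function.iterate_add_apply]
      exact hm.iterate a hb
    have h3 := hi h1 h2 (by
      rw [apply_iterate_of_abel hfΩ habel (hV.subset (hψV _ hvk).1),
        apply_iterate_of_abel hfΩ habel (hV.subset (hψV _ hwk).1), hvw])
    have h4 := congrArg α h3
    rw [apply_iterate_of_abel hfΩ h.abel (hV.subset (hψV _ hvk).1),
      apply_iterate_of_abel hfΩ h.abel (hV.subset (hψV _ hwk).1), (hψV _ hvk).2,
      (hψV _ hwk).2] at h4
    exact add_right_cancel (add_left_cancel h4)
  obtain ⟨a, b, -, hab⟩ := exists_eq_affine_of_injective hFd hFi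
  have ha : a = 1 := by
    have h1 : F (0 + 1) = F 0 + 1 := by
      have h2 := hFk 0 (κ 0 + 1) (by push_cast; linarith [hκlt 0])
      have h3 := hFk (0 + 1) (κ 0) (by
        have := hκlt 0
        simp only [Complex.add_re, Complex.one_re]; linarith)
      rw [h2, h3]
      push_cast
      rw [show (0 : ℂ) + 1 + κ 0 = 0 + (κ 0 + 1) by ring]
      ring
    rw [hab, hab] at h1
    linear_combination h1
  refine ⟨b, fun z hz => ?_⟩
  obtain ⟨k, hk⟩ := h.absorb z hz
  have h1 := apply_iterate_of_abel hfΩ h.abel hz k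
  have h2 := apply_iterate_of_abel hfΩ habel hz k
  have h3 : c₀ < (α (f^[k] z)).re := hV.bijOn.mapsTo hk
  rw [h1, add_comm, hre] at h3
  have h4 := hFk (α z) k h3
  rw [add_comm, ← h1, hψ, hV.bijOn.injOn.leftInvOn_invFunOn hk, h2, hab, ha] at h4
  linear_combination -h4

theorem not_isCriticalPoint_of_multiplicity {f : Sphere → Sphere} {p : Sphere} {n : ℕ}
    (hf : IsHolomorphicMap f) (hp : IsFixedPointOfMultiplicity f p (n + 1)) (hn : n ≠ 0) :
    ¬ IsCriticalPoint f p := by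
  intro hc
  obtain ⟨s, hs, -, hsw⟩ :=
    (((hf.analyticAt p).sub analyticAt_id).analyticOrderAt_eq_natCast).1 hp.2
  have h1 : HasDerivAt (fun w : ℂ => w ^ (n + 1) * s w) 0 0 := by
    have h2 := (hasDerivAt_pow (n + 1) (0 : ℂ)).mul hs.differentiableAt.hasDerivAt
    refine h2.congr_deriv ?_
    simp [hn]
  have h3 : HasDerivAt (localExpr f p) (1 + 0) 0 := by
    refine ((hasDerivAt_id (0 : ℂ)).add h1).congr_of_eventuallyEq ?_
    filter_upwards [hsw] with w hw
    simp only [Pi.sub_apply, id_eq, sub_zero, smul_eq_mul] at hw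
    simp only [Pi.add_apply, id_eq]
    linear_combination hw
  have := h3.unique hc
  simp at this

end RiemannSphere

end

theorem mainTheorem8 (R : RatFunc ℂ) (hR : 2 ≤ RiemannSphere.degree R)
    (p : OnePoint ℂ) (n : ℕ) (hn : 1 ≤ n)
    (hp : RiemannSphere.IsFixedPointOfMultiplicity (RiemannSphere.ratMap R) p (n + 1))
    (N : Set (OnePoint ℂ)) (U U' : Fin n → Set (OnePoint ℂ))
    (hU : RiemannSphere.IsFlower (RiemannSphere.ratMap R) p n N U U') (i : Fin n) :
    (U i ⊆ RiemannSphere.immediateBasin (RiemannSphere.ratMap R) (U i) ∧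
      ∃ x ∈ RiemannSphere.immediateBasin (RiemannSphere.ratMap R) (U i),
        RiemannSphere.IsCriticalPoint (RiemannSphere.ratMap R) x) ∧
    (∃ α : OnePoint ℂ → ℂ,
      RiemannSphere.IsFatouCoordinate (RiemannSphere.ratMap R) (U i) α) ∧
    ∃ V : Set (OnePoint ℂ), ∀ α : OnePoint ℂ → ℂ,
      RiemannSphere.IsFatouCoordinate (RiemannSphere.ratMap R) (U i) α →
        RiemannSphere.IsPreferredPetal (RiemannSphere.ratMap R) p (U i) α V ∧
        ∀ W : Set (OnePoint ℂ),
          RiemannSphere.IsPreferredPetal (RiemannSphere.ratMap R) p (U i) α W → W = V := by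
  open RiemannSphere in
  have hf := isHolomorphicMap_ratMap R
  have hfp := hp.1
  have hn0 : n ≠ 0 := by omega
  set f := ratMap R
  obtain ⟨P, α, hP, hbasin⟩ := hU.exists_basin_eq hf hp i
  obtain ⟨V₀, c₀, hB⟩ := hP.exists_isFatouBasin hf hfp
    (not_isCriticalPoint_of_multiplicity hf hp hn0)
  obtain ⟨V, c, hV, h0, ⟨x, hx, hxΩ, hxc⟩, huniq⟩ :=
    hB.exists_unique_critical_sheet (not_injOn_ratMap hR hfp)
  rw [← hbasin] at hB hV hxΩ huniq
  have hUm : Set.MapsTo f (U i) (U i) := hU.mapsTo hf hfp i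
  have hUb : U i ⊆ basin f (U i) := fun z hz => ⟨0, hz⟩
  -- the petal `U i` meets the sheet `V`, so both lie in the same component of the basin
  obtain ⟨y, hyU, hyV⟩ : (U i ∩ V).Nonempty := by
    obtain ⟨z, hz⟩ := hV.nonempty
    obtain ⟨k, hk⟩ := hV.subset hz
    exact ⟨_, hk, (hB.mapsTo_sheet hV h0).iterate k hz⟩
  have hcomp : closure V ∩ basin f (U i) ⊆ immediateBasin f (U i) := by
    have h1 : IsPreconnected (closure V ∩ basin f (U i)) :=
      (hB.isPreconnected_sheet hV).subset_closure
        (fun z hz => ⟨subset_closure hz, hV.subset hz⟩) Set.inter_subset_left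
    exact (h1.subset_connectedComponentIn ⟨subset_closure hyV, hUb hyU⟩
      Set.inter_subset_right).trans (Set.subset_biUnion_of_mem
        (u := fun x => connectedComponentIn (basin f (U i)) x) hyU)
  have himm : immediateBasin f (U i) ⊆ basin f (U i) :=
    Set.iUnion₂_subset fun z _ => connectedComponentIn_subset _ z
  refine ⟨⟨fun z hz => Set.mem_biUnion hz (mem_connectedComponentIn (hUb hz)), x,
    hcomp ⟨frontier_subset_closure hx, hxΩ⟩, hxc⟩, ⟨abelExtension f P α, ?_, hB.holomorphicOn,
    hB.abel⟩, V, fun β hβ => ?_⟩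
  · refine hP.injOn_abelExtension ?_ hUm (hU.injOn_attracting i)
    rw [← hbasin]
    exact hUb
  obtain ⟨b, hb⟩ := hB.exists_eq_add_const hβ.holomorphicOn hβ.abel hβ.injOn hUm fun z hz => hz
  have hbij : ∀ (W : Set Sphere) (α₁ α₂ : Sphere → ℂ) (s : ℂ) (d : ℝ),
      (∀ z ∈ W, α₂ z = α₁ z + s) → Set.BijOn α₁ W (rightHalfPlane d) →
      Set.BijOn α₂ W (rightHalfPlane (d + s.re)) := by
    intro W α₁ α₂ s d hs h
    refine ⟨fun z hz => ?_, fun y hy z hz hyz => ?_, fun w hw => ?_⟩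
    · have h1 : d < (α₁ z).re := h.mapsTo hz
      show d + s.re < (α₂ z).re
      rw [hs z hz, Complex.add_re]
      linarith
    · rw [hs y hy, hs z hz] at hyz
      exact h.injOn hy hz (add_right_cancel hyz)
    · have hw' : d + s.re < w.re := hw
      obtain ⟨z, hz, hzw⟩ := h.surjOn (show w - s ∈ rightHalfPlane d by
        show d < (w - s).re
        rw [Complex.sub_re]
        linarith)
      exact ⟨z, hz, by rw [hs z hz, hzw, sub_add_cancel]⟩
  refine ⟨⟨fun z hz => hcomp ⟨subset_closure hz, hV.subset hz⟩, hB.isPetalLike_sheet hV h0,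
    ⟨c + b.re, hbij V _ β b c (fun z hz => hb z (hV.subset hz)) hV.bijOn⟩, x, hx, hxc⟩, ?_⟩
  rintro W ⟨hWsub, hWpetal, ⟨d, hd⟩, hWcrit⟩
  have hWΩ : W ⊆ basin f (U i) := hWsub.trans himm
  refine huniq W (d + (-b).re) ⟨hWpetal.isOpen, hWΩ, hbij W β _ (-b) d (fun z hz => ?_) hd⟩
    (fun z hz => ?_) hWcrit
  · rw [hb z (hWΩ hz)]
    ring
  · rcases hWpetal.image_closure (Set.mem_image_of_mem f (subset_closure hz)) with h1 | h1
    · exact h1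
    · refine absurd ((hB.map_mem_iff z).2 (hWΩ hz)) ?_
      rw [Set.mem_singleton_iff.1 h1]
      exact hB.notMem
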